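/- **Graphs.** A loopless mixed graph on a finite node set $V$ has lines $a - b$, arrows $a\to b$ and arcs $a\leftrightarrow b$, and no loops. Two nodes are adjacent ($a\sim b$) if some edge joins them. Arrows $a\to b$ and arcs $a\leftrightarrow b$ have an arrowhead at $b$. The node $a$ is an ancestor of $b$ if there is a path of arrows $a\to\cdots\to b$. A graph is *ancestral* if no node $i$ is an ancestor of a node $j$ with $j\to i$ or $j\leftrightarrow i$, and no endpoint of a line has an arrowhead at it. An inner node of a path (a sequence of distinct, consecutively adjacent nodes) is a *collider* on the path if both path edges at it have an arrowhead at it. For disjoint $A,B,C\subseteq V$, $A\perp_m B\mid C$ means that there is no path between a node of $A$ and a node of $B$ all of whose colliders are in $C$ or ancestors of nodes in $C$ and all of whose other inner nodes are outside $C$. Two graphs on $V$ are *Markov equivalent* if they have the same relations $A\perp_m B\mid C$. A *maximal ancestral graph* is an ancestral graph in which every two distinct non-adjacent nodes $i,j$ satisfy $i\perp_m j\mid C$ for some $C\subseteq V\setminus\{i,j\}$. A *DAG* has only arrows and no cycle of arrows all pointing in one direction. $H[-]$ is the subgraph of $H$ formed by its lines and their endpoints; it is *chordal* if it has no induced chordless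 cycle with at least $4$ nodes. A *collider path* $\langle i,B,j\rangle$ is a path from $i$ to $j$ with inner nodes $B$, all of which are colliders on it. It is a *minimal collider path* if $i\not\sim j$ and there is no collider path $\langle i,B',j\rangle$ with $B'\subsetneq B$. It is a *minimal collider cycle* if it has at least $3$ nodes, $i\sim j$, and the cycle formed by the path and the edge between $i$ and $j$ is chordless. The length of either is its number of nodes. **Theorem.** Let $H$ be a maximal ancestral graph. Then $H$ is Markov equivalent to some DAG on the same nodes if and only if (*) $H[-]$ is chordal, and $H$ has no minimal collider path and no minimal collider cycle of length $4$. Moreover, if (*) holds, then the following algorithm can always be carried through and terminates, and, whatever choices are made, its output is a DAG that is Markov equivalent to $H$. 1. Number the nodes of $H[-]$ by maximum cardinality search: numbers $1,2,\dots$ are given in turn, each to a not yet numbered node with the largest number of already numbered neighbours in $H[-]$ (ties are broken arbitrarily). 2. Orient every line from the lower to the higher number. 3. As long as possible, choose nodes $i\ne j$, $i\not\sim j$, and $k$ with $i\leftrightarrow k\leftrightarrow j$ or $i\leftrightarrow k\leftarrow j$, and replace these two edges by $i\to k\leftarrow j$. 4. Number the endpoints of arrows by distinct natural numbers such that all arrows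 are from higher numbers to lower ones. 5. Give the remaining endpoints of arcs arbitrary distinct numbers that were not used in step 4. 6. Replace every arc by an arrow from the higher to the lower number. -/

import Mathlib

/-- A loopless mixed graph on the node set `V`: lines `a — b`, arrows `a → b` and arcs `a ↔ b`. -/
structure MixedGraph (V : Type*) where
  line : V → V → Prop
  arrow : V → V → Prop
  arc : V → V → Prop
  line_symm : ∀ {a b}, line a b → line b a
  arc_symm : ∀ {a b}, arc a b → arc b a
  line_irrefl : ∀ a, ¬ line a a
  arrow_irrefl : ∀ a, ¬ arrow a a
  arc_irrefl : ∀ a, ¬ arc a a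

namespace MixedGraph

variable {V : Type*}

/-- `a` and `b` are the endpoints of an edge. -/
def Adj (H : MixedGraph V) (a b : V) : Prop :=
  H.line a b ∨ H.arrow a b ∨ H.arrow b a ∨ H.arc a b

/-- An edge between `a` and `b` has an arrowhead pointing to `b`. -/
def Arrowhead (H : MixedGraph V) (a b : V) : Prop :=
  H.arrow a b ∨ H.arc a b

/-- `a` is an ancestor of `b`: there is a direction-preserving path from `a` to `b`. -/
def Ancestor (H : MixedGraph V) (a b : V) : Prop :=
  Relation.TransGen H.arrow a b

/-- Ancestral graphs. In such a graph there is at most one edge between two nodes, so that a path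
is determined by its sequence of nodes. -/
def IsAncestral (H : MixedGraph V) : Prop :=
  (∀ i j, H.Arrowhead j i → ¬ H.Ancestor i j) ∧
    ∀ i, (∃ j, H.line i j) → ¬ ∃ j, H.Arrowhead j i

/-- `p` is the node sequence of a path between `i` and `j`. -/
def IsPath (H : MixedGraph V) (i j : V) (p : List V) : Prop :=
  p.head? = some i ∧ p.getLast? = some j ∧ p.Nodup ∧ p.IsChain H.Adj

/-- The inner node `b` of the V-configuration `⟨a, b, c⟩` is a collider. -/
def IsCollider (H : MixedGraph V) (a b c : V) : Prop :=
  H.Arrowhead a b ∧ H.Arrowhead c b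

/-- All colliders on the path are in `C ∪ an(C)` and all its other inner nodes are outside `C`. -/
def IsConnecting (H : MixedGraph V) (C : Set V) (p : List V) : Prop :=
  ∀ a b c, [a, b, c] <:+: p →
    (H.IsCollider a b c → b ∈ C ∨ ∃ d ∈ C, H.Ancestor b d) ∧ (¬ H.IsCollider a b c → b ∉ C)

/-- `A` and `B` are `m`-separated given `C` (for disjoint `A`, `B`, `C`, in ancestral graphs). -/
def MSep (H : MixedGraph V) (A B C : Set V) : Prop :=
  ¬ ∃ i ∈ A, ∃ j ∈ B, ∃ p, H.IsPath i j p ∧ H.IsConnecting C p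

/-- The two graphs on `V` have the same `m`-separations. -/
def MarkovEquiv (H G : MixedGraph V) : Prop :=
  ∀ A B C : Set V, Disjoint A B → Disjoint A C → Disjoint B C →
    (H.MSep A B C ↔ G.MSep A B C)

/-- Every two non-adjacent nodes are `m`-separated by some set of other nodes. -/
def IsMaximal (H : MixedGraph V) : Prop :=
  ∀ i j, i ≠ j → ¬ H.Adj i j → ∃ C : Set V, i ∉ C ∧ j ∉ C ∧ H.MSep {i} {j} C

/-- Maximal ancestral graphs. -/
def IsMAG (H : MixedGraph V) : Prop :=
  H.IsAncestral ∧ H.IsMaximal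

/-- Directed acyclic graphs. -/
def IsDAG (G : MixedGraph V) : Prop :=
  (∀ a b, ¬ G.line a b) ∧ (∀ a b, ¬ G.arc a b) ∧ ∀ a, ¬ G.Ancestor a a

/-- A path all of whose inner nodes are colliders. -/
def IsColliderPath (H : MixedGraph V) (i j : V) (p : List V) : Prop :=
  H.IsPath i j p ∧ ∀ a b c, [a, b, c] <:+: p → H.IsCollider a b c

/-- A collider path `⟨i, B, j⟩` with `i`, `j` non-adjacent such that there is no collider path
`⟨i, B', j⟩` with `B'` a proper subset of `B`. -/
def IsMinimalColliderPath (H : MixedGraph V) (i j : V) (p : List V) : Prop :=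
  ¬ H.Adj i j ∧ H.IsColliderPath i j p ∧
    ∀ q, H.IsColliderPath i j q → ¬ {v | v ∈ q} ⊂ {v | v ∈ p}

/-- A collider path `⟨i, B, j⟩` whose endpoints are adjacent and which together with the edge
between `i` and `j` forms a chordless cycle: any other two adjacent nodes on it are consecutive. -/
def IsMinimalColliderCycle (H : MixedGraph V) (i j : V) (p : List V) : Prop :=
  3 ≤ p.length ∧ H.Adj i j ∧ H.IsColliderPath i j p ∧
    ∀ a ∈ p, ∀ b ∈ p, H.Adj a b →
      [a, b] <:+: p ∨ [b, a] <:+: p ∨ (a = i ∧ b = j) ∨ (a = j ∧ b = i)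

/-- The nodes that are endpoints of lines. -/
abbrev LineNode (H : MixedGraph V) : Type _ := {v : V // ∃ w, H.line v w}

/-- The subgraph induced by the lines. -/
def lineSubgraph (H : MixedGraph V) : SimpleGraph H.LineNode where
  Adj a b := H.line a b
  symm := ⟨fun _ _ h => H.line_symm h⟩
  loopless := ⟨fun a h => H.line_irrefl a h⟩

/-- Orient the lines from a lower number to a higher one. -/
def orientLines (H : MixedGraph V) {n : ℕ} (σ : H.LineNode ≃ Fin n) : MixedGraph V where
  line _ _ := False
  arrow a b := H.arrow a b ∨ ∃ h : H.line a b, σ ⟨a, b, h⟩ < σ ⟨b, a, H.line_symm h⟩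
  arc := H.arc
  line_symm h := h
  arc_symm := H.arc_symm
  line_irrefl _ h := h
  arrow_irrefl a h := h.elim (H.arrow_irrefl a) fun ⟨h, _⟩ => H.line_irrefl a h
  arc_irrefl := H.arc_irrefl

/-- Replace the arc between `i` and `k`, if there is one, by an arrow from `i` to `k`. -/
def replaceArc (H : MixedGraph V) (i k : V) : MixedGraph V where
  line := H.line
  arrow a b := H.arrow a b ∨ (H.arc a b ∧ a = i ∧ b = k)
  arc a b := H.arc a b ∧ ¬ (a = i ∧ b = k) ∧ ¬ (a = k ∧ b = i)
  line_symm := H.line_symm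
  arc_symm h := ⟨H.arc_symm h.1, fun e => h.2.2 ⟨e.2, e.1⟩, fun e => h.2.1 ⟨e.2, e.1⟩⟩
  line_irrefl := H.line_irrefl
  arrow_irrefl a h := h.elim (H.arrow_irrefl a) fun h => H.arc_irrefl a h.1
  arc_irrefl a h := H.arc_irrefl a h.1

/-- `K'` arises from `K` by replacing one unshielded collider V-configuration `i ↔ k ↔ j` or
`i ↔ k ← j` by `i → k ← j`. -/
def ColliderStep (K K' : MixedGraph V) : Prop :=
  ∃ i k j, i ≠ j ∧ ¬ K.Adj i j ∧ K.arc i k ∧ K.Arrowhead j k ∧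
    K' = (K.replaceArc i k).replaceArc j k

/-- `K'` arises from `K` by applying `ColliderStep` until it cannot be applied any more. -/
def IsColliderResult (K K' : MixedGraph V) : Prop :=
  Relation.ReflTransGen ColliderStep K K' ∧ ¬ ∃ K'', ColliderStep K' K''

/-- The nodes that are endpoints of arrows. -/
def arrowNodes (K : MixedGraph V) : Set V := {v | ∃ w, K.arrow v w ∨ K.arrow w v}

/-- The nodes that are endpoints of arcs. -/
def arcNodes (K : MixedGraph V) : Set V := {v | ∃ w, K.arc v w}

/-- `f` orders the nodes of the subgraph induced by the arrows in such a way that arrows are from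
higher numbers to lower ones. -/
def IsArrowOrder (K : MixedGraph V) (f : V → ℕ) : Prop :=
  Set.InjOn f K.arrowNodes ∧ ∀ a b, K.arrow a b → f b < f a

/-- `g` keeps the numbers that `f` gives to the endpoints of arrows and gives distinct new numbers
to the remaining endpoints of arcs. -/
def IsArcOrder (K : MixedGraph V) (f g : V → ℕ) : Prop :=
  Set.EqOn g f K.arrowNodes ∧ Set.InjOn g (K.arrowNodes ∪ K.arcNodes)

/-- Replace all arcs by arrows from higher numbers to lower ones. -/
def orientArcs (K : MixedGraph V) (g : V → ℕ) : MixedGraph V where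
  line := K.line
  arrow a b := K.arrow a b ∨ (K.arc a b ∧ g b < g a)
  arc _ _ := False
  line_symm := K.line_symm
  arc_symm h := h
  line_irrefl := K.line_irrefl
  arrow_irrefl a h := h.elim (K.arrow_irrefl a) fun h => K.arc_irrefl a h.1
  arc_irrefl _ h := h

end MixedGraph

/-- A graph without chordless cycles of length at least `4`. -/
def IsChordalGraph {W : Type*} (G : SimpleGraph W) : Prop :=
  ∀ n, 4 ≤ n → IsEmpty (SimpleGraph.cycleGraph n ↪g G)

/-- A maximum cardinality search order, numbered in the order in which the nodes are visited: the
node visited next has, among the nodes not visited so far, as many visited neighbours as possible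
(ties are broken arbitrarily). -/
def IsMCSOrder {W : Type*} (G : SimpleGraph W) (σ : W ≃ Fin (Nat.card W)) : Prop :=
  ∀ v u, σ v ≤ σ u →
    {w | σ w < σ v ∧ G.Adj u w}.ncard ≤ {w | σ w < σ v ∧ G.Adj v w}.ncard

/-- The subgraph induced by the lines is chordal and there is no minimal collider path or cycle
with `4` nodes. -/
def MixedGraph.DAGCondition {V : Type*} (H : MixedGraph V) : Prop :=
  IsChordalGraph H.lineSubgraph ∧
    ¬ ∃ i j p, p.length = 4 ∧ (H.IsMinimalColliderPath i j p ∨ H.IsMinimalColliderCycle i j p)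

/-!
A maximal ancestral graph `H` is compared with a directed acyclic graph by means of connecting
walks instead of paths: `MixedGraph.Reach` records only the last node of such a walk and whether
there is an arrowhead at it, and in ancestral graphs walks join the same nodes as paths
(`IsAncestral.exists_path_iff_reach`). Hence two ancestral graphs are Markov equivalent as soon as
the same nodes are reached from each node given each `C`.

*Necessity.* A directed acyclic graph that is Markov equivalent to `H` has the same adjacencies and
the same unshielded colliders, since it is maximal as well. A chordless cycle of lines would contain
a sink of the directed acyclic graph, which would be an unshielded collider. In a minimal collider
path or cycle with four nodes either both inner nodes are unshielded colliders, so that the inner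
edge would have to be oriented in both directions, or the path is a discriminating one, and
the separation of its end nodes is violated (`MarkovEquiv.dagCondition`).

*Sufficiency.* Without minimal collider paths and cycles with four nodes, any collider path between
non-adjacent nodes contains a node that is on its own a collider between them
(`IsMAG.collidersReduce`): the end nodes of a shortest counterexample could not be separated. A
maximum cardinality search order of a chordal graph is a perfect elimination order
(`IsMCSOrder.adj_of_adj_of_lt`), so that orienting the lines creates no unshielded collider, and
connecting walks in one graph can be turned into connecting walks in the other. The third step of
the algorithm orients exactly the forced arcs, those that belong to an unshielded collider; by the
absence of minimal collider paths and cycles no arc is forced in both directions. A shortest cycle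
of arrows and forced arcs would have to alternate between the two and leads to a collider path that
cannot be shortened (`Orientable.not_transGen_arrowOrForced`). Hence the numberings exist.

For the Markov equivalence the arcs are replaced one at a time, in an order that depends on the
output: the next arc joins the highest node `a` that still has arcs to its lowest neighbour
`b` along an arc. Then the graph stays ancestral, and every edge that points to `a`, or to a node of
a discriminating path for `a`, is accompanied by an edge from the same node that points to `b`
(`ResolvedBy.replaceableArc`). Such edges serve as shortcuts that make up for the
change of the arc to an arrow (`ReplaceableArc.reach_iff`).
-/

namespace MixedGraph

variable {V : Type*}

/-! ### Connecting walks -/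

/-- `y` lies in `C` or is an ancestor of a node in `C`; exactly then a collider `y` is open
given `C`. -/
def AnteSet (H : MixedGraph V) (C : Set V) (y : V) : Prop :=
  y ∈ C ∨ ∃ d ∈ C, H.Ancestor y d

/-- A walk that arrives at `y` (with an arrowhead at `y` iff `m`) may go on to `z` given `C`. -/
def Open (H : MixedGraph V) (C : Set V) (m : Bool) (y z : V) : Prop :=
  (m = true ∧ H.Arrowhead z y ∧ H.AnteSet C y) ∨ (¬ (m = true ∧ H.Arrowhead z y) ∧ y ∉ C)

/-- `H.Reach C i m y`: some walk from `i` to `y` that is connecting given `C` ends with an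
arrowhead at `y` (`m = true`) or without one (`m = false`). The empty walk counts as ending without
an arrowhead, which is harmless if `i ∉ C`. Nodes may be repeated. -/
inductive Reach (H : MixedGraph V) (C : Set V) (i : V) : Bool → V → Prop
  | start : Reach H C i false i
  | head {m : Bool} {y z : V} : Reach H C i m y → H.Arrowhead y z → H.Open C m y z →
      Reach H C i true z
  | tail {m : Bool} {y z : V} : Reach H C i m y → H.Adj y z → ¬ H.Arrowhead y z →
      H.Open C m y z → Reach H C i false z

lemma Adj.symm {H : MixedGraph V} {a b : V} (h : H.Adj a b) : H.Adj b a := by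
  rcases h with h | h | h | h
  · exact Or.inl (H.line_symm h)
  · exact Or.inr (Or.inr (Or.inl h))
  · exact Or.inr (Or.inl h)
  · exact Or.inr (Or.inr (Or.inr (H.arc_symm h)))

lemma Adj.ne {H : MixedGraph V} {a b : V} (h : H.Adj a b) : a ≠ b := by
  rintro rfl
  rcases h with h | h | h | h
  exacts [H.line_irrefl _ h, H.arrow_irrefl _ h, H.arrow_irrefl _ h, H.arc_irrefl _ h]

lemma Arrowhead.adj {H : MixedGraph V} {a b : V} (h : H.Arrowhead a b) : H.Adj a b := by
  rcases h with h | h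
  · exact Or.inr (Or.inl h)
  · exact Or.inr (Or.inr (Or.inr h))

lemma Arrowhead.ne {H : MixedGraph V} {a b : V} (h : H.Arrowhead a b) : a ≠ b := h.adj.ne

lemma AnteSet.of_ancestor {H : MixedGraph V} {C : Set V} {a b : V} (hab : H.Ancestor a b)
    (hb : H.AnteSet C b) : H.AnteSet C a := by
  rcases hb with hb | ⟨d, hd, hbd⟩
  · exact Or.inr ⟨b, hb, hab⟩
  · exact Or.inr ⟨d, hd, hab.trans hbd⟩

lemma AnteSet.of_arrow {H : MixedGraph V} {C : Set V} {a b : V} (hab : H.arrow a b)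
    (hb : H.AnteSet C b) : H.AnteSet C a :=
  hb.of_ancestor (Relation.TransGen.single hab)

lemma IsAncestral.not_arrow_of_arrowhead {H : MixedGraph V} (hH : H.IsAncestral) {a b : V}
    (h : H.Arrowhead a b) : ¬ H.arrow b a :=
  fun h' => hH.1 b a h (Relation.TransGen.single h')

lemma IsAncestral.not_line_of_arrowhead {H : MixedGraph V} (hH : H.IsAncestral) {a b c : V}
    (h : H.Arrowhead a b) : ¬ H.line b c :=
  fun h' => hH.2 b ⟨c, h'⟩ ⟨a, h⟩

/-- An edge at `b` without an arrowhead at `b` is an arrow if some other edge points to `b`, since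
lines do not meet arrowheads. -/
lemma IsAncestral.arrow_of_not_arrowhead {H : MixedGraph V} (hH : H.IsAncestral) {a b c : V}
    (h : H.Arrowhead a b) (hbc : H.Adj b c) (hn : ¬ H.Arrowhead c b) : H.arrow b c := by
  rcases hbc with h' | h' | h' | h'
  · exact absurd h' (hH.not_line_of_arrowhead h)
  · exact h'
  · exact absurd (Or.inl h') hn
  · exact absurd (Or.inr (H.arc_symm h')) hn

lemma Reach.step_mark {H : MixedGraph V} {C : Set V} {i y z : V} {m : Bool}
    (h : H.Reach C i m y) (hyz : H.Adj y z) (ho : H.Open C m y z) :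
    (H.Arrowhead y z → H.Reach C i true z) ∧ (¬ H.Arrowhead y z → H.Reach C i false z) :=
  ⟨fun h' => h.head h' ho, fun h' => h.tail hyz h' ho⟩

lemma Reach.step {H : MixedGraph V} {C : Set V} {i y z : V} {m : Bool}
    (h : H.Reach C i m y) (hyz : H.Adj y z) (ho : H.Open C m y z) :
    ∃ m', H.Reach C i m' z := by
  by_cases h' : H.Arrowhead y z
  exacts [⟨_, h.head h' ho⟩, ⟨_, h.tail hyz h' ho⟩]

lemma open_false {H : MixedGraph V} {C : Set V} {y z : V} (hy : y ∉ C) :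
    H.Open C false y z := Or.inr ⟨by simp, hy⟩

lemma open_of_not_arrowhead {H : MixedGraph V} {C : Set V} {y z : V} {m : Bool}
    (h : ¬ H.Arrowhead z y) (hy : y ∉ C) : H.Open C m y z := Or.inr ⟨fun h' => h h'.2, hy⟩

lemma open_collider {H : MixedGraph V} {C : Set V} {y z : V}
    (h : H.Arrowhead z y) (hy : H.AnteSet C y) : H.Open C true y z := Or.inl ⟨rfl, h, hy⟩

lemma isConnecting_cons {H : MixedGraph V} {C : Set V} {a b c : V} {l : List V} :
    H.IsConnecting C (a :: b :: c :: l) ↔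
      ((H.IsCollider a b c → H.AnteSet C b) ∧ (¬ H.IsCollider a b c → b ∉ C)) ∧
        H.IsConnecting C (b :: c :: l) := by
  constructor
  · intro h
    refine ⟨h a b c ⟨[], l, rfl⟩, fun x y z hx => h x y z ?_⟩
    exact List.infix_cons_iff.2 (Or.inr hx)
  · rintro ⟨h₁, h₂⟩ x y z hx
    rcases List.infix_cons_iff.1 hx with hx | hx
    · simp only [List.cons_prefix_cons] at hx
      obtain ⟨rfl, rfl, rfl, -⟩ := hx
      exact h₁
    · exact h₂ x y z hx

lemma isConnecting_of_length_le_two {H : MixedGraph V} {C : Set V} {l : List V}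
    (hl : l.length ≤ 2) : H.IsConnecting C l := fun a b c h => by
  have := h.length_le
  simp at this
  omega

lemma IsConnecting.mono {H : MixedGraph V} {C : Set V} {l l' : List V}
    (h : H.IsConnecting C l) (hl : l' <:+: l) : H.IsConnecting C l' :=
  fun a b c hx => h a b c (hx.trans hl)

lemma IsConnecting.reverse {H : MixedGraph V} {C : Set V} {l : List V}
    (h : H.IsConnecting C l) : H.IsConnecting C l.reverse := by
  intro a b c hx
  have h' := h c b a (by simpa using List.reverse_infix.2 hx)
  have e : H.IsCollider a b c ↔ H.IsCollider c b a := and_comm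
  rwa [e]

/-- Along a connecting walk that starts with an arrow one follows arrows until an open collider or
the end of the walk is reached. -/
lemma IsAncestral.anteSet_or_ancestor_getLast {H : MixedGraph V} (hH : H.IsAncestral) {C : Set V} :
    ∀ (l : List V) (a b : V), H.arrow a b → (a :: b :: l).IsChain H.Adj →
      H.IsConnecting C (a :: b :: l) →
      H.AnteSet C a ∨ H.Ancestor a ((b :: l).getLast (List.cons_ne_nil b l))
  | [], a, b, hab, _, _ => Or.inr (Relation.TransGen.single hab)
  | c :: l, a, b, hab, hch, hco => by
    rw [isConnecting_cons] at hco
    rw [List.isChain_cons_cons] at hch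
    by_cases hcb : H.Arrowhead c b
    · exact Or.inl ((hco.1.1 ⟨Or.inl hab, hcb⟩).of_arrow hab)
    · have hbc : H.Adj b c := (List.isChain_cons_cons.1 hch.2).1
      have hbc' := hH.arrow_of_not_arrowhead (Or.inl hab) hbc hcb
      rcases hH.anteSet_or_ancestor_getLast l b c hbc' hch.2 hco.2 with h | h
      · exact Or.inl (h.of_arrow hab)
      · rw [List.getLast_cons (List.cons_ne_nil c l)]
        exact Or.inr (Relation.TransGen.head hab h)

lemma infix_triple_append {a b c x : V} {l₁ l₃ : List V}
    (h : [a, b, c] <:+: l₁ ++ x :: l₃) :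
    [a, b, c] <:+: l₁ ++ [x] ∨ [a, b, c] <:+: x :: l₃ ∨
      b = x ∧ (∃ l, l₁ = l ++ [a]) ∧ ∃ l, l₃ = c :: l := by
  induction l₁ with
  | nil => exact Or.inr (Or.inl h)
  | cons d l₁ ih =>
    rw [List.cons_append, List.infix_cons_iff] at h
    rcases h with h | h
    · rcases l₁ with _ | ⟨e, l₁⟩
      · rcases l₃ with _ | ⟨f, l₃⟩
        · simp at h
        · simp at h
          obtain ⟨rfl, rfl, rfl⟩ := h
          exact Or.inr (Or.inr ⟨rfl, ⟨[], rfl⟩, _, rfl⟩)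
      · rcases l₁ with _ | ⟨f, l₁⟩
        · simp at h
          obtain ⟨rfl, rfl, rfl⟩ := h
          exact Or.inl ⟨[], [], rfl⟩
        · simp at h
          obtain ⟨rfl, rfl, rfl⟩ := h
          exact Or.inl ⟨[], l₁ ++ [x], rfl⟩
    · rcases ih h with h' | h' | ⟨hb, ⟨l, hl⟩, hl'⟩
      · exact Or.inl (List.infix_cons_iff.2 (Or.inr h'))
      · exact Or.inr (Or.inl h')
      · exact Or.inr (Or.inr ⟨hb, ⟨d :: l, by simp [hl]⟩, hl'⟩)

lemma exists_eq_append_of_not_nodup {l : List V} (h : ¬ l.Nodup) :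
    ∃ l₁ l₂ l₃ x, l = l₁ ++ x :: (l₂ ++ x :: l₃) := by
  induction l with
  | nil => simp at h
  | cons a l ih =>
    by_cases ha : a ∈ l
    · obtain ⟨l₂, l₃, rfl⟩ := List.append_of_mem ha
      exact ⟨[], l₂, l₃, a, rfl⟩
    · obtain ⟨l₁, l₂, l₃, x, rfl⟩ := ih (fun h' => h (List.nodup_cons.2 ⟨ha, h'⟩))
      exact ⟨a :: l₁, l₂, l₃, x, rfl⟩

/-- A closed part of a connecting walk may be cut out. If the node `x` where it is attached becomes
a collider that was none before, then the closed part leaves `x` along an arrow and, by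
acyclicity, leads to an open collider. -/
lemma IsAncestral.isConnecting_cut {H : MixedGraph V} (hH : H.IsAncestral) {C : Set V}
    {l₁ l₂ l₃ : List V} {x : V} (hch : (l₁ ++ x :: (l₂ ++ x :: l₃)).IsChain H.Adj)
    (hco : H.IsConnecting C (l₁ ++ x :: (l₂ ++ x :: l₃))) :
    H.IsConnecting C (l₁ ++ x :: l₃) := by
  intro a b c h
  rcases infix_triple_append h with h | h | ⟨rfl, ⟨k₁, rfl⟩, ⟨k₃, rfl⟩⟩
  · exact hco a b c (h.trans ⟨[], l₂ ++ x :: l₃, by simp⟩)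
  · exact hco a b c (h.trans ⟨l₁ ++ x :: l₂, [], by simp⟩)
  · obtain ⟨d, k₂, hd⟩ : ∃ d k₂, l₂ ++ [b] = d :: k₂ := by
      rcases l₂ with _ | ⟨d, l₂⟩
      exacts [⟨b, [], rfl⟩, ⟨d, l₂ ++ [b], rfl⟩]
    have hl : k₁ ++ [a] ++ b :: (l₂ ++ b :: c :: k₃) = k₁ ++ a :: b :: d :: (k₂ ++ c :: k₃) := by
      have : l₂ ++ b :: c :: k₃ = l₂ ++ [b] ++ c :: k₃ := by simp
      rw [this, hd]; simp
    obtain ⟨e, k₄, he⟩ : ∃ e k₄, b :: l₂ = k₄ ++ [e] :=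
      ⟨_, _, (List.dropLast_append_getLast (List.cons_ne_nil b l₂)).symm⟩
    have hl' : k₁ ++ [a] ++ b :: (l₂ ++ b :: c :: k₃) = k₁ ++ [a] ++ k₄ ++ [e, b, c] ++ k₃ := by
      have : b :: (l₂ ++ b :: c :: k₃) = (b :: l₂) ++ b :: c :: k₃ := by simp
      rw [this, he]; simp
    have h₁ := hco a b d (by rw [hl]; exact ⟨k₁, k₂ ++ c :: k₃, by simp⟩)
    have h₂ := hco e b c (by rw [hl']; exact ⟨_, _, rfl⟩)
    -- `d` follows the first and `e` precedes the second occurrence of `b`.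
    constructor
    · rintro ⟨hab, hcb⟩
      by_cases hdb : H.Arrowhead d b
      · exact h₁.1 ⟨hab, hdb⟩
      · rw [hl] at hch hco
        have hch' : (b :: d :: k₂).IsChain H.Adj :=
          hch.infix ⟨k₁ ++ [a], c :: k₃, by simp⟩
        have hco' : H.IsConnecting C (b :: d :: k₂) :=
          hco.mono ⟨k₁ ++ [a], c :: k₃, by simp⟩
        have hbd := hH.arrow_of_not_arrowhead hab (List.isChain_cons_cons.1 hch').1 hdb
        rcases hH.anteSet_or_ancestor_getLast k₂ b d hbd hch' hco' with h' | h'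
        · exact h'
        · have hlast : (d :: k₂).getLast (List.cons_ne_nil d k₂) = b := by
            have : (l₂ ++ [b]).getLast (by simp) = b := by simp
            simpa [hd] using this
          rw [hlast] at h'
          obtain ⟨f, hf, hfb⟩ := Relation.TransGen.tail'_iff.1 h'
          rcases Relation.reflTransGen_iff_eq_or_transGen.1 hf with rfl | hf
          · exact absurd hfb (H.arrow_irrefl _)
          · exact absurd hf (hH.1 b f (Or.inl hfb))
    · intro hn
      by_cases hab : H.Arrowhead a b
      · exact h₂.2 fun h' => hn ⟨hab, h'.2⟩
      · exact h₁.2 fun h' => hab h'.1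

/-- Cutting out closed parts turns a connecting walk into a connecting path. -/
lemma IsAncestral.exists_path_of_walk {H : MixedGraph V} (hH : H.IsAncestral) {C : Set V}
    {i j : V} (n : ℕ) : ∀ p : List V, p.length = n → p.head? = some i → p.getLast? = some j →
      p.IsChain H.Adj → H.IsConnecting C p → ∃ p, H.IsPath i j p ∧ H.IsConnecting C p := by
  induction n using Nat.strong_induction_on with
  | _ n ih =>
    intro p hn hi hj hch hco
    by_cases hp : p.Nodup
    · exact ⟨p, ⟨hi, hj, hp, hch⟩, hco⟩
    · obtain ⟨l₁, l₂, l₃, x, rfl⟩ := exists_eq_append_of_not_nodup hp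
      refine ih _ ?_ (l₁ ++ x :: l₃) rfl ?_ ?_ ?_ (hH.isConnecting_cut hch hco)
      · rw [← hn]; simp
      · rcases l₁ with _ | ⟨y, l₁⟩ <;> simpa using hi
      · simpa [List.getLast?_append, List.getLast?_cons] using hj
      · have h₁ : (l₁ ++ [x]).IsChain H.Adj := hch.infix ⟨[], l₂ ++ x :: l₃, by simp⟩
        have h₂ : (x :: l₃).IsChain H.Adj := hch.infix ⟨l₁ ++ x :: l₂, [], by simp⟩
        simpa using List.isChain_split.2 ⟨h₁, h₂⟩

/-- Continuing a connecting walk that ends with the edge between `x` and `y` by the list `l`. -/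
lemma Reach.of_walk {H : MixedGraph V} {C : Set V} {i j : V} :
    ∀ (l : List V) (x y : V) (m : Bool), H.Reach C i m y → (m = true ↔ H.Arrowhead x y) →
      (x :: y :: l).IsChain H.Adj → H.IsConnecting C (x :: y :: l) →
      (y :: l).getLast? = some j → ∃ m, H.Reach C i m j
  | [], x, y, m, hr, _, _, _, hj => by
    simp at hj
    exact ⟨m, hj ▸ hr⟩
  | z :: l, x, y, m, hr, hm, hch, hco, hj => by
    rw [isConnecting_cons] at hco
    rw [List.isChain_cons_cons] at hch
    have ho : H.Open C m y z := by
      by_cases h : H.IsCollider x y z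
      · exact Or.inl ⟨hm.2 h.1, h.2, hco.1.1 h⟩
      · exact Or.inr ⟨fun h' => h ⟨hm.1 h'.1, h'.2⟩, hco.1.2 h⟩
    have hyz := (List.isChain_cons_cons.1 hch.2).1
    by_cases h : H.Arrowhead y z
    · exact Reach.of_walk l y z true (hr.head h ho) (by simpa) hch.2 hco.2 (by simpa using hj)
    · exact Reach.of_walk l y z false (hr.tail hyz h ho) (by simpa) hch.2 hco.2 (by simpa using hj)

/-- The node sequence of a connecting walk, in reverse order. -/
lemma Reach.exists_walk {H : MixedGraph V} {C : Set V} {i y : V} {m : Bool} (hi : i ∉ C)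
    (h : H.Reach C i m y) : ∃ l : List V, (y :: l).getLast? = some i ∧ (y :: l).IsChain H.Adj ∧
      H.IsConnecting C (y :: l) ∧
      (l = [] ∧ m = false ∧ y ∉ C ∨ ∃ x l', l = x :: l' ∧ (m = true ↔ H.Arrowhead x y)) := by
  have key : ∀ {m m' : Bool} {y z : V}, (∃ l : List V, (y :: l).getLast? = some i ∧
      (y :: l).IsChain H.Adj ∧ H.IsConnecting C (y :: l) ∧ (l = [] ∧ m = false ∧ y ∉ C ∨
        ∃ x l', l = x :: l' ∧ (m = true ↔ H.Arrowhead x y))) →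
      H.Adj y z → H.Open C m y z → (m' = true ↔ H.Arrowhead y z) →
      ∃ l : List V, (z :: l).getLast? = some i ∧ (z :: l).IsChain H.Adj ∧
        H.IsConnecting C (z :: l) ∧
        (l = [] ∧ m' = false ∧ z ∉ C ∨ ∃ x l', l = x :: l' ∧ (m' = true ↔ H.Arrowhead x z)) := by
    rintro m m' y z ⟨l, h₁, h₂, h₃, h₄⟩ hyz ho hm
    refine ⟨y :: l, by simpa using h₁, List.isChain_cons_cons.2 ⟨hyz.symm, h₂⟩, ?_,
      Or.inr ⟨y, l, rfl, hm⟩⟩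
    rcases h₄ with ⟨rfl, -, -⟩ | ⟨x, l, rfl, hm'⟩
    · exact isConnecting_of_length_le_two (by simp)
    · refine isConnecting_cons.2 ⟨?_, h₃⟩
      rcases ho with ⟨h, h', h''⟩ | ⟨h, h'⟩
      · exact ⟨fun _ => h'', fun hn => absurd ⟨h', hm'.1 h⟩ hn⟩
      · exact ⟨fun hc => absurd ⟨hm'.2 hc.2, hc.1⟩ h, fun _ => h'⟩
  induction h with
  | start => exact ⟨[], by simp, by simp, isConnecting_of_length_le_two (by simp),
      Or.inl ⟨rfl, rfl, hi⟩⟩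
  | head _ ha ho ih => exact key ih ha.adj ho (by simpa)
  | tail _ ha hn ho ih => exact key ih ha ho (by simpa)

/-- In an ancestral graph walks connect the same nodes as paths. -/
lemma IsAncestral.exists_path_iff_reach {H : MixedGraph V} (hH : H.IsAncestral) {C : Set V}
    {i j : V} (hij : i ≠ j) (hi : i ∉ C) :
    (∃ p, H.IsPath i j p ∧ H.IsConnecting C p) ↔ ∃ m, H.Reach C i m j := by
  constructor
  · rintro ⟨p, ⟨h₁, h₂, -, h₄⟩, h₅⟩
    rcases p with _ | ⟨x, _ | ⟨y, l⟩⟩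
    · simp at h₁
    · simp at h₁ h₂
      exact absurd (h₁.symm.trans h₂) hij
    · simp at h₁
      subst h₁
      have hxy := (List.isChain_cons_cons.1 h₄).1
      by_cases h : H.Arrowhead x y
      · exact Reach.of_walk l x y true (Reach.start.head h (open_false hi)) (by simpa) h₄ h₅
          (by simpa using h₂)
      · exact Reach.of_walk l x y false (Reach.start.tail hxy h (open_false hi)) (by simpa) h₄ h₅
          (by simpa using h₂)
  · rintro ⟨m, h⟩
    obtain ⟨l, h₁, h₂, h₃, -⟩ := h.exists_walk hi
    refine hH.exists_path_of_walk _ (j :: l).reverse rfl (by rwa [List.head?_reverse]) (by simp) ?_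
      h₃.reverse
    rw [List.isChain_reverse]
    exact h₂.imp fun _ _ h => h.symm

lemma IsAncestral.mSep_iff {H : MixedGraph V} (hH : H.IsAncestral) {A B C : Set V}
    (hAB : Disjoint A B) (hAC : Disjoint A C) :
    H.MSep A B C ↔ ∀ i ∈ A, ∀ j ∈ B, ∀ m, ¬ H.Reach C i m j := by
  unfold MSep
  have : ∀ i ∈ A, ∀ j ∈ B, (∃ p, H.IsPath i j p ∧ H.IsConnecting C p) ↔ ∃ m, H.Reach C i m j :=
    fun i hi j hj => hH.exists_path_iff_reach (fun e => Set.disjoint_left.1 hAB hi (e ▸ hj))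
      (Set.disjoint_left.1 hAC hi)
  constructor
  · intro h i hi j hj m hr
    exact h ⟨i, hi, j, hj, (this i hi j hj).2 ⟨m, hr⟩⟩
  · rintro h ⟨i, hi, j, hj, hp⟩
    obtain ⟨m, hr⟩ := (this i hi j hj).1 hp
    exact h i hi j hj m hr

lemma IsAncestral.mSep_singleton_iff {H : MixedGraph V} (hH : H.IsAncestral) {i j : V} {C : Set V}
    (hij : i ≠ j) (hi : i ∉ C) : H.MSep {i} {j} C ↔ ∀ m, ¬ H.Reach C i m j := by
  rw [hH.mSep_iff (by simpa using hij) (by simpa using hi)]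
  simp

/-- Ancestral graphs whose connecting walks join the same nodes are Markov equivalent. -/
lemma markovEquiv_of_reach {H G : MixedGraph V} (hH : H.IsAncestral) (hG : G.IsAncestral)
    (h : ∀ (C : Set V) (i j : V), i ∉ C → ((∃ m, H.Reach C i m j) ↔ ∃ m, G.Reach C i m j)) :
    H.MarkovEquiv G := by
  intro A B C hAB hAC _
  rw [hH.mSep_iff hAB hAC, hG.mSep_iff hAB hAC]
  refine forall₂_congr fun i hi => forall₂_congr fun j _ => ?_
  rw [← not_exists, ← not_exists, h C i j (Set.disjoint_left.1 hAC hi)]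

end MixedGraph

namespace MixedGraph

variable {V : Type*}

/-! ### Graphs that are Markov equivalent to a directed acyclic graph -/

lemma IsDAG.arrow_of_arrowhead {G : MixedGraph V} (hG : G.IsDAG) {a b : V}
    (h : G.Arrowhead a b) : G.arrow a b :=
  h.resolve_right (hG.2.1 a b)

lemma IsDAG.adj_iff {G : MixedGraph V} (hG : G.IsDAG) {a b : V} :
    G.Adj a b ↔ G.arrow a b ∨ G.arrow b a := by
  constructor
  · rintro (h | h | h | h)
    exacts [absurd h (hG.1 a b), Or.inl h, Or.inr h, absurd h (hG.2.1 a b)]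
  · rintro (h | h)
    exacts [Or.inr (Or.inl h), Or.inr (Or.inr (Or.inl h))]

lemma IsDAG.isAncestral {G : MixedGraph V} (hG : G.IsDAG) : G.IsAncestral :=
  ⟨fun _ _ h h' => hG.2.2 _ (h'.tail (hG.arrow_of_arrowhead h)),
    fun _ ⟨_, h⟩ _ => hG.1 _ _ h⟩

/-- In a directed acyclic graph a node is separated from its non-neighbours other than its
descendants by its parents. -/
lemma IsDAG.mSep_parents {G : MixedGraph V} (hG : G.IsDAG) {i j : V} (hij : i ≠ j)
    (h : ¬ G.Adj i j) (ha : ¬ G.Ancestor i j) : G.MSep {i} {j} {v | G.arrow v i} := by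
  rw [hG.isAncestral.mSep_singleton_iff hij (C := {v | G.arrow v i}) (G.arrow_irrefl i)]
  have hdesc : ∀ y, G.Ancestor i y → ¬ G.AnteSet {v | G.arrow v i} y := by
    rintro y hy (h' | ⟨d, hd, h'⟩)
    · exact hG.2.2 i (hy.tail h')
    · exact hG.2.2 i ((hy.trans h').tail hd)
  -- A connecting walk from `i` is at `i`, at a parent of `i`, or descends from `i`.
  have key : ∀ m y, G.Reach {v | G.arrow v i} i m y →
      (m = false ∧ (y = i ∨ G.arrow y i)) ∨ (m = true ∧ G.Ancestor i y) := by
    have step : ∀ {m y z}, ((m = false ∧ (y = i ∨ G.arrow y i)) ∨ (m = true ∧ G.Ancestor i y)) →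
        G.Open {v | G.arrow v i} m y z → G.Adj y z →
        (y = i ∧ m = false) ∨ (m = true ∧ G.Ancestor i z ∧ G.arrow y z) := by
      rintro m y z (⟨rfl, rfl | hy⟩ | ⟨rfl, hy⟩) ho hyz
      · exact Or.inl ⟨rfl, rfl⟩
      · rcases ho with ⟨h, -⟩ | ⟨-, h⟩
        · simp at h
        · exact absurd hy h
      · rcases ho with ⟨-, -, h⟩ | ⟨h, -⟩
        · exact absurd h (hdesc y hy)
        · have hyz' : G.arrow y z :=
            (hG.adj_iff.1 hyz).resolve_right fun h' => h ⟨rfl, Or.inl h'⟩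
          exact Or.inr ⟨rfl, hy.tail hyz', hyz'⟩
    intro m y hr
    induction hr with
    | start => exact Or.inl ⟨rfl, Or.inl rfl⟩
    | head _ hyz ho ih =>
      rcases step ih ho hyz.adj with ⟨rfl, -⟩ | ⟨-, h', -⟩
      · exact Or.inr ⟨rfl, Relation.TransGen.single (hG.arrow_of_arrowhead hyz)⟩
      · exact Or.inr ⟨rfl, h'⟩
    | tail _ hyz hn ho ih =>
      rcases step ih ho hyz with ⟨rfl, -⟩ | ⟨-, -, h'⟩
      · exact Or.inl ⟨rfl, Or.inr ((hG.adj_iff.1 hyz).resolve_left fun h' => hn (Or.inl h'))⟩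
      · exact absurd (Or.inl h') hn
  intro m hr
  rcases key m j hr with ⟨-, rfl | h'⟩ | ⟨-, h'⟩
  · exact hij rfl
  · exact h (hG.adj_iff.2 (Or.inr h'))
  · exact ha h'

lemma IsAncestral.not_mSep_of_adj {H : MixedGraph V} (hH : H.IsAncestral) {i j : V} {C : Set V}
    (h : H.Adj i j) (hi : i ∉ C) : ¬ H.MSep {i} {j} C := by
  rw [hH.mSep_singleton_iff h.ne hi]
  intro h'
  obtain ⟨m, hm⟩ := Reach.start.step h (open_false hi)
  exact h' m hm

lemma MarkovEquiv.mSep_singleton {H G : MixedGraph V} (h : H.MarkovEquiv G) {i j : V} {C : Set V}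
    (hij : i ≠ j) (hi : i ∉ C) (hj : j ∉ C) : H.MSep {i} {j} C ↔ G.MSep {i} {j} C :=
  h {i} {j} C (by simpa using hij) (by simpa using hi) (by simpa using hj)

lemma MarkovEquiv.adj_iff {H G : MixedGraph V} (h : H.MarkovEquiv G) (hH : H.IsMAG)
    (hG : G.IsDAG) {i j : V} : H.Adj i j ↔ G.Adj i j := by
  constructor
  · intro hij
    by_contra hn
    by_cases ha : G.Ancestor i j
    · have ha' : ¬ G.Ancestor j i := fun h' => hG.2.2 i (ha.trans h')
      have hs := hG.mSep_parents hij.ne.symm (fun h' => hn h'.symm) ha'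
      rw [← h.mSep_singleton (C := {v | G.arrow v j}) hij.ne.symm (G.arrow_irrefl j)
        fun h' => hn (hG.adj_iff.2 (Or.inl h'))] at hs
      exact hH.1.not_mSep_of_adj (C := {v | G.arrow v j}) hij.symm (G.arrow_irrefl j) hs
    · have hs := hG.mSep_parents hij.ne hn ha
      rw [← h.mSep_singleton (C := {v | G.arrow v i}) hij.ne (G.arrow_irrefl i)
        fun h' => hn (hG.adj_iff.2 (Or.inr h'))] at hs
      exact hH.1.not_mSep_of_adj (C := {v | G.arrow v i}) hij (G.arrow_irrefl i) hs
  · intro hij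
    by_contra hn
    obtain ⟨C, hi, hj, hs⟩ := hH.2 i j hij.ne hn
    rw [h.mSep_singleton hij.ne hi hj] at hs
    exact hG.isAncestral.not_mSep_of_adj hij hi hs

/-- An inner node of an unshielded V-configuration is a collider iff it is outside the sets that
separate the endpoints. -/
lemma IsAncestral.isCollider_iff_of_mSep {H : MixedGraph V} (hH : H.IsAncestral) {a b c : V}
    {C : Set V} (hac : a ≠ c) (ha : a ∉ C) (hs : H.MSep {a} {c} C) (hab : H.Adj a b)
    (hbc : H.Adj b c) : H.IsCollider a b c ↔ b ∉ C := by
  rw [hH.mSep_singleton_iff hac ha] at hs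
  have hr := Reach.start.step_mark hab (open_false ha)
  constructor
  · rintro ⟨h₁, h₂⟩ hb
    obtain ⟨m, hm⟩ := (hr.1 h₁).step hbc (open_collider h₂ (Or.inl hb))
    exact hs m hm
  · intro hb
    by_contra hn
    obtain ⟨m, hm⟩ : ∃ m, H.Reach C a m c := by
      by_cases h₁ : H.Arrowhead a b
      · exact (hr.1 h₁).step hbc (open_of_not_arrowhead (fun h₂ => hn ⟨h₁, h₂⟩) hb)
      · exact (hr.2 h₁).step hbc (open_false hb)
    exact hs m hm

lemma MarkovEquiv.isCollider_iff {H G : MixedGraph V} (h : H.MarkovEquiv G) (hH : H.IsMAG)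
    (hG : G.IsDAG) {a b c : V} (hac : a ≠ c) (hn : ¬ H.Adj a c) (hab : H.Adj a b)
    (hbc : H.Adj b c) : H.IsCollider a b c ↔ G.IsCollider a b c := by
  obtain ⟨C, ha, hc, hs⟩ := hH.2 a c hac hn
  rw [hH.1.isCollider_iff_of_mSep hac ha hs hab hbc]
  rw [h.mSep_singleton hac ha hc] at hs
  rw [hG.isAncestral.isCollider_iff_of_mSep hac ha hs ((h.adj_iff hH hG).1 hab)
    ((h.adj_iff hH hG).1 hbc)]

lemma IsAncestral.line_of_adj {H : MixedGraph V} (hH : H.IsAncestral) {a b : V}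
    (ha : ∃ c, H.line a c) (hb : ∃ c, H.line b c) (h : H.Adj a b) : H.line a b := by
  obtain ⟨c, hc⟩ := ha
  obtain ⟨d, hd⟩ := hb
  rcases h with h | h | h | h
  · exact h
  · exact absurd hd (hH.not_line_of_arrowhead (Or.inl h))
  · exact absurd hc (hH.not_line_of_arrowhead (Or.inl h))
  · exact absurd hd (hH.not_line_of_arrowhead (Or.inr h))

/-- A chordless cycle of lines would yield an unshielded collider at one of its sinks in the
directed acyclic graph. -/
lemma MarkovEquiv.isChordalGraph {H G : MixedGraph V} (h : H.MarkovEquiv G) (hH : H.IsMAG)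
    (hG : G.IsDAG) : IsChordalGraph H.lineSubgraph := by
  intro n hn
  obtain ⟨n, rfl⟩ := Nat.exists_eq_add_of_le' hn
  refine ⟨fun φ => ?_⟩
  let r : Fin (n + 4) → Fin (n + 4) → Prop := fun l k => G.Ancestor (φ k) (φ l)
  have : IsTrans _ r := ⟨fun _ _ _ h₁ h₂ => h₂.trans h₁⟩
  have : Std.Irrefl r := ⟨fun k hk => hG.2.2 _ hk⟩
  -- `φ k` is a sink of the cycle in `G`.
  obtain ⟨k, -, hk⟩ := (Finite.wellFounded_of_trans_of_irrefl r).has_min Set.univ ⟨0, trivial⟩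
  have hadj : ∀ l, (SimpleGraph.cycleGraph (n + 4)).Adj l k →
      H.line (φ l) (φ k) ∧ G.arrow (φ l) (φ k) := by
    intro l hl
    have h₁ : H.line (φ l) (φ k) := φ.map_rel_iff.2 hl
    refine ⟨h₁, ?_⟩
    rcases hG.adj_iff.1 ((h.adj_iff hH hG).1 (Or.inl h₁)) with h₂ | h₂
    · exact h₂
    · exact absurd (Relation.TransGen.single h₂) (hk l trivial)
  have h₁ := hadj (k + 1) (by rw [SimpleGraph.cycleGraph_adj]; left; abel)
  have h₂ := hadj (k - 1) (by rw [SimpleGraph.cycleGraph_adj]; right; abel)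
  have hne : ∀ l l' : Fin (n + 4), l ≠ l' → (φ l : V) ≠ φ l' := fun l l' hl e =>
    hl (φ.injective (Subtype.ext e))
  have h12 : (k + 1) - (k - 1) = (2 : Fin (n + 4)) := by
    have : (k + 1) - (k - 1) = (1 + 1 : Fin (n + 4)) := by abel
    rw [this]; rfl
  have h21 : (k - 1) - (k + 1) = (-2 : Fin (n + 4)) := by rw [← h12]; abel
  have two : (2 : Fin (n + 4)) ≠ 0 := by
    simp [Fin.ext_iff, Nat.mod_eq_of_lt (show 2 < n + 4 by omega)]
  have two' : (2 : Fin (n + 4)) ≠ 1 := by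
    simp [Fin.ext_iff, Nat.mod_eq_of_lt (show 2 < n + 4 by omega)]
  have two'' : (-2 : Fin (n + 4)) ≠ 1 := by
    intro e
    have : (0 : Fin (n + 4)) = 3 := by
      calc (0 : Fin (n + 4)) = -2 + 2 := by simp
        _ = 1 + 2 := by rw [e]
        _ = 3 := rfl
    simp [Fin.ext_iff, Nat.mod_eq_of_lt (show 3 < n + 4 by omega)] at this
  have hnadj : ¬ H.Adj (φ (k + 1)) (φ (k - 1)) := by
    intro ha
    have hl := hH.1.line_of_adj (φ (k + 1)).2 (φ (k - 1)).2 ha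
    have : (SimpleGraph.cycleGraph (n + 4)).Adj (k + 1) (k - 1) := φ.map_rel_iff.1 hl
    rw [SimpleGraph.cycleGraph_adj, h12, h21] at this
    exact this.elim two' two''
  have hcol := (h.isCollider_iff hH hG
    (hne _ _ fun e => two (by rw [← h12, e, sub_self])) hnadj (Or.inl h₁.1)
    (Or.inl (H.line_symm h₂.1))).2 ⟨Or.inl h₁.2, Or.inl h₂.2⟩
  exact hH.1.not_line_of_arrowhead hcol.1 (H.line_symm h₁.1)

/-- The inner arc of a collider path with four nodes whose end nodes are not adjacent has an end
that is a collider between the end nodes of the path, provided that the first node is adjacent to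
the third one. Otherwise, the third node is a parent of the first one; it is in every set that
separates the end nodes of the path, while the second node is not. -/
lemma MarkovEquiv.arrowhead_of_adj {H G : MixedGraph V} (h : H.MarkovEquiv G) (hH : H.IsMAG)
    (hG : G.IsDAG) {i b c j : V} (hij : i ≠ j) (hn : ¬ H.Adj i j) (hib : H.Arrowhead i b)
    (hbc : H.arc b c) (hjc : H.Arrowhead j c) (hic : H.Adj i c) :
    H.Arrowhead i c ∨ H.Arrowhead j b := by
  by_contra! hcon
  obtain ⟨hic', hjb'⟩ := hcon
  have hci : H.arrow c i := hH.1.arrow_of_not_arrowhead hjc hic.symm hic'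
  obtain ⟨C, hi, hj, hs⟩ := hH.2 j i hij.symm fun h' => hn h'.symm
  have hcC : c ∈ C := by
    by_contra hc
    exact hic' ((hH.1.isCollider_iff_of_mSep hij.symm hi hs hjc.adj hic.symm).2 hc).2
  have hrc : H.Reach C j true c := Reach.start.head hjc (open_false hi)
  have hrb : H.Reach C j true b := hrc.head (Or.inr (H.arc_symm hbc))
    (open_collider (Or.inr hbc) (Or.inl hcC))
  have hbC : b ∉ C := by
    intro hb
    obtain ⟨m, hm⟩ := hrb.step hib.adj.symm (open_collider hib (Or.inl hb))
    exact (hH.1.mSep_singleton_iff hij.symm hi).1 hs m hm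
  by_cases hjb : H.Adj j b
  · exact hjb' ((hH.1.isCollider_iff_of_mSep hij.symm hi hs hjb hib.adj.symm).2 hbC).1
  · have hjb_ne : j ≠ b := fun e => hn (e ▸ hib.adj)
    have hcol := (h.isCollider_iff hH hG hjb_ne hjb hjc.adj (Or.inr (Or.inr (Or.inr
      (H.arc_symm hbc))))).1 ⟨hjc, Or.inr hbc⟩
    have h₁ := hG.arrow_of_arrowhead hcol.1
    have h₂ := hG.arrow_of_arrowhead hcol.2
    -- In `G`, the path `j → c ← b → i` is connecting given `C`.
    have h₃ : G.arrow c i := by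
      rcases hG.adj_iff.1 ((h.adj_iff hH hG).1 hic) with h' | h'
      · have := (h.isCollider_iff hH hG hij hn hic hjc.adj.symm).2 ⟨Or.inl h', Or.inl h₁⟩
        exact absurd this.1 hic'
      · exact h'
    have h₄ : G.arrow b i := by
      rcases hG.adj_iff.1 ((h.adj_iff hH hG).1 hib.adj) with h' | h'
      · exact absurd ((((Relation.TransGen.single h').tail h₂).tail h₃)) (hG.2.2 i)
      · exact h'
    rw [h.mSep_singleton hij.symm hi hj, hG.isAncestral.mSep_singleton_iff hij.symm hi] at hs
    have hr₁ : G.Reach C j true c := Reach.start.head (Or.inl h₁) (open_false hi)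
    have hr₂ : G.Reach C j false b := hr₁.tail (Or.inr (Or.inr (Or.inl h₂)))
      (fun h' => hG.isAncestral.not_arrow_of_arrowhead h' h₂) (open_collider (Or.inl h₂)
        (Or.inl hcC))
    obtain ⟨m, hm⟩ := hr₂.step (Or.inr (Or.inl h₄)) (open_false hbC)
    exact hs m hm

lemma IsAncestral.arc_of_arrowhead {H : MixedGraph V} (hH : H.IsAncestral) {a b : V}
    (h₁ : H.Arrowhead a b) (h₂ : H.Arrowhead b a) : H.arc a b := by
  rcases h₁ with h₁ | h₁
  · exact absurd h₁ (hH.not_arrow_of_arrowhead h₂)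
  · exact h₁

/-- The two inner nodes of a collider path with four nodes cannot both be unshielded on it. -/
lemma MarkovEquiv.adj_or_adj {H G : MixedGraph V} (h : H.MarkovEquiv G) (hH : H.IsMAG)
    (hG : G.IsDAG) {i b c j : V} (hic : i ≠ c) (hbj : b ≠ j) (hib : H.Arrowhead i b)
    (hbc : H.arc b c) (hjc : H.Arrowhead j c) : H.Adj i c ∨ H.Adj b j := by
  by_contra! hcon
  have hbc' : H.Adj b c := Or.inr (Or.inr (Or.inr hbc))
  have h₁ := (h.isCollider_iff hH hG hic hcon.1 hib.adj hbc').1 ⟨hib, Or.inr (H.arc_symm hbc)⟩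
  have h₂ := (h.isCollider_iff hH hG hbj hcon.2 hbc' hjc.adj.symm).1 ⟨Or.inr hbc, hjc⟩
  exact hG.isAncestral.not_arrow_of_arrowhead h₁.2 (hG.arrow_of_arrowhead h₂.1)

lemma isColliderPath_triple {H : MixedGraph V} {i b j : V} (hij : i ≠ j)
    (hib : H.Arrowhead i b) (hjb : H.Arrowhead j b) : H.IsColliderPath i j [i, b, j] := by
  refine ⟨⟨rfl, rfl, ?_, ?_⟩, ?_⟩
  · simp [hij, hib.ne, hjb.ne.symm]
  · simp [hib.adj, hjb.adj.symm]
  · intro a b' c h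
    have := h.eq_of_length (by simp)
    simp at this
    obtain ⟨rfl, rfl, rfl⟩ := this
    exact ⟨hib, hjb⟩

lemma IsAncestral.isColliderPath_quadruple {H : MixedGraph V} (hH : H.IsAncestral) {i j : V}
    {p : List V} (hp : H.IsColliderPath i j p) (hl : p.length = 4) :
    ∃ b c, p = [i, b, c, j] ∧ p.Nodup ∧ H.Arrowhead i b ∧ H.arc b c ∧ H.Arrowhead j c := by
  match p, hl with
  | [a, b, c, d], _ =>
    obtain ⟨⟨h₁, h₂, h₃, h₄⟩, h₅⟩ := hp
    simp at h₁ h₂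
    subst h₁ h₂
    have h₆ := h₅ a b c ⟨[], [d], rfl⟩
    have h₇ := h₅ b c d ⟨[a], [], rfl⟩
    exact ⟨b, c, rfl, h₃, h₆.1, hH.arc_of_arrowhead h₇.1 h₆.2, h₇.2⟩

theorem MarkovEquiv.dagCondition {H G : MixedGraph V} (h : H.MarkovEquiv G) (hH : H.IsMAG)
    (hG : G.IsDAG) : H.DAGCondition := by
  refine ⟨h.isChordalGraph hH hG, ?_⟩
  rintro ⟨i, j, p, hl, ⟨hn, hp, hmin⟩ | ⟨-, -, hp, hch⟩⟩
  · obtain ⟨b, c, rfl, hnd, hib, hbc, hjc⟩ := hH.1.isColliderPath_quadruple hp hl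
    simp at hnd
    obtain ⟨⟨hib_ne, hic_ne, hij⟩, ⟨hbc_ne, hbj_ne⟩, hcj_ne⟩ := hnd
    have no : ∀ x, x = b ∨ x = c → ¬ (H.Arrowhead i x ∧ H.Arrowhead j x) := by
      rintro x hx ⟨h₁, h₂⟩
      refine hmin [i, x, j] (isColliderPath_triple hij h₁ h₂) ⟨fun v hv => ?_, fun hs => ?_⟩
      · simp at hv ⊢
        rcases hx with rfl | rfl <;> tauto
      · have hb : b ∈ [i, x, j] := hs (by simp)
        have hc : c ∈ [i, x, j] := hs (by simp)
        simp at hb hc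
        rcases hx with rfl | rfl
        · rcases hc with e | e | e
          exacts [hic_ne e.symm, hbc_ne e.symm, hcj_ne e]
        · rcases hb with e | e | e
          exacts [hib_ne e.symm, hbc_ne e, hbj_ne e]
    -- A chord of the path would yield a collider path with three nodes.
    rcases h.adj_or_adj hH hG hic_ne hbj_ne hib hbc hjc with ha | ha
    · rcases h.arrowhead_of_adj hH hG hij hn hib hbc hjc ha with h' | h'
      exacts [no c (Or.inr rfl) ⟨h', hjc⟩, no b (Or.inl rfl) ⟨hib, h'⟩]
    · rcases h.arrowhead_of_adj hH hG (Ne.symm hij) (fun h' => hn h'.symm) hjc (H.arc_symm hbc) hib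
        ha.symm with h' | h'
      exacts [no b (Or.inl rfl) ⟨hib, h'⟩, no c (Or.inr rfl) ⟨h', hjc⟩]
  · obtain ⟨b, c, rfl, hnd, hib, hbc, hjc⟩ := hH.1.isColliderPath_quadruple hp hl
    simp at hnd
    obtain ⟨⟨hib_ne, hic_ne, hij⟩, ⟨hbc_ne, hbj_ne⟩, hcj_ne⟩ := hnd
    have inf : ∀ x y : V, [x, y] <:+: [i, b, c, j] →
        (x = i ∧ y = b) ∨ (x = b ∧ y = c) ∨ (x = c ∧ y = j) := by
      intro x y hxy
      simp only [List.infix_cons_iff, List.cons_prefix_cons] at hxy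
      simpa using hxy
    rcases h.adj_or_adj hH hG hic_ne hbj_ne hib hbc hjc with ha | ha
    · rcases hch i (by simp) c (by simp) ha with h' | h' | ⟨-, h'⟩ | ⟨h', -⟩
      · rcases inf _ _ h' with ⟨-, e⟩ | ⟨e, -⟩ | ⟨e, -⟩
        exacts [hbc_ne e.symm, hib_ne e, hic_ne e]
      · rcases inf _ _ h' with ⟨e, -⟩ | ⟨-, e⟩ | ⟨-, e⟩
        exacts [hic_ne e.symm, hic_ne e, hij e]
      · exact hcj_ne h'
      · exact hij h'
    · rcases hch b (by simp) j (by simp) ha with h' | h' | ⟨h', -⟩ | ⟨h', -⟩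
      · rcases inf _ _ h' with ⟨e, -⟩ | ⟨-, e⟩ | ⟨e, -⟩
        exacts [hib_ne e.symm, hcj_ne e.symm, hbc_ne e]
      · rcases inf _ _ h' with ⟨e, -⟩ | ⟨e, -⟩ | ⟨e, -⟩
        exacts [hij e.symm, hbj_ne e.symm, hcj_ne e.symm]
      · exact hib_ne h'.symm
      · exact hbj_ne h'

end MixedGraph

namespace MixedGraph

variable {V : Type*}

/-! ### Collider paths in graphs that satisfy the condition -/

/-- `f 0, …, f (m + 1)` is the node sequence of a walk all of whose inner nodes `f 1, …, f m` are colliders, whose end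
nodes are distinct and not adjacent, and no inner node of which is on its own a collider between the
end nodes. -/
structure IrreducibleWalk (H : MixedGraph V) (m : ℕ) (f : ℕ → V) : Prop where
  collider : ∀ k < m, H.Arrowhead (f k) (f (k + 1)) ∧ H.Arrowhead (f (k + 2)) (f (k + 1))
  pos : 1 ≤ m
  ne : f 0 ≠ f (m + 1)
  not_adj : ¬ H.Adj (f 0) (f (m + 1))
  not_collider : ∀ k, 1 ≤ k → k ≤ m →
    ¬ (H.Arrowhead (f 0) (f k) ∧ H.Arrowhead (f (m + 1)) (f k))

namespace IrreducibleWalk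

variable {H : MixedGraph V} {m : ℕ} {f : ℕ → V}

lemma succ_arrowhead (h : H.IrreducibleWalk m f) {k : ℕ} (hk : k < m) :
    H.Arrowhead (f k) (f (k + 1)) := (h.collider k hk).1

lemma arrowhead_succ (h : H.IrreducibleWalk m f) {k : ℕ} (hk : 1 ≤ k) (hk' : k ≤ m) :
    H.Arrowhead (f (k + 1)) (f k) := by
  have := (h.collider (k - 1) (by omega)).2
  rwa [show k - 1 + 2 = k + 1 by omega, show k - 1 + 1 = k by omega] at this

lemma reverse (h : H.IrreducibleWalk m f) : H.IrreducibleWalk m fun k => f (m + 1 - k) where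
  collider k hk := by
    have := h.collider (m - 1 - k) (by omega)
    rw [show m - 1 - k + 1 = m + 1 - (k + 1) by omega, show m - 1 - k + 2 = m + 1 - k by omega,
      show m - 1 - k = m + 1 - (k + 2) by omega] at this
    exact this.symm
  pos := h.pos
  ne := by simpa using h.ne.symm
  not_adj := by simpa using fun h' : H.Adj (f (m + 1)) (f 0) => h.not_adj h'.symm
  not_collider k hk hk' := by
    have := h.not_collider (m + 1 - k) (by omega) (by omega)
    simpa [and_comm] using this

/-- Leaving out the inner nodes before `f k`. -/
lemma skip_to (h : H.IrreducibleWalk m f) {k : ℕ} (hk : 1 ≤ k) (hk' : k ≤ m)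
    (ha : H.Arrowhead (f 0) (f k)) :
    H.IrreducibleWalk (m - k + 1) fun t => if t = 0 then f 0 else f (t + k - 1) where
  collider t ht := by
    rcases t with _ | t
    · have h' := h.arrowhead_succ hk hk'
      simp only [show ¬ (0 + 1 = 0) by omega, show ¬ (0 + 2 = 0) by omega, if_false, if_true]
      rw [show 0 + 1 + k - 1 = k by omega, show 0 + 2 + k - 1 = k + 1 by omega]
      exact ⟨ha, h'⟩
    · have h' := h.collider (t + k) (by omega)
      simp only [show ¬ (t + 1 = 0) by omega, show ¬ (t + 1 + 1 = 0) by omega,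
        show ¬ (t + 1 + 2 = 0) by omega, if_false]
      rw [show t + 1 + k - 1 = t + k by omega, show t + 1 + 1 + k - 1 = t + k + 1 by omega,
        show t + 1 + 2 + k - 1 = t + k + 2 by omega]
      exact h'
  pos := by omega
  ne := by
    simp only [if_true, show ¬ (m - k + 1 + 1 = 0) by omega, if_false]
    rw [show m - k + 1 + 1 + k - 1 = m + 1 by omega]
    exact h.ne
  not_adj := by
    simp only [if_true, show ¬ (m - k + 1 + 1 = 0) by omega, if_false]
    rw [show m - k + 1 + 1 + k - 1 = m + 1 by omega]
    exact h.not_adj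
  not_collider t ht ht' := by
    simp only [if_true, show ¬ (m - k + 1 + 1 = 0) by omega, show ¬ (t = 0) by omega, if_false]
    rw [show m - k + 1 + 1 + k - 1 = m + 1 by omega]
    exact h.not_collider _ (by omega) (by omega)

/-- Leaving out the inner nodes between `f 1` and `f k`. -/
lemma skip_between (h : H.IrreducibleWalk m f) {k : ℕ} (hk : 2 ≤ k) (hk' : k ≤ m)
    (ha : H.arc (f 1) (f k)) :
    H.IrreducibleWalk (m - k + 2) fun t => if t ≤ 1 then f t else f (t + k - 2) where
  collider t ht := by
    rcases t with _ | _ | t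
    · have h' := h.succ_arrowhead (k := 0) (by omega)
      simp only [show 0 ≤ 1 by omega, show 0 + 1 ≤ 1 by omega, show ¬ (0 + 2 ≤ 1) by omega,
        if_false, if_true]
      rw [show 0 + 2 + k - 2 = k by omega]
      exact ⟨h', Or.inr (H.arc_symm ha)⟩
    · have h' := h.arrowhead_succ (k := k) (by omega) hk'
      simp only [show 0 + 1 ≤ 1 by omega, show ¬ (0 + 1 + 1 ≤ 1) by omega,
        show ¬ (0 + 1 + 2 ≤ 1) by omega, if_false, if_true]
      rw [show 0 + 1 + 1 + k - 2 = k by omega, show 0 + 1 + 2 + k - 2 = k + 1 by omega]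
      exact ⟨Or.inr ha, h'⟩
    · have h' := h.collider (t + k) (by omega)
      simp only [show ¬ (t + 1 + 1 ≤ 1) by omega, show ¬ (t + 1 + 1 + 1 ≤ 1) by omega,
        show ¬ (t + 1 + 1 + 2 ≤ 1) by omega, if_false]
      rw [show t + 1 + 1 + k - 2 = t + k by omega, show t + 1 + 1 + 1 + k - 2 = t + k + 1 by omega,
        show t + 1 + 1 + 2 + k - 2 = t + k + 2 by omega]
      exact h'
  pos := by omega
  ne := by
    simp only [show 0 ≤ 1 by omega, if_true, show ¬ (m - k + 2 + 1 ≤ 1) by omega, if_false]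
    rw [show m - k + 2 + 1 + k - 2 = m + 1 by omega]
    exact h.ne
  not_adj := by
    simp only [show 0 ≤ 1 by omega, if_true, show ¬ (m - k + 2 + 1 ≤ 1) by omega, if_false]
    rw [show m - k + 2 + 1 + k - 2 = m + 1 by omega]
    exact h.not_adj
  not_collider t ht ht' := by
    simp only [show 0 ≤ 1 by omega, if_true, show ¬ (m - k + 2 + 1 ≤ 1) by omega, if_false]
    rw [show m - k + 2 + 1 + k - 2 = m + 1 by omega]
    split_ifs
    · exact h.not_collider _ (by omega) (by omega)
    · exact h.not_collider _ (by omega) (by omega)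

/-- Leaving out a first part of the walk that returns to its first node. -/
lemma drop (h : H.IrreducibleWalk m f) {k : ℕ} (hk' : k < m) (he : f 0 = f k) :
    H.IrreducibleWalk (m - k) fun t => f (t + k) where
  collider t ht := by
    have := h.collider (t + k) (by omega)
    rwa [show t + k + 1 = t + 1 + k by omega, show t + k + 2 = t + 2 + k by omega] at this
  pos := by omega
  ne := by
    rw [show m - k + 1 + k = m + 1 by omega, Nat.zero_add, ← he]
    exact h.ne
  not_adj := by
    rw [show m - k + 1 + k = m + 1 by omega, Nat.zero_add, ← he]
    exact h.not_adj
  not_collider t ht ht' := by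
    rw [show m - k + 1 + k = m + 1 by omega, Nat.zero_add, ← he]
    exact h.not_collider _ (by omega) (by omega)

lemma not_arrowhead_of_minimal (h : H.IrreducibleWalk m f)
    (hmin : ∀ m' < m, ∀ f', ¬ H.IrreducibleWalk m' f') {k : ℕ} (hk : 2 ≤ k) (hk' : k ≤ m) :
    ¬ H.Arrowhead (f 0) (f k) :=
  fun h' => hmin _ (by omega) _ (h.skip_to (by omega) hk' h')

lemma not_arrowhead_of_minimal' (h : H.IrreducibleWalk m f)
    (hmin : ∀ m' < m, ∀ f', ¬ H.IrreducibleWalk m' f') {k : ℕ} (hk : 1 ≤ k) (hk' : k + 1 ≤ m) :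
    ¬ H.Arrowhead (f (m + 1)) (f k) := by
  have := h.reverse.not_arrowhead_of_minimal hmin (k := m + 1 - k) (by omega) (by omega)
  simpa [show m + 1 - (m + 1 - k) = k by omega] using this

lemma not_arc_of_minimal (h : H.IrreducibleWalk m f)
    (hmin : ∀ m' < m, ∀ f', ¬ H.IrreducibleWalk m' f') {k : ℕ} (hk : 3 ≤ k) (hk' : k ≤ m) :
    ¬ H.arc (f 1) (f k) :=
  fun h' => hmin _ (by omega) _ (h.skip_between (by omega) hk' h')

lemma ne_of_minimal (h : H.IrreducibleWalk m f)
    (hmin : ∀ m' < m, ∀ f', ¬ H.IrreducibleWalk m' f') {k : ℕ} (hk : 1 ≤ k) (hk' : k ≤ m) :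
    f 0 ≠ f k := by
  intro e
  rcases hk'.lt_or_eq with hk' | rfl
  · exact hmin _ (by omega) _ (h.drop hk' e)
  · exact h.not_adj (e ▸ (h.arrowhead_succ hk le_rfl).adj.symm)

/-- Otherwise, a collider between `f 0` and `f k` would lie on the part of the walk before `f k`, and
it could be used to shorten the walk. -/
lemma adj_or_arrow_of_minimal (h : H.IrreducibleWalk m f)
    (hmin : ∀ m' < m, ∀ f', ¬ H.IrreducibleWalk m' f') {k : ℕ} (hk : 3 ≤ k) (hk' : k ≤ m) :
    H.Adj (f 0) (f k) ∨ H.arrow (f k) (f 1) := by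
  by_contra! hcon
  refine hmin (k - 1) (by omega) f ⟨fun t ht => h.collider t (by omega), by omega, ?_, ?_, ?_⟩
  · rw [show k - 1 + 1 = k by omega]
    exact h.ne_of_minimal hmin (by omega) hk'
  · rw [show k - 1 + 1 = k by omega]
    exact hcon.1
  · rintro t ht ht' ⟨h₁, h₂⟩
    rw [show k - 1 + 1 = k by omega] at h₂
    rcases ht.eq_or_lt with rfl | ht
    · rcases h₂ with h₂ | h₂
      · exact hcon.2 h₂
      · exact h.not_arc_of_minimal hmin hk hk' (H.arc_symm h₂)
    · exact h.not_arrowhead_of_minimal hmin ht (by omega) h₁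

lemma adj_or_arrow_of_minimal' (h : H.IrreducibleWalk m f)
    (hmin : ∀ m' < m, ∀ f', ¬ H.IrreducibleWalk m' f') {k : ℕ} (hk : 1 ≤ k) (hk' : k + 2 ≤ m) :
    H.Adj (f (m + 1)) (f k) ∨ H.arrow (f k) (f m) := by
  have := h.reverse.adj_or_arrow_of_minimal hmin (k := m + 1 - k) (by omega) (by omega)
  simpa [show m + 1 - (m + 1 - k) = k by omega] using this

/-- An inner node other than the first inner node is a parent of the first node if they are adjacent. -/
lemma arrow_of_adj_of_minimal (h : H.IrreducibleWalk m f) (hH : H.IsAncestral)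
    (hmin : ∀ m' < m, ∀ f', ¬ H.IrreducibleWalk m' f') {k : ℕ} (hk : 2 ≤ k) (hk' : k ≤ m)
    (ha : H.Adj (f 0) (f k)) : H.arrow (f k) (f 0) :=
  hH.arrow_of_not_arrowhead (h.arrowhead_succ (by omega) hk') ha.symm
    (h.not_arrowhead_of_minimal hmin hk hk')

lemma arrow_of_adj_of_minimal' (h : H.IrreducibleWalk m f) (hH : H.IsAncestral)
    (hmin : ∀ m' < m, ∀ f', ¬ H.IrreducibleWalk m' f') {k : ℕ} (hk : 1 ≤ k) (hk' : k + 1 ≤ m)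
    (ha : H.Adj (f (m + 1)) (f k)) : H.arrow (f k) (f (m + 1)) :=
  hH.arrow_of_not_arrowhead (h.arrowhead_succ hk (by omega)) ha.symm
    (h.not_arrowhead_of_minimal' hmin hk hk')

lemma last_arrow_first_of_minimal (h : H.IrreducibleWalk m f) (hH : H.IsAncestral)
    (hmin : ∀ m' < m, ∀ f', ¬ H.IrreducibleWalk m' f') (hm : 3 ≤ m) : H.arrow (f m) (f 0) := by
  rcases h.adj_or_arrow_of_minimal hmin hm le_rfl with h₁ | h₁
  · exact h.arrow_of_adj_of_minimal hH hmin (by omega) le_rfl h₁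
  · exfalso
    rcases h.adj_or_arrow_of_minimal' hmin le_rfl hm with h₂ | h₂
    · have h₃ := h.arrow_of_adj_of_minimal' hH hmin le_rfl (by omega) h₂
      exact hH.1 _ _ (h.arrowhead_succ (by omega) le_rfl) ((Relation.TransGen.single h₁).tail h₃)
    · exact hH.not_arrow_of_arrowhead (Or.inl h₁) h₂

lemma first_arrow_last_of_minimal (h : H.IrreducibleWalk m f) (hH : H.IsAncestral)
    (hmin : ∀ m' < m, ∀ f', ¬ H.IrreducibleWalk m' f') (hm : 3 ≤ m) :
    H.arrow (f 1) (f (m + 1)) := by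
  have := h.reverse.last_arrow_first_of_minimal hH hmin hm
  simpa using this

lemma first_arc_of_minimal (h : H.IrreducibleWalk m f) (hH : H.IsAncestral)
    (hmin : ∀ m' < m, ∀ f', ¬ H.IrreducibleWalk m' f') (hm : 3 ≤ m) : H.arc (f 0) (f 1) := by
  rcases h.succ_arrowhead h.pos with h₁ | h₁
  · exfalso
    exact hH.1 _ _ (h.arrowhead_succ (by omega) le_rfl)
      (((Relation.TransGen.single (h.last_arrow_first_of_minimal hH hmin hm)).tail h₁).tail
        (h.first_arrow_last_of_minimal hH hmin hm))
  · exact h₁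

/-- In a shortest irreducible walk with at least three inner nodes, the inner nodes that are not
adjacent to an end node are parents of the first or last inner node; hence the end nodes cannot be
separated. -/
lemma not_minimal_of_three_le (h : H.IrreducibleWalk m f) (hH : H.IsMAG)
    (hmin : ∀ m' < m, ∀ f', ¬ H.IrreducibleWalk m' f') (hm : 3 ≤ m)
    (hcyc : m = 3 → H.Adj (f 0) (f 2) ∨ H.Adj (f 1) (f 3)) : False := by
  have hA := hH.1
  have hlast := h.last_arrow_first_of_minimal hA hmin hm
  have hfirst := h.first_arrow_last_of_minimal hA hmin hm
  have harc := h.first_arc_of_minimal hA hmin hm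
  obtain ⟨C, hi, hj, hs⟩ := hH.2 _ _ h.ne h.not_adj
  rw [hA.mSep_singleton_iff h.ne hi] at hs
  have h1C : f 1 ∈ C := by
    by_contra hn
    obtain ⟨n, hr⟩ := (Reach.start.head (Or.inr harc) (open_false hi)).step
      (Or.inr (Or.inl hfirst)) (open_of_not_arrowhead
        (fun h' => hA.not_arrow_of_arrowhead h' hfirst) hn)
    exact hs n hr
  have hback : ∀ k, H.arrow (f k) (f 0) → H.Reach C (f 0) false (f k) := fun k hk =>
    Reach.start.tail (Or.inr (Or.inr (Or.inl hk)))
      (fun h' => hA.not_arrow_of_arrowhead h' hk) (open_false hi)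
  have hmC : f m ∈ C := by
    by_contra hn
    obtain ⟨n, hr⟩ := (hback m hlast).step (h.arrowhead_succ (by omega) le_rfl).adj.symm
      (open_false hn)
    exact hs n hr
  -- Every inner node is reached with an arrowhead. At an inner node outside `C ∪ an(C)` the walk is
  -- replaced by the arrow from that node to `f 0`.
  have key : ∀ k, 1 ≤ k → k ≤ m → H.Reach C (f 0) true (f k) := by
    intro k hk
    induction k, hk using Nat.le_induction with
    | base => exact fun _ => Reach.start.head (Or.inr harc) (open_false hi)
    | succ k hk ih =>
      intro hk'
      have hr := ih (by omega)
      have ha := h.succ_arrowhead (k := k) (by omega)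
      have ha' := h.arrowhead_succ hk (by omega)
      by_cases hkC : H.AnteSet C (f k)
      · exact hr.head ha (open_collider ha' hkC)
      have hkC' : f k ∉ C := fun h' => hkC (Or.inl h')
      have hk2 : 2 ≤ k := by
        rcases hk.eq_or_lt with rfl | hk
        exacts [absurd h1C hkC', hk]
      have hnj : ¬ H.Adj (f (m + 1)) (f k) := by
        intro h₁
        have h₂ := h.arrow_of_adj_of_minimal' hA hmin hk hk' h₁
        obtain ⟨n, hr'⟩ := hr.step (Or.inr (Or.inl h₂)) (open_of_not_arrowhead
          (fun h' => hA.not_arrow_of_arrowhead h' h₂) hkC')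
        exact hs n hr'
      by_cases hni : H.Adj (f 0) (f k)
      · have h₁ := h.arrow_of_adj_of_minimal hA hmin hk2 (by omega) hni
        exact (hback k h₁).head ha (open_false hkC')
      -- Now `f k` is a parent of `f 1` or `f m`, unless `m = 3`.
      exfalso
      rcases Nat.lt_or_ge k 3 with hk3 | hk3
      · obtain rfl : k = 2 := by omega
        rcases Nat.lt_or_ge m 4 with hm4 | hm4
        · obtain rfl : m = 3 := by omega
          rcases (hcyc rfl).resolve_left hni with h₁ | h₁ | h₁ | h₁
          · exact hA.not_line_of_arrowhead (Or.inr harc) h₁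
          · exact hA.1 _ _ (Or.inr harc) ((Relation.TransGen.single h₁).tail hlast)
          · exact hA.1 _ _ (h.arrowhead_succ (by omega) le_rfl)
              ((Relation.TransGen.single h₁).tail hfirst)
          · exact h.not_arc_of_minimal hmin le_rfl le_rfl h₁
        · have h₁ := (h.adj_or_arrow_of_minimal' hmin hk (by omega)).resolve_left hnj
          exact hkC ((show H.AnteSet C (f m) from Or.inl hmC).of_arrow h₁)
      · have h₁ := (h.adj_or_arrow_of_minimal hmin hk3 (by omega)).resolve_left hni
        exact hkC ((show H.AnteSet C (f 1) from Or.inl h1C).of_arrow h₁)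
  obtain ⟨n, hr⟩ := (key m (by omega) le_rfl).step (h.arrowhead_succ (by omega) le_rfl).adj.symm
    (open_collider (h.arrowhead_succ (by omega) le_rfl) (Or.inl hmC))
  exact hs n hr

end IrreducibleWalk

lemma isColliderPath_quadruple {H : MixedGraph V} {a b c d : V} (hnd : [a, b, c, d].Nodup)
    (hab : H.Arrowhead a b) (hcb : H.Arrowhead c b) (hbc : H.Arrowhead b c)
    (hdc : H.Arrowhead d c) : H.IsColliderPath a d [a, b, c, d] := by
  refine ⟨⟨rfl, rfl, hnd, ?_⟩, ?_⟩
  · simp [hab.adj, hbc.adj, hdc.adj.symm]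
  · intro x y z h
    simp only [List.infix_cons_iff, List.cons_prefix_cons] at h
    simp at h
    rcases h with ⟨rfl, rfl, rfl⟩ | ⟨rfl, rfl, rfl⟩
    exacts [⟨hab, hcb⟩, ⟨hbc, hdc⟩]

lemma isMinimalColliderCycle_quadruple {H : MixedGraph V} {a b c d : V}
    (hnd : [a, b, c, d].Nodup) (hab : H.Arrowhead a b) (hcb : H.Arrowhead c b)
    (hbc : H.Arrowhead b c) (hdc : H.Arrowhead d c) (had : H.Adj a d) (hac : ¬ H.Adj a c)
    (hbd : ¬ H.Adj b d) : H.IsMinimalColliderCycle a d [a, b, c, d] := by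
  refine ⟨by simp, had, isColliderPath_quadruple hnd hab hcb hbc hdc, ?_⟩
  have inf : [a, b] <:+: [a, b, c, d] ∧ [b, c] <:+: [a, b, c, d] ∧ [c, d] <:+: [a, b, c, d] :=
    ⟨⟨[], [c, d], rfl⟩, ⟨[a], [d], rfl⟩, ⟨[a, b], [], rfl⟩⟩
  intro x hx y hy hxy
  simp only [List.mem_cons, List.not_mem_nil, or_false] at hx hy
  rcases hx with rfl | rfl | rfl | rfl <;> rcases hy with rfl | rfl | rfl | rfl <;>
    first
    | exact absurd rfl hxy.ne
    | exact absurd hxy hac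
    | exact absurd hxy.symm hac
    | exact absurd hxy hbd
    | exact absurd hxy.symm hbd
    | exact Or.inl inf.1
    | exact Or.inl inf.2.1
    | exact Or.inl inf.2.2
    | exact Or.inr (Or.inl inf.1)
    | exact Or.inr (Or.inl inf.2.1)
    | exact Or.inr (Or.inl inf.2.2)
    | exact Or.inr (Or.inr (Or.inl ⟨rfl, rfl⟩))
    | exact Or.inr (Or.inr (Or.inr ⟨rfl, rfl⟩))

/-- Without minimal collider paths and cycles of length four, every collider path between
non-adjacent nodes has an inner node that is on its own a collider between these nodes. -/
theorem IsMAG.not_irreducibleWalk {H : MixedGraph V} (hH : H.IsMAG) (hC : H.DAGCondition) (m : ℕ) :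
    ∀ f, ¬ H.IrreducibleWalk m f := by
  induction m using Nat.strong_induction_on with
  | _ m hmin =>
    intro f h
    have hpos := h.pos
    rcases Nat.lt_or_ge m 3 with hm | hm
    · obtain rfl | rfl : m = 1 ∨ m = 2 := by omega
      · exact h.not_collider 1 le_rfl le_rfl (h.collider 0 (by omega))
      · have h₁ := h.collider 0 (by omega)
        have h₂ := h.collider 1 (by omega)
        simp only [Nat.zero_add, Nat.reduceAdd] at h₁ h₂
        have h01 := h.ne_of_minimal hmin (k := 1) (by omega) (by omega)
        have h02 := h.ne_of_minimal hmin (k := 2) (by omega) (by omega)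
        have h03 : f 0 ≠ f 3 := h.ne
        have h12 := h₂.1.ne
        have h32 := h₂.2.ne
        have h13 : f 1 ≠ f 3 := fun e => h.not_adj (e ▸ h₁.1.adj)
        refine hC.2 ⟨f 0, f 3, [f 0, f 1, f 2, f 3], rfl, Or.inl ⟨h.not_adj, ?_, ?_⟩⟩
        · exact isColliderPath_quadruple (by simp [h01, h02, h03, h12, h32.symm, h13])
            h₁.1 h₁.2 h₂.1 h₂.2
        · rintro q ⟨⟨hq₁, hq₂, hq₃, hq₄⟩, hq₅⟩ hss
          obtain ⟨v, hv, hvq⟩ := Set.exists_of_ssubset hss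
          replace hv : v ∈ [f 0, f 1, f 2, f 3] := hv
          replace hvq : v ∉ q := hvq
          -- A proper subset of the four nodes that contains both ends has at most one inner node.
          have hlen : q.length ≤ 3 := by
            classical
            have hsub : q ⊆ [f 0, f 1, f 2, f 3].erase v := by
              intro x hx
              have hx' : x ∈ [f 0, f 1, f 2, f 3] := hss.1 hx
              exact (List.mem_erase_of_ne (by rintro rfl; exact hvq hx)).2 hx'
            have := (hq₃.subperm hsub).length_le
            rwa [List.length_erase_of_mem hv] at this
          match q, hlen with
          | [], _ => simp at hq₁
          | [a], _ =>
            simp at hq₁ hq₂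
            exact h03 (hq₁.symm.trans hq₂)
          | [a, b], _ =>
            simp at hq₁ hq₂ hq₄
            exact h.not_adj (hq₁ ▸ hq₂ ▸ hq₄)
          | [a, b, c], _ =>
            have hcol := hq₅ a b c ⟨[], [], rfl⟩
            simp at hq₁ hq₂
            subst hq₁ hq₂
            have hb : b ∈ [f 0, f 1, f 2, f 3] := hss.1 (by simp)
            simp at hb
            rcases hb with rfl | rfl | rfl | rfl
            · exact hcol.1.ne rfl
            · exact h.not_collider 1 (by omega) (by omega) hcol
            · exact h.not_collider 2 (by omega) (by omega) hcol
            · exact hcol.2.ne rfl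
    · refine h.not_minimal_of_three_le hH hmin hm ?_
      rintro rfl
      by_contra! hcon
      have hne : ∀ k, 1 ≤ k → k ≤ 3 → f 0 ≠ f k := fun k => h.ne_of_minimal hmin
      have h₁ := h.collider 0 (by omega)
      have h₂ := h.collider 1 (by omega)
      simp only [Nat.zero_add, Nat.reduceAdd] at h₁ h₂
      have h30 := h.last_arrow_first_of_minimal hH.1 hmin hm
      have h13 : f 1 ≠ f 3 := by
        intro e
        exact hH.1.not_arrow_of_arrowhead h₁.1 (e ▸ h30)
      exact hC.2 ⟨f 0, f 3, [f 0, f 1, f 2, f 3], rfl, Or.inr (isMinimalColliderCycle_quadruple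
        (by simp [hne 1, hne 2, hne 3, h₂.1.ne, h₂.2.ne.symm, h13]) h₁.1 h₁.2 h₂.1 h₂.2
        (Or.inr (Or.inr (Or.inl h30))) hcon.1 hcon.2)⟩

lemma exists_walk_of_reflTransGen {α : Type*} {r : α → α → Prop} {x y : α}
    (h : Relation.ReflTransGen r x y) :
    ∃ (n : ℕ) (f : ℕ → α), f 0 = x ∧ f n = y ∧ ∀ k < n, r (f k) (f (k + 1)) := by
  induction h using Relation.ReflTransGen.head_induction_on with
  | refl => exact ⟨0, fun _ => y, rfl, rfl, by simp⟩
  | @head a c hac _ ih =>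
    obtain ⟨n, f, h₀, hn, hf⟩ := ih
    refine ⟨n + 1, fun k => Nat.casesOn k a f, rfl, hn, fun k hk => ?_⟩
    rcases k with _ | k
    · simpa [h₀] using hac
    · exact hf k (by omega)

/-- Two non-adjacent nodes `i` and `j` that are joined by a collider path through a set `S` are
joined by one with a single inner node, which lies in `S`. -/
def CollidersReduce (H : MixedGraph V) : Prop :=
  ∀ (S : Set V) (i j x y : V), i ≠ j → ¬ H.Adj i j → H.Arrowhead i x → x ∈ S →
    Relation.ReflTransGen (fun u v => H.arc u v ∧ v ∈ S) x y → H.Arrowhead j y →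
      ∃ z ∈ S, H.Arrowhead i z ∧ H.Arrowhead j z

theorem IsMAG.collidersReduce {H : MixedGraph V} (hH : H.IsMAG) (hC : H.DAGCondition) :
    H.CollidersReduce := by
  intro S i j x y hij hn hix hx hxy hjy
  by_contra! hcon
  obtain ⟨n, f, rfl, rfl, hf⟩ := exists_walk_of_reflTransGen hxy
  have hS : ∀ k ≤ n, f k ∈ S := by
    intro k hk
    rcases k with _ | k
    exacts [hx, (hf k (by omega)).2]
  refine hH.not_irreducibleWalk hC (n + 1)
    (fun k => if k = 0 then i else if k ≤ n + 1 then f (k - 1) else j)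
    ⟨?_, by omega, by simpa using hij, by simpa using hn, ?_⟩
  · intro k hk
    constructor
    · rcases k with _ | k
      · simpa using hix
      · simp only [show ¬ (k + 1 = 0) by omega, show ¬ (k + 1 + 1 = 0) by omega,
          show k + 1 ≤ n + 1 by omega, show k + 1 + 1 ≤ n + 1 by omega, if_true, if_false]
        exact Or.inr (hf k (by omega)).1
    · rcases (show k < n ∨ k = n by omega) with hk' | rfl
      · simp only [show ¬ (k + 2 = 0) by omega, show ¬ (k + 1 = 0) by omega,
          show k + 2 ≤ n + 1 by omega, show k + 1 ≤ n + 1 by omega, if_true, if_false]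
        exact Or.inr (H.arc_symm (hf k (by omega)).1)
      · simpa using hjy
  · rintro k hk hk' ⟨h₁, h₂⟩
    simp only [if_true, show ¬ (n + 1 + 1 = 0) by omega, show ¬ (n + 1 + 1 ≤ n + 1) by omega,
      show ¬ (k = 0) by omega, show k ≤ n + 1 by omega, if_false] at h₁ h₂
    exact hcon _ (hS _ (by omega)) h₁ h₂

end MixedGraph

namespace MixedGraph

variable {V : Type*}

/-! ### Forced arcs -/

/-- The arc between `x` and `y` is part of an unshielded collider at `y`, so that it has to be
replaced by an arrow from `x` to `y`. -/
def Forced (H : MixedGraph V) (x y : V) : Prop :=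
  H.arc x y ∧ ∃ j, j ≠ x ∧ ¬ H.Adj j x ∧ H.Arrowhead j y

/-- Ancestral graphs without lines in which collider paths can be shortened and no arc is forced in
both directions. -/
structure Orientable (H : MixedGraph V) : Prop where
  ancestral : H.IsAncestral
  line_free : ∀ a b, ¬ H.line a b
  reduce : H.CollidersReduce
  forced_asymm : ∀ a b, H.Forced a b → ¬ H.Forced b a

/-- An arrow or a forced arc. -/
def ArrowOrForced (H : MixedGraph V) (x y : V) : Prop := H.arrow x y ∨ H.Forced x y

lemma Forced.arrowhead {H : MixedGraph V} {x y : V} (h : H.Forced x y) : H.Arrowhead x y :=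
  Or.inr h.1

lemma ArrowOrForced.arrowhead {H : MixedGraph V} {x y : V} (h : H.ArrowOrForced x y) :
    H.Arrowhead x y := h.imp id And.left

/-- The case of collider paths with four nodes. -/
lemma CollidersReduce.of_two {H : MixedGraph V} (h : H.CollidersReduce) {i z y j : V}
    (hij : i ≠ j) (hn : ¬ H.Adj i j) (hiz : H.Arrowhead i z) (hzy : H.arc z y)
    (hjy : H.Arrowhead j y) :
    (H.Arrowhead i z ∧ H.Arrowhead j z) ∨ (H.Arrowhead i y ∧ H.Arrowhead j y) := by
  obtain ⟨x, hx, hx'⟩ := h {z, y} i j z y hij hn hiz (by simp)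
    (Relation.ReflTransGen.single ⟨hzy, by simp⟩) hjy
  rcases hx with rfl | rfl
  exacts [Or.inl hx', Or.inr hx']

/-- If two consecutive edges of a collider path `⟨x, y, z⟩` are not part of a triangle and the
second one is an arc, then this arc is forced towards `y`. -/
lemma forced_of_not_adj {H : MixedGraph V} {x y z : V} (hxz : x ≠ z) (hn : ¬ H.Adj x z)
    (hxy : H.Arrowhead x y) (hzy : H.arc z y) : H.Forced z y :=
  ⟨hzy, x, hxz, hn, hxy⟩

namespace Orientable

variable {H : MixedGraph V}

lemma arrowhead_or_arrow (h : H.Orientable) {a b : V} (hab : H.Adj a b) :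
    H.Arrowhead a b ∨ H.arrow b a := by
  rcases hab with h' | h' | h' | h'
  exacts [absurd h' (h.line_free a b), Or.inl (Or.inl h'), Or.inr h', Or.inl (Or.inr h')]

lemma not_arrow_arrow (h : H.Orientable) {a b c : V} (hca : H.Arrowhead c a)
    (hab : H.arrow a b) : ¬ H.arrow b c :=
  fun hbc => h.ancestral.1 a c hca ((Relation.TransGen.single hab).tail hbc)

/-- Two consecutive forced arcs are part of a transitive triangle. -/
lemma arrowOrForced_of_forced_of_forced (h : H.Orientable) {x y z : V} (hxy : H.Forced x y)
    (hyz : H.Forced y z) : H.ArrowOrForced x z := by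
  obtain ⟨hxy', w, hwx, hwx', hwy⟩ := id hxy
  obtain ⟨hyz', j, hjy, hjy', hjz⟩ := id hyz
  have hzy' := H.arc_symm hyz'
  have hxz : x ≠ z := by
    rintro rfl
    exact h.forced_asymm _ _ hxy hyz
  have hadj : H.Adj x z := by
    by_contra hn
    exact h.forced_asymm _ _ hyz (forced_of_not_adj hxz hn (Or.inr hxy') hzy')
  have hyx : ¬ H.Arrowhead j x := fun h' =>
    h.forced_asymm _ _ hxy (forced_of_not_adj hjy hjy' h' (H.arc_symm hxy'))
  by_contra hcon
  have hxz_forced : ¬ H.Forced x z := fun h' => hcon (Or.inr h')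
  rcases h.arrowhead_or_arrow hadj with (h₁ | hxz') | hzx
  · exact hcon (Or.inl h₁)
  · have hjx_ne : j ≠ x := by
      rintro rfl
      exact hjy' (Or.inr (Or.inr (Or.inr hxy')))
    have hjx : H.Adj j x := by
      by_contra hn
      exact hxz_forced (forced_of_not_adj hjx_ne hn hjz hxz')
    have hxj : H.arrow x j := (h.arrowhead_or_arrow hjx).resolve_left hyx
    have hwz_ne : w ≠ z := by
      rintro rfl
      exact hwx' (Or.inr (Or.inr (Or.inr (H.arc_symm hxz'))))
    have hwz : H.Adj w z := by
      by_contra hn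
      exact h.forced_asymm _ _ hyz (forced_of_not_adj hwz_ne hn hwy hzy')
    have hzw : H.arrow z w := (h.arrowhead_or_arrow hwz).resolve_left fun h' =>
      hxz_forced (forced_of_not_adj hwx hwx' h' hxz')
    have hwy' : H.arc w y := by
      rcases hwy with h₁ | h₁
      · exact absurd h₁ (h.not_arrow_arrow (Or.inr hyz') hzw)
      · exact h₁
    have hjw_ne : j ≠ w := by
      rintro rfl
      exact h.ancestral.not_arrow_of_arrowhead hjz hzw
    have hjw : H.Adj j w := by
      by_contra hn
      rcases h.reduce.of_two hjw_ne hn hjz hzy' (Or.inr hwy') with ⟨-, h₁⟩ | ⟨h₁, -⟩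
      · exact h.ancestral.not_arrow_of_arrowhead h₁ hzw
      · exact hjy' h₁.adj
    rcases h.arrowhead_or_arrow hjw with h₁ | h₁
    · exact h.forced_asymm _ _
        (forced_of_not_adj hwx.symm (fun h' => hwx' h'.symm) (Or.inr hxy') hwy')
        (forced_of_not_adj hjy hjy' h₁ (H.arc_symm hwy')) |>.elim
    · exact h.not_arrow_arrow hjz hzw h₁
  · have hjx_ne : j ≠ x := by
      rintro rfl
      exact h.ancestral.not_arrow_of_arrowhead hjz hzx
    have hjx : H.Adj j x := by
      by_contra hn
      rcases h.reduce.of_two hjx_ne hn hjz hzy' (Or.inr hxy') with ⟨-, h₁⟩ | ⟨h₁, -⟩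
      · exact h.ancestral.not_arrow_of_arrowhead h₁ hzx
      · exact hjy' h₁.adj
    have hxj : H.arrow x j := (h.arrowhead_or_arrow hjx).resolve_left hyx
    exact h.not_arrow_arrow hjz hzx hxj

lemma arrowOrForced_asymm (h : H.Orientable) {x y : V} (hxy : H.ArrowOrForced x y) :
    ¬ H.ArrowOrForced y x := by
  rintro (h₁ | h₁)
  · exact h.ancestral.not_arrow_of_arrowhead hxy.arrowhead h₁
  · rcases hxy with h₂ | h₂
    · exact h.ancestral.not_arrow_of_arrowhead h₁.arrowhead h₂
    · exact h.forced_asymm _ _ h₁ h₂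

end Orientable

/-- `y` is reached from `x` in `n` steps. -/
def Steps {α : Type*} (r : α → α → Prop) : ℕ → α → α → Prop
  | 0, x, y => x = y
  | n + 1, x, y => ∃ z, r x z ∧ Steps r n z y

lemma Steps.trans {α : Type*} {r : α → α → Prop} : ∀ {m n : ℕ} {x y z : α}, Steps r m x y →
    Steps r n y z → Steps r (m + n) x z
  | 0, n, x, y, z, h, h' => by
    have : x = y := h
    rwa [this, Nat.zero_add]
  | m + 1, n, x, y, z, ⟨w, hw, h⟩, h' => by
    rw [show m + 1 + n = m + n + 1 by omega]
    exact ⟨w, hw, h.trans h'⟩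

lemma Steps.single {α : Type*} {r : α → α → Prop} {x y : α} (h : r x y) : Steps r 1 x y :=
  ⟨y, h, rfl⟩

lemma Steps.of_transGen {α : Type*} {r : α → α → Prop} {x y : α} (h : Relation.TransGen r x y) :
    ∃ n, 1 ≤ n ∧ Steps r n x y := by
  induction h with
  | single h => exact ⟨1, le_rfl, Steps.single h⟩
  | tail _ h ih =>
    obtain ⟨n, hn, h'⟩ := ih
    exact ⟨n + 1, by omega, h'.trans (Steps.single h)⟩

lemma Steps.exists_fun {α : Type*} {r : α → α → Prop} : ∀ {n : ℕ} {x y : α}, Steps r n x y →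
    ∃ c : ℕ → α, c 0 = x ∧ c n = y ∧ ∀ k < n, r (c k) (c (k + 1))
  | 0, x, y, h => ⟨fun _ => x, rfl, h, by simp⟩
  | n + 1, x, y, ⟨z, hz, h⟩ => by
    obtain ⟨c, h₀, hn, hc⟩ := h.exists_fun
    refine ⟨fun k => Nat.casesOn k x c, rfl, hn, fun k hk => ?_⟩
    rcases k with _ | k
    · simpa [h₀] using hz
    · exact hc k (by omega)

lemma Steps.of_fun {α : Type*} {r : α → α → Prop} {c : ℕ → α} {n : ℕ}
    (hc : ∀ k < n, r (c k) (c (k + 1))) (i : ℕ) : ∀ d, i + d ≤ n → Steps r d (c i) (c (i + d))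
  | 0, _ => rfl
  | d + 1, hd => (Steps.of_fun hc i d (by omega)).trans (Steps.single (hc (i + d) (by omega)))

lemma Steps.of_fun' {α : Type*} {r : α → α → Prop} {c : ℕ → α} {n : ℕ}
    (hc : ∀ k < n, r (c k) (c (k + 1))) {i j : ℕ} (hij : i ≤ j) (hj : j ≤ n) :
    Steps r (j - i) (c i) (c j) := by
  have := Steps.of_fun hc i (j - i) (by omega)
  rwa [show i + (j - i) = j by omega] at this

/-- A walk that consists of steps of two kinds has only steps of the first kind, or has a step of
the second kind somewhere. -/
lemma Steps.transGen_or_split {α : Type*} {r s : α → α → Prop} : ∀ {n : ℕ} {x y : α}, 1 ≤ n →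
    Steps (fun a b => r a b ∨ s a b) n x y → Relation.TransGen r x y ∨
      ∃ a b k l, k + l + 1 = n ∧ Steps (fun a b => r a b ∨ s a b) k x a ∧ s a b ∧
        Steps (fun a b => r a b ∨ s a b) l b y
  | n + 1, x, y, _, ⟨z, hz, h⟩ => by
    rcases hz with hz | hz
    · rcases Nat.eq_zero_or_pos n with rfl | hn
      · have : z = y := h
        exact Or.inl (Relation.TransGen.single (this ▸ hz))
      · rcases h.transGen_or_split hn with h' | ⟨a, b, k, l, hkl, h₁, h₂, h₃⟩
        · exact Or.inl (Relation.TransGen.head hz h')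
        · exact Or.inr ⟨a, b, k + 1, l, by omega, ⟨z, Or.inl hz, h₁⟩, h₂, h₃⟩
    · exact Or.inr ⟨x, z, 0, n, by omega, rfl, hz, h⟩

namespace Orientable

variable {H : MixedGraph V}

/-- A shortest cycle of arrows and forced arcs that starts with a forced arc has at most three
nodes. In a longer one, the head `c 1` of the forced arc is joined by unforced arcs to all nodes of
the cycle but its two neighbours, so that arrows and forced arcs alternate; this yields a collider
path between `c 2` and `c 4` that cannot be shortened. -/
lemma false_of_minimal_cycle (h : H.Orientable) {n : ℕ} {c : ℕ → V} (hn : 4 ≤ n)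
    (hc : ∀ k < n, H.ArrowOrForced (c k) (c (k + 1))) (hc0 : c n = c 0)
    (hmin : ∀ m < n, 1 ≤ m → ∀ x, ¬ Steps H.ArrowOrForced m x x) (h01 : H.Forced (c 0) (c 1)) :
    False := by
  have hst : ∀ {i j : ℕ}, i ≤ j → j ≤ n → Steps H.ArrowOrForced (j - i) (c i) (c j) :=
    fun {i j} => Steps.of_fun' hc
  -- Chords that are arrows or forced arcs would give a shorter cycle.
  have hback : ∀ {i j : ℕ}, i < j → j + 1 < n + i → j ≤ n → ¬ H.ArrowOrForced (c j) (c i) :=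
    fun {i j} hij hj hjn h' => hmin _ (by omega) (by omega) _
      ((hst hij.le hjn).trans (Steps.single h'))
  have hforth : ∀ {i j : ℕ}, i + 1 < j → j ≤ n → ¬ H.ArrowOrForced (c i) (c j) :=
    fun {i j} hij hj h' => by
      have h₁ := hst hj le_rfl
      rw [hc0] at h₁
      have h₂ := (h₁.trans (hst (Nat.zero_le i) (by omega))).trans (Steps.single h')
      exact hmin _ (by omega) (by omega) _ h₂
  have hne : ∀ {i j : ℕ}, i < j → j < n + i → j ≤ n → c i ≠ c j := fun {i j} hij hj hjn e => by
    have := hst hij.le hjn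
    rw [← e] at this
    exact hmin _ (by omega) (by omega) _ this
  have harc : ∀ {i j : ℕ}, i + 1 < j → j + 1 < n + i → j ≤ n → H.Adj (c j) (c i) →
      H.arc (c j) (c i) := by
    intro i j hij hj hjn ha
    rcases h.arrowhead_or_arrow ha with (h₁ | h₁) | h₁
    · exact absurd (Or.inl h₁) (hback (by omega) hj hjn)
    · exact h₁
    · exact absurd (Or.inl h₁) (hforth hij hjn)
  -- Backwards along the cycle: an edge to an endpoint of an unforced arc also has a neighbour at
  -- the other endpoint.
  have hall : ∀ d, d + 4 ≤ n → H.arc (c (n - 1 - d)) (c 1) := by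
    intro d
    induction d with
    | zero =>
      intro _
      refine harc (by omega) (by omega) (by omega) ?_
      by_contra hna
      have h₁ := (hc (n - 1) (by omega)).arrowhead
      rw [show n - 1 + 1 = n by omega, hc0] at h₁
      exact h.forced_asymm _ _ h01 (forced_of_not_adj (hne (by omega) (by omega) (by omega)).symm
        hna h₁ (H.arc_symm h01.1))
    | succ d ih =>
      intro hd
      refine harc (by omega) (by omega) (by omega) ?_
      by_contra hna
      have h₁ := (hc (n - 1 - (d + 1)) (by omega)).arrowhead
      have h₂ := ih (by omega)
      rw [show n - 1 - (d + 1) + 1 = n - 1 - d by omega] at h₁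
      exact hforth (i := 1) (j := n - 1 - d) (by omega) (by omega) (Or.inr (forced_of_not_adj
        (hne (by omega) (by omega) (by omega)).symm hna h₁ (H.arc_symm h₂)))
  have h31 : H.arc (c 3) (c 1) := by
    have := hall (n - 4) (by omega)
    rwa [show n - 1 - (n - 4) = 3 by omega] at this
  have h41 : H.arc (c 4) (c 1) := by
    rcases hn.eq_or_lt with rfl | hn
    · rw [hc0]
      exact h01.1
    · have := hall (n - 5) (by omega)
      rwa [show n - 1 - (n - 5) = 4 by omega] at this
  have h12 : H.arrow (c 1) (c 2) := by
    rcases hc 1 (by omega) with h₁ | h₁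
    · exact h₁
    · exact absurd (h.arrowOrForced_of_forced_of_forced h01 h₁)
        (hforth (i := 0) (j := 2) (by omega) (by omega))
  have h23 : H.Forced (c 2) (c 3) := by
    rcases hc 2 (by omega) with h₁ | h₁
    · exact absurd h₁ (h.not_arrow_arrow (Or.inr h31) h12)
    · exact h₁
  have h34 : H.arrow (c 3) (c 4) := by
    rcases hc 3 (by omega) with h₁ | h₁
    · exact h₁
    · exact absurd (h.arrowOrForced_of_forced_of_forced h23 h₁) (hforth (by omega) (by omega))
  have h43 : ¬ H.Arrowhead (c 4) (c 3) := fun h' => h.ancestral.not_arrow_of_arrowhead h' h34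
  have h24 : H.arc (c 4) (c 2) := by
    refine harc (by omega) (by omega) (by omega) ?_
    by_contra hna
    rcases h.reduce.of_two (hne (i := 2) (j := 4) (by omega) (by omega) (by omega))
      (fun h' => hna h'.symm) h23.arrowhead h31 (Or.inr h41) with ⟨-, h₁⟩ | ⟨h₁, -⟩
    · exact h43 h₁
    · exact h.ancestral.not_arrow_of_arrowhead h₁ h12
  obtain ⟨h23', j, hj2, hj2', hj3⟩ := h23
  have hj4_ne : j ≠ c 4 := fun e => h43 (e ▸ hj3)
  have hj4 : H.Adj j (c 4) := by
    by_contra hna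
    rcases h.reduce.of_two hj4_ne hna hj3 (H.arc_symm h23') (Or.inr h24) with ⟨-, h₁⟩ | ⟨h₁, -⟩
    · exact h43 h₁
    · exact hj2' h₁.adj
  rcases h.arrowhead_or_arrow hj4 with h₁ | h₁
  · exact hforth (i := 2) (j := 4) (by omega) (by omega)
      (Or.inr (forced_of_not_adj hj2 hj2' h₁ (H.arc_symm h24)))
  · exact h.not_arrow_arrow hj3 h34 h₁

/-- Replacing the forced arcs by arrows does not create cycles. -/
theorem not_transGen_arrowOrForced (h : H.Orientable) (x : V) :
    ¬ Relation.TransGen H.ArrowOrForced x x := by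
  intro hx
  have hex : ∃ n, 1 ≤ n ∧ ∃ x, Steps H.ArrowOrForced n x x := by
    obtain ⟨n, hn, h'⟩ := Steps.of_transGen hx
    exact ⟨n, hn, x, h'⟩
  classical
  obtain ⟨hn, y, hy⟩ := Nat.find_spec hex
  have hmin : ∀ m < Nat.find hex, 1 ≤ m → ∀ x, ¬ Steps H.ArrowOrForced m x x :=
    fun m hm hm' x hx => Nat.find_min hex hm ⟨hm', x, hx⟩
  generalize Nat.find hex = n at hn hy hmin
  rcases hy.transGen_or_split hn with hy' | ⟨a, b, k, l, hkl, h₁, h₂, h₃⟩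
  · obtain ⟨z, hz, hzy⟩ := Relation.TransGen.tail'_iff.1 hy'
    rcases Relation.reflTransGen_iff_eq_or_transGen.1 hz with rfl | hz
    · exact H.arrow_irrefl _ hzy
    · exact h.ancestral.1 _ _ (Or.inl hzy) hz
  · -- Rotated, the cycle starts with a forced arc.
    obtain ⟨c, hc0, hcl, hc⟩ := (Steps.trans (r := H.ArrowOrForced) h₃ h₁).exists_fun
    let c' : ℕ → V := fun t => Nat.casesOn t a c
    have hc' : ∀ t < n, H.ArrowOrForced (c' t) (c' (t + 1)) := by
      intro t ht
      rcases t with _ | t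
      · have : H.ArrowOrForced a (c 0) := hc0 ▸ Or.inr h₂
        exact this
      · exact hc t (by omega)
    have hcn : c' n = c' 0 := by
      have : n = l + k + 1 := by omega
      rw [this]
      exact hcl
    have h01 : H.Forced (c' 0) (c' 1) := by
      have : H.Forced a (c 0) := hc0 ▸ h₂
      exact this
    clear_value c'
    rcases Nat.lt_or_ge n 4 with hn4 | hn4
    · obtain rfl | rfl | rfl : n = 1 ∨ n = 2 ∨ n = 3 := by omega
      · exact H.arc_irrefl _ (hcn ▸ h01.1)
      · exact h.arrowOrForced_asymm (Or.inr h01) (hcn ▸ hc' 1 (by omega))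
      · have h12 := hc' 1 (by omega)
        have h20 : H.ArrowOrForced (c' 2) (c' 0) := hcn ▸ hc' 2 (by omega)
        rcases h12 with h₁ | h₁
        · rcases h20 with h₂ | h₂
          · exact h.not_arrow_arrow h01.arrowhead h₁ h₂
          · exact h.arrowOrForced_asymm (Or.inl h₁)
              (h.arrowOrForced_of_forced_of_forced h₂ h01)
        · exact h.arrowOrForced_asymm (h.arrowOrForced_of_forced_of_forced h01 h₁) h20
    · exact h.false_of_minimal_cycle hn4 hc' hcn hmin h01

end Orientable

end MixedGraph

namespace MixedGraph

variable {V : Type*}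

/-! ### Replacing a single arc -/

section CanGo

variable {H : MixedGraph V} {C : Set V} {i : V}

/-- `y` is reached from `i` in a state that allows all continuations that are allowed after
arriving with an arrowhead at `y`. -/
def ReachHead (H : MixedGraph V) (C : Set V) (i y : V) : Prop :=
  H.Reach C i true y ∨ (H.Reach C i false y ∧ y ∉ C)

/-- Some connecting walk from `i` to `y` may go on to `z`. -/
def CanGo (H : MixedGraph V) (C : Set V) (i y z : V) : Prop :=
  ∃ m, H.Reach C i m y ∧ H.Open C m y z

/-- Some connecting walk from `i` to `b` may go on along any edge with an arrowhead at `b`. -/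
def Passes (H : MixedGraph V) (C : Set V) (i b : V) : Prop :=
  (H.Reach C i true b ∧ H.AnteSet C b) ∨ (H.Reach C i false b ∧ b ∉ C)

lemma CanGo.head {y z : V} (h : H.CanGo C i y z) (hyz : H.Arrowhead y z) : H.Reach C i true z := by
  obtain ⟨m, hm, ho⟩ := h
  exact hm.head hyz ho

lemma CanGo.tail {y z : V} (h : H.CanGo C i y z) (hyz : H.Adj y z) (hn : ¬ H.Arrowhead y z) :
    H.Reach C i false z := by
  obtain ⟨m, hm, ho⟩ := h
  exact hm.tail hyz hn ho

lemma Reach.canGo {y : V} (h : H.Reach C i false y) (hy : y ∉ C) (z : V) : H.CanGo C i y z :=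
  ⟨false, h, open_false hy⟩

lemma ReachHead.canGo {y z : V} (h : H.ReachHead C i y) (h₁ : H.Arrowhead z y → H.AnteSet C y)
    (h₂ : ¬ H.Arrowhead z y → y ∉ C) : H.CanGo C i y z := by
  rcases h with h | ⟨h, hy⟩
  · by_cases hzy : H.Arrowhead z y
    · exact ⟨true, h, open_collider hzy (h₁ hzy)⟩
    · exact ⟨true, h, open_of_not_arrowhead hzy (h₂ hzy)⟩
  · exact h.canGo hy z

lemma Passes.canGo {b z : V} (h : H.Passes C i b) (hz : H.Arrowhead z b) : H.CanGo C i b z := by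
  rcases h with ⟨h, hb⟩ | ⟨h, hb⟩
  · exact ⟨true, h, open_collider hz hb⟩
  · exact h.canGo hb z

lemma Passes.reachHead {b : V} (h : H.Passes C i b) : H.ReachHead C i b := h.imp And.left id

lemma ReachHead.passes {b : V} (h : H.ReachHead C i b) (hb : H.AnteSet C b) : H.Passes C i b :=
  h.imp (fun h => ⟨h, hb⟩) id

lemma Open.of_false {y z : V} (h : H.Open C false y z) : y ∉ C := by
  rcases h with ⟨h, -⟩ | ⟨-, h⟩
  · simp at h
  · exact h

lemma Open.anteSet {y z : V} (h : H.Open C true y z) (hz : H.Arrowhead z y) : H.AnteSet C y := by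
  rcases h with ⟨-, -, h⟩ | ⟨h, -⟩
  · exact h
  · exact absurd ⟨rfl, hz⟩ h

lemma Open.notMem {m : Bool} {y z : V} (h : H.Open C m y z) (hz : ¬ H.Arrowhead z y) : y ∉ C := by
  rcases h with ⟨-, h, -⟩ | ⟨-, h⟩
  · exact absurd h hz
  · exact h

end CanGo

/-- `y` is `a`, or a parent of `b` that is joined to `a` by a sequence of arcs all of whose nodes
before `a` are parents of `b`. A collider path that goes on from `y` in this way is a discriminating
path for `a` if its first node is not adjacent to `b`. -/
def Discriminates (K : MixedGraph V) (a b y : V) : Prop :=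
  (y = a ∨ K.arrow y b) ∧
    Relation.ReflTransGen (fun u v => K.arc u v ∧ (v = a ∨ K.arrow v b)) y a

/-- The arc between `a` and `b` can be replaced by an arrow from `a` to `b`: nodes with an edge
that points to `a`, or to a node of a discriminating path for `a`, have an edge that points to
`b`. -/
structure ReplaceableArc (K : MixedGraph V) (a b : V) : Prop where
  ancestral : K.IsAncestral
  line_free : ∀ x y, ¬ K.line x y
  arc : K.arc a b
  arrow_of_arrow : ∀ c, K.arrow c a → K.arrow c b
  arrowhead_of_discriminates : ∀ c y, c ≠ b → K.Arrowhead c y → K.Discriminates a b y →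
    K.Arrowhead c b

section Replace

variable {K : MixedGraph V} {a b : V}

lemma replaceArc_adj {x y : V} : (K.replaceArc a b).Adj x y ↔ K.Adj x y := by
  unfold Adj
  simp only [replaceArc]
  constructor
  · rintro (h | (h | ⟨h, -⟩) | (h | ⟨h, -⟩) | ⟨h, -⟩)
    exacts [Or.inl h, Or.inr (Or.inl h), Or.inr (Or.inr (Or.inr h)), Or.inr (Or.inr (Or.inl h)),
      Or.inr (Or.inr (Or.inr (K.arc_symm h))), Or.inr (Or.inr (Or.inr h))]
  · rintro (h | h | h | h)
    · exact Or.inl h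
    · exact Or.inr (Or.inl (Or.inl h))
    · exact Or.inr (Or.inr (Or.inl (Or.inl h)))
    · by_cases h₁ : x = a ∧ y = b
      · exact Or.inr (Or.inl (Or.inr ⟨h, h₁⟩))
      · by_cases h₂ : x = b ∧ y = a
        · exact Or.inr (Or.inr (Or.inl (Or.inr ⟨K.arc_symm h, h₂.2, h₂.1⟩)))
        · exact Or.inr (Or.inr (Or.inr ⟨h, h₁, h₂⟩))

lemma replaceArc_arrowhead_of_ne {x y : V} (h : ¬ (x = b ∧ y = a)) :
    (K.replaceArc a b).Arrowhead x y ↔ K.Arrowhead x y := by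
  simp only [Arrowhead, replaceArc]
  constructor
  · rintro ((h' | ⟨h', -⟩) | ⟨h', -⟩)
    exacts [Or.inl h', Or.inr h', Or.inr h']
  · rintro (h' | h')
    · exact Or.inl (Or.inl h')
    · by_cases h₁ : x = a ∧ y = b
      exacts [Or.inl (Or.inr ⟨h', h₁⟩), Or.inr ⟨h', h₁, h⟩]

namespace ReplaceableArc

lemma ne (hK : K.ReplaceableArc a b) : a ≠ b :=
  Arrowhead.ne (Or.inr hK.arc)

lemma not_arrowhead (hK : K.ReplaceableArc a b) : ¬ (K.replaceArc a b).Arrowhead b a := by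
  rintro ((h | ⟨-, h, -⟩) | ⟨-, -, h⟩)
  · exact hK.ancestral.not_arrow_of_arrowhead (Or.inr hK.arc) h
  · exact hK.ne h.symm
  · exact h ⟨rfl, rfl⟩

lemma discriminates_self (_ : K.ReplaceableArc a b) : K.Discriminates a b a :=
  ⟨Or.inl rfl, Relation.ReflTransGen.refl⟩

lemma not_discriminates (hK : K.ReplaceableArc a b) : ¬ K.Discriminates a b b := fun h =>
  h.1.elim (fun h' => hK.ne h'.symm) (K.arrow_irrefl b)

lemma arrowhead_or_arrow (hK : K.ReplaceableArc a b) {x y : V} (hxy : K.Adj x y) :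
    K.Arrowhead x y ∨ K.arrow y x := by
  rcases hxy with h' | h' | h' | h'
  exacts [absurd h' (hK.line_free x y), Or.inl (Or.inl h'), Or.inr h', Or.inl (Or.inr h')]

lemma arrow_of_discriminates (hK : K.ReplaceableArc a b) {c y : V} (hcb : c ≠ b)
    (hc : K.arrow c y) (hy : K.Discriminates a b y) : K.arrow c b := by
  rcases hK.arrowhead_of_discriminates c y hcb (Or.inl hc) hy with h | h
  · exact h
  · rcases hy.1 with rfl | h'
    · exact hK.arrow_of_arrow c hc
    · exact absurd ((Relation.TransGen.single hc).tail h')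
        (hK.ancestral.1 c b (Or.inr (K.arc_symm h)))

lemma discriminates_of_arc (_ : K.ReplaceableArc a b) {c y : V} (hc : c = a ∨ K.arrow c b)
    (hcy : K.arc c y) (hy : K.Discriminates a b y) : K.Discriminates a b c :=
  ⟨hc, Relation.ReflTransGen.head ⟨hcy, hy.1⟩ hy.2⟩

/-- An edge with an arrowhead at a node `y` of a discriminating path does not lead to `b`, unless
it is the arc that is replaced. -/
lemma ne_of_discriminates (hK : K.ReplaceableArc a b) {w y : V} (hwy : K.Arrowhead w y)
    (hy : K.Discriminates a b y) (hn : ¬ (w = b ∧ y = a)) : w ≠ b := by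
  rintro rfl
  rcases hy.1 with rfl | h
  · exact hn ⟨rfl, rfl⟩
  · exact hK.ancestral.not_arrow_of_arrowhead hwy h

lemma ancestor_replaceArc (_ : K.ReplaceableArc a b) {x y : V} (h : K.Ancestor x y) :
    (K.replaceArc a b).Ancestor x y :=
  Relation.TransGen.mono (p := (K.replaceArc a b).arrow) (fun _ _ h' => Or.inl h') _ _ h

lemma ancestor_of_replaceArc (hK : K.ReplaceableArc a b) {x y : V}
    (h : (K.replaceArc a b).Ancestor x y) :
    K.Ancestor x y ∨ ((x = a ∨ K.Ancestor x b) ∧ (b = y ∨ K.Ancestor b y)) := by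
  induction h using Relation.TransGen.head_induction_on with
  | single h =>
    rcases h with h | ⟨-, rfl, rfl⟩
    exacts [Or.inl (Relation.TransGen.single h), Or.inr ⟨Or.inl rfl, Or.inl rfl⟩]
  | head h _ ih =>
    rcases h with h | ⟨-, rfl, rfl⟩
    · rcases ih with ih | ⟨rfl | ih, ih'⟩
      · exact Or.inl (Relation.TransGen.head h ih)
      · exact Or.inr ⟨Or.inr (Relation.TransGen.single (hK.arrow_of_arrow _ h)), ih'⟩
      · exact Or.inr ⟨Or.inr (Relation.TransGen.head h ih), ih'⟩
    · rcases ih with ih | ⟨-, ih'⟩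
      · exact Or.inr ⟨Or.inl rfl, Or.inr ih⟩
      · exact Or.inr ⟨Or.inl rfl, ih'⟩

lemma anteSet_replaceArc (hK : K.ReplaceableArc a b) {C : Set V} {x : V} (h : K.AnteSet C x) :
    (K.replaceArc a b).AnteSet C x := by
  rcases h with h | ⟨d, hd, h⟩
  exacts [Or.inl h, Or.inr ⟨d, hd, hK.ancestor_replaceArc h⟩]

lemma anteSet_of_replaceArc (hK : K.ReplaceableArc a b) {C : Set V} {x : V}
    (h : (K.replaceArc a b).AnteSet C x) : K.AnteSet C x ∨ (x = a ∧ K.AnteSet C b) := by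
  rcases h with h | ⟨d, hd, h⟩
  · exact Or.inl (Or.inl h)
  · rcases hK.ancestor_of_replaceArc h with h | ⟨h, h'⟩
    · exact Or.inl (Or.inr ⟨d, hd, h⟩)
    · have hb : K.AnteSet C b := by
        rcases h' with rfl | h'
        exacts [Or.inl hd, Or.inr ⟨d, hd, h'⟩]
      rcases h with h | h
      exacts [Or.inr ⟨h, hb⟩, Or.inl (hb.of_ancestor h)]

variable {C : Set V} {i : V}

/-- The state of the new graph that corresponds to a state of the old one: a walk that arrives at
`a` along the replaced arc, or at another discriminating node after that, is represented by a walk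
to `b`, from which there is a shortcut to every node that points to the discriminating node. Every
walk that arrives at a discriminating node has a shortcut to `b`. -/
def NewState (K : MixedGraph V) (a b : V) (C : Set V) (i : V) (m : Bool) (y : V) : Prop :=
  (m = false → (K.replaceArc a b).Reach C i false y) ∧
    (m = true → ((K.replaceArc a b).ReachHead C i y ∨
      (K.Discriminates a b y ∧ (K.replaceArc a b).Passes C i b)) ∧
      (K.Discriminates a b y → (K.replaceArc a b).ReachHead C i b))

/-- Before the step, the walk in the new graph is either at `y`, too, or at `b`. In the latter case
it can do without the detour via `y`, as an edge that points to `y` is accompanied by one that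
points to `b`. -/
lemma newState_step (hK : K.ReplaceableArc a b) {m : Bool} {y w : V}
    (hP : NewState K a b C i m y) (hyw : K.Adj y w) (ho : K.Open C m y w) :
    (K.Arrowhead y w → NewState K a b C i true w) ∧
      (¬ K.Arrowhead y w → NewState K a b C i false w) := by
  have hab' : (K.replaceArc a b).Arrowhead a b :=
    (replaceArc_arrowhead_of_ne fun h => hK.ne h.1).2 (Or.inr hK.arc)
  by_cases e₁ : y = b ∧ w = a
  · obtain ⟨rfl, rfl⟩ := e₁
    have hb : (K.replaceArc w y).Passes C i y := by
      cases m with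
      | false => exact Or.inr ⟨hP.1 rfl, ho.of_false⟩
      | true =>
        have h₁ := hK.anteSet_replaceArc (ho.anteSet (Or.inr hK.arc))
        rcases (hP.2 rfl).1 with h | ⟨h, -⟩
        · exact h.passes h₁
        · exact absurd h hK.not_discriminates
    refine ⟨fun _ => ⟨by simp, fun _ => ⟨Or.inr ⟨hK.discriminates_self, hb⟩,
      fun _ => hb.reachHead⟩⟩, fun hn => absurd (Or.inr (K.arc_symm hK.arc)) hn⟩
  by_cases e₂ : y = a ∧ w = b
  · obtain ⟨rfl, rfl⟩ := e₂
    refine ⟨fun _ => ⟨by simp, fun _ => ⟨Or.inl ?_, fun h => absurd h hK.not_discriminates⟩⟩,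
      fun hn => absurd (Or.inr hK.arc) hn⟩
    cases m with
    | false => exact Or.inl (((hP.1 rfl).canGo ho.of_false w).head hab')
    | true => exact (hP.2 rfl).2 hK.discriminates_self
  have hyw' : (K.replaceArc a b).Arrowhead y w ↔ K.Arrowhead y w := replaceArc_arrowhead_of_ne e₁
  have hwy' : (K.replaceArc a b).Arrowhead w y ↔ K.Arrowhead w y :=
    replaceArc_arrowhead_of_ne fun h => e₂ ⟨h.2, h.1⟩
  -- From now on, the edge between `y` and `w` is the same in both graphs.
  have hcase : (K.replaceArc a b).CanGo C i y w ∨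
      (K.Discriminates a b y ∧ (K.replaceArc a b).Passes C i b ∧ K.Arrowhead w y) := by
    cases m with
    | false => exact Or.inl ((hP.1 rfl).canGo ho.of_false w)
    | true =>
      rcases (hP.2 rfl).1 with h | ⟨h, hb⟩
      · refine Or.inl (h.canGo ?_ ?_)
        · exact fun h' => hK.anteSet_replaceArc (ho.anteSet (hwy'.1 h'))
        · exact fun h' => ho.notMem fun h'' => h' (hwy'.2 h'')
      · by_cases h₁ : K.Arrowhead w y
        · exact Or.inr ⟨h, hb, h₁⟩
        · have hyb : (K.replaceArc a b).arrow y b := by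
            rcases h.1 with rfl | h₂
            exacts [Or.inr ⟨hK.arc, rfl, rfl⟩, Or.inl h₂]
          have hby : ¬ (K.replaceArc a b).Arrowhead b y := by
            rcases h.1 with rfl | h₂
            · exact hK.not_arrowhead
            · have : y ≠ a := by
                rintro rfl
                exact hK.ancestral.not_arrow_of_arrowhead (Or.inr (K.arc_symm hK.arc)) h₂
              rw [replaceArc_arrowhead_of_ne fun h => this h.2]
              exact fun h₃ => hK.ancestral.not_arrow_of_arrowhead h₃ h₂
          have := (hb.canGo (Or.inl hyb)).tail (Or.inr (Or.inr (Or.inl hyb))) hby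
          exact Or.inl (this.canGo (ho.notMem h₁) w)
  constructor
  · intro hah
    refine ⟨by simp, fun _ => ⟨?_, fun hw => ?_⟩⟩
    · rcases hcase with h | ⟨h, hb, hwy⟩
      · exact Or.inl (Or.inl (h.head (hyw'.2 hah)))
      · have hwb_ne := hK.ne_of_discriminates hwy h fun h' => e₂ ⟨h'.2, h'.1⟩
        have harc := K.arc_symm (hK.ancestral.arc_of_arrowhead hah hwy)
        rcases hK.arrowhead_of_discriminates w y hwb_ne hwy h with h₁ | h₁
        · exact Or.inr ⟨hK.discriminates_of_arc (Or.inr h₁) harc h, hb⟩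
        · by_cases hwa : w = a
          · exact Or.inr ⟨hwa ▸ hK.discriminates_self, hb⟩
          · refine Or.inl (Or.inl ((hb.canGo ?_).head ?_))
            · exact (replaceArc_arrowhead_of_ne fun h => hwb_ne h.1).2 (Or.inr h₁)
            · exact (replaceArc_arrowhead_of_ne fun h => hwa h.2).2 (Or.inr (K.arc_symm h₁))
    · have hyb_ne := hK.ne_of_discriminates hah hw e₁
      have hyb := hK.arrowhead_of_discriminates y w hyb_ne hah hw
      have hyb' : (K.replaceArc a b).Arrowhead y b :=
        (replaceArc_arrowhead_of_ne fun h => hyb_ne h.1).2 hyb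
      cases m with
      | false => exact Or.inl (((hP.1 rfl).canGo ho.of_false b).head hyb')
      | true =>
        by_cases hy : K.Discriminates a b y
        · exact (hP.2 rfl).2 hy
        have hya : y ≠ a := fun e => hy (e ▸ hK.discriminates_self)
        have hby' : (K.replaceArc a b).Arrowhead b y ↔ K.Arrowhead b y :=
          replaceArc_arrowhead_of_ne fun h => hya h.2
        have h₁ := ((hP.2 rfl).1).resolve_right fun h => hy h.1
        refine Or.inl ((h₁.canGo ?_ ?_).head hyb')
        · intro h₂
          refine hK.anteSet_replaceArc (ho.anteSet ?_)
          rcases hah with h₃ | h₃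
          · exact absurd (hK.arrow_of_discriminates hyb_ne h₃ hw)
              (hK.ancestral.not_arrow_of_arrowhead (hby'.1 h₂))
          · exact Or.inr (K.arc_symm h₃)
        · intro h₂
          have h₃ : K.arrow y b := by
            rcases hyb with h₃ | h₃
            · exact h₃
            · exact absurd (hby'.2 (Or.inr (K.arc_symm h₃))) h₂
          refine ho.notMem fun h₄ => hy ?_
          exact hK.discriminates_of_arc (Or.inr h₃) (hK.ancestral.arc_of_arrowhead hah h₄) hw
  · intro hn
    refine ⟨fun _ => ?_, by simp⟩
    rcases hcase with h | ⟨h, hb, hwy⟩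
    · exact h.tail (replaceArc_adj.2 hyw) fun h' => hn (hyw'.1 h')
    · have hwb_ne := hK.ne_of_discriminates hwy h fun h' => e₂ ⟨h'.2, h'.1⟩
      have h₁ := hK.arrow_of_discriminates hwb_ne ((hK.arrowhead_or_arrow hyw).resolve_left hn) h
      have hwa : w ≠ a := by
        rintro rfl
        exact hK.ancestral.not_arrow_of_arrowhead (Or.inr (K.arc_symm hK.arc)) h₁
      refine (hb.canGo ?_).tail (Or.inr (Or.inr (Or.inl (Or.inl h₁)))) ?_
      · exact Or.inl (Or.inl h₁)
      · rw [replaceArc_arrowhead_of_ne fun h => hwa h.2]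
        exact fun h₂ => hK.ancestral.not_arrow_of_arrowhead h₂ h₁

/-- The state of the old graph that corresponds to a state of the new one, with the same shortcuts
as before. -/
def OldState (K : MixedGraph V) (a b : V) (C : Set V) (i : V) (m : Bool) (y : V) : Prop :=
  (m = false → K.Reach C i false y ∨ (y = a ∧ K.Reach C i true a ∧ K.Passes C i b)) ∧
    (m = true → (K.ReachHead C i y ∨
      (K.arrow y b ∧ K.Discriminates a b y ∧ K.Passes C i b)) ∧
      (K.Discriminates a b y → K.ReachHead C i b))

lemma oldState_step (hK : K.ReplaceableArc a b) {m : Bool} {y w : V}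
    (hP : OldState K a b C i m y) (hyw : K.Adj y w) (ho : (K.replaceArc a b).Open C m y w) :
    ((K.replaceArc a b).Arrowhead y w → OldState K a b C i true w) ∧
      (¬ (K.replaceArc a b).Arrowhead y w → OldState K a b C i false w) := by
  have hab' : (K.replaceArc a b).Arrowhead a b :=
    (replaceArc_arrowhead_of_ne fun h => hK.ne h.1).2 (Or.inr hK.arc)
  by_cases e₁ : y = b ∧ w = a
  · obtain ⟨rfl, rfl⟩ := e₁
    have hb : K.Passes C i y := by
      cases m with
      | false =>
        exact Or.inr ⟨(hP.1 rfl).resolve_right fun h => hK.ne h.1.symm, ho.of_false⟩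
      | true =>
        have h₁ := (hK.anteSet_of_replaceArc (ho.anteSet hab')).resolve_right
          fun h => hK.ne h.1.symm
        rcases (hP.2 rfl).1 with h | ⟨h, -⟩
        · exact h.passes h₁
        · exact absurd h (K.arrow_irrefl y)
    refine ⟨fun h => absurd h hK.not_arrowhead, fun _ => ⟨fun _ => Or.inr ⟨rfl, ?_, hb⟩, by simp⟩⟩
    exact (hb.canGo (Or.inr hK.arc)).head (Or.inr (K.arc_symm hK.arc))
  by_cases e₂ : y = a ∧ w = b
  · obtain ⟨rfl, rfl⟩ := e₂
    refine ⟨fun _ => ⟨by simp, fun _ => ⟨Or.inl ?_, fun h => absurd h hK.not_discriminates⟩⟩,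
      fun hn => absurd hab' hn⟩
    cases m with
    | false =>
      rcases hP.1 rfl with h | ⟨-, -, h⟩
      · exact Or.inl ((h.canGo ho.of_false w).head (Or.inr hK.arc))
      · exact h.reachHead
    | true => exact (hP.2 rfl).2 hK.discriminates_self
  have hyw' : (K.replaceArc a b).Arrowhead y w ↔ K.Arrowhead y w := replaceArc_arrowhead_of_ne e₁
  have hwy' : (K.replaceArc a b).Arrowhead w y ↔ K.Arrowhead w y :=
    replaceArc_arrowhead_of_ne fun h => e₂ ⟨h.2, h.1⟩
  have hcase : K.CanGo C i y w ∨ (K.Discriminates a b y ∧ K.Passes C i b ∧ K.Arrowhead w y) := by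
    cases m with
    | false =>
      rcases hP.1 rfl with h | ⟨rfl, h, hb⟩
      · exact Or.inl (h.canGo ho.of_false w)
      · by_cases h₁ : K.Arrowhead w y
        · exact Or.inr ⟨hK.discriminates_self, hb, h₁⟩
        · exact Or.inl ⟨true, h, open_of_not_arrowhead h₁ ho.of_false⟩
    | true =>
      by_cases h₁ : K.Arrowhead w y
      · rcases (hP.2 rfl).1 with h | ⟨-, h, hb⟩
        · rcases hK.anteSet_of_replaceArc (ho.anteSet (hwy'.2 h₁)) with h₂ | ⟨rfl, h₂⟩
          · exact Or.inl (h.canGo (fun _ => h₂) fun h₃ => absurd h₁ h₃)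
          -- In the old graph, only `b` is known to be an ancestor of `C`, so the collider `a` is
          -- replaced by the collider `b`.
          · exact Or.inr ⟨hK.discriminates_self,
              ((hP.2 rfl).2 hK.discriminates_self).passes h₂, h₁⟩
        · exact Or.inr ⟨h, hb, h₁⟩
      · have hyC := ho.notMem fun h => h₁ (hwy'.1 h)
        rcases (hP.2 rfl).1 with h | ⟨h, -, hb⟩
        · exact Or.inl (h.canGo (fun h₂ => absurd h₂ h₁) fun _ => hyC)
        · have := (hb.canGo (Or.inl h)).tail (Or.inr (Or.inr (Or.inl h)))
            fun h₂ => hK.ancestral.not_arrow_of_arrowhead h₂ h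
          exact Or.inl (this.canGo hyC w)
  constructor
  · intro hah'
    have hah := hyw'.1 hah'
    refine ⟨by simp, fun _ => ⟨?_, fun hw => ?_⟩⟩
    · rcases hcase with h | ⟨h, hb, hwy⟩
      · exact Or.inl (Or.inl (h.head hah))
      · have hwb_ne := hK.ne_of_discriminates hwy h fun h' => e₂ ⟨h'.2, h'.1⟩
        have harc := K.arc_symm (hK.ancestral.arc_of_arrowhead hah hwy)
        rcases hK.arrowhead_of_discriminates w y hwb_ne hwy h with h₁ | h₁
        · exact Or.inr ⟨h₁, hK.discriminates_of_arc (Or.inr h₁) harc h, hb⟩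
        · exact Or.inl (Or.inl ((hb.canGo (Or.inr h₁)).head (Or.inr (K.arc_symm h₁))))
    · have hyb_ne := hK.ne_of_discriminates hah hw e₁
      have hyb := hK.arrowhead_of_discriminates y w hyb_ne hah hw
      cases m with
      | false =>
        rcases hP.1 rfl with h | ⟨-, -, h⟩
        · exact Or.inl ((h.canGo ho.of_false b).head hyb)
        · exact h.reachHead
      | true =>
        by_cases hy : K.Discriminates a b y
        · exact (hP.2 rfl).2 hy
        have hya : y ≠ a := fun e => hy (e ▸ hK.discriminates_self)
        have h₁ := ((hP.2 rfl).1).resolve_right fun h => hy h.2.1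
        refine Or.inl ((h₁.canGo ?_ ?_).head hyb)
        · intro h₂
          refine (hK.anteSet_of_replaceArc (ho.anteSet (hwy'.2 ?_))).resolve_right
            fun h => hya h.1
          rcases hah with h₃ | h₃
          · exact absurd (hK.arrow_of_discriminates hyb_ne h₃ hw)
              (hK.ancestral.not_arrow_of_arrowhead h₂)
          · exact Or.inr (K.arc_symm h₃)
        · intro h₂
          have h₃ : K.arrow y b := by
            rcases hyb with h₃ | h₃
            · exact h₃
            · exact absurd (Or.inr (K.arc_symm h₃)) h₂
          refine ho.notMem fun h₄ => hy ?_
          exact hK.discriminates_of_arc (Or.inr h₃)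
            (hK.ancestral.arc_of_arrowhead hah (hwy'.1 h₄)) hw
  · intro hn'
    have hn : ¬ K.Arrowhead y w := fun h => hn' (hyw'.2 h)
    refine ⟨fun _ => Or.inl ?_, by simp⟩
    rcases hcase with h | ⟨h, hb, hwy⟩
    · exact h.tail hyw hn
    · have hwb_ne := hK.ne_of_discriminates hwy h fun h' => e₂ ⟨h'.2, h'.1⟩
      have h₁ := hK.arrow_of_discriminates hwb_ne ((hK.arrowhead_or_arrow hyw).resolve_left hn) h
      exact (hb.canGo (Or.inl h₁)).tail (Or.inr (Or.inr (Or.inl h₁)))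
        fun h₂ => hK.ancestral.not_arrow_of_arrowhead h₂ h₁

/-- Connecting walks join the same nodes before and after the replacement. -/
theorem reach_iff (hK : K.ReplaceableArc a b) {j : V} :
    (∃ m, K.Reach C i m j) ↔ ∃ m, (K.replaceArc a b).Reach C i m j := by
  constructor
  · rintro ⟨m, h⟩
    have hP : NewState K a b C i m j := by
      induction h with
      | start => exact ⟨fun _ => Reach.start, by simp⟩
      | head _ h ho ih => exact (hK.newState_step ih h.adj ho).1 h
      | tail _ h hn ho ih => exact (hK.newState_step ih h ho).2 hn
    cases m with
    | false => exact ⟨_, hP.1 rfl⟩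
    | true =>
      rcases (hP.2 rfl).1 with (h | h) | ⟨h, hb⟩
      · exact ⟨_, h⟩
      · exact ⟨_, h.1⟩
      · have hjb : (K.replaceArc a b).arrow j b := by
          rcases h.1 with rfl | h₂
          exacts [Or.inr ⟨hK.arc, rfl, rfl⟩, Or.inl h₂]
        obtain ⟨m, hm, ho⟩ := hb.canGo (Or.inl hjb)
        exact hm.step (Or.inr (Or.inr (Or.inl hjb))) ho
  · rintro ⟨m, h⟩
    have hP : OldState K a b C i m j := by
      induction h with
      | start => exact ⟨fun _ => Or.inl Reach.start, by simp⟩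
      | head _ h ho ih => exact (hK.oldState_step ih (replaceArc_adj.1 h.adj) ho).1 h
      | tail _ h hn ho ih => exact (hK.oldState_step ih (replaceArc_adj.1 h) ho).2 hn
    cases m with
    | false =>
      rcases hP.1 rfl with h | ⟨rfl, h, -⟩
      exacts [⟨_, h⟩, ⟨_, h⟩]
    | true =>
      rcases (hP.2 rfl).1 with (h | h) | ⟨h, -, hb⟩
      · exact ⟨_, h⟩
      · exact ⟨_, h.1⟩
      · obtain ⟨m, hm, ho⟩ := hb.canGo (Or.inl h)
        exact hm.step (Or.inr (Or.inr (Or.inl h))) ho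

end ReplaceableArc

end Replace

end MixedGraph

namespace MixedGraph

variable {V : Type*}

/-! ### Replacing all arcs -/

/-- `G` arises from `K` by orienting arcs, such that all unshielded colliders of `K` are kept. -/
structure ResolvedBy (K G : MixedGraph V) : Prop where
  ancestral : K.IsAncestral
  line_free : ∀ x y, ¬ K.line x y
  reduce : K.CollidersReduce
  adj_iff : ∀ x y, K.Adj x y ↔ G.Adj x y
  arrowhead : ∀ x y, G.arrow x y → K.Arrowhead x y
  unshielded : ∀ x y z, x ≠ z → ¬ K.Adj x z → K.Arrowhead x y → K.Arrowhead z y → G.arrow x y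

namespace ResolvedBy

variable {K G : MixedGraph V}

lemma arrow (h : K.ResolvedBy G) (hG : G.IsDAG) {x y : V} (hxy : K.arrow x y) : G.arrow x y := by
  rcases hG.adj_iff.1 ((h.adj_iff x y).1 (Or.inr (Or.inl hxy))) with h' | h'
  · exact h'
  · exact absurd hxy (h.ancestral.not_arrow_of_arrowhead (h.arrowhead y x h'))

/-- The arc between the highest endpoint `a` of arcs and its lowest neighbour `b` along an arc can
be replaced. -/
lemma replaceableArc (h : K.ResolvedBy G) (hG : G.IsDAG) {g : V → ℕ}
    (hg : ∀ x y, G.arrow x y → g y < g x) {a b : V} (hab : K.arc a b)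
    (ha : ∀ x y, K.arc x y → g x ≤ g a) (hb : ∀ y, K.arc a y → g b ≤ g y) :
    K.ReplaceableArc a b ∧ G.arrow a b := by
  have hK := h.ancestral
  have habG : G.arrow a b := by
    rcases hG.adj_iff.1 ((h.adj_iff a b).1 (Or.inr (Or.inr (Or.inr hab)))) with h' | h'
    · exact h'
    · exact absurd (hg _ _ h') (not_lt.2 (ha b a (K.arc_symm hab)))
  -- Otherwise `G` would keep the unshielded collider `a` between `b` and `c`.
  have hadj : ∀ c, c ≠ b → K.Arrowhead c a → G.Adj c b := by
    intro c hcb hca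
    rw [← h.adj_iff]
    by_contra hn
    exact hG.isAncestral.not_arrow_of_arrowhead (Or.inl habG) (h.unshielded b a c hcb.symm
      (fun h' => hn h'.symm) (Or.inr (K.arc_symm hab)) hca)
  -- `c` is higher than `a`, so that it has no arcs.
  have harr : ∀ c, K.arrow c a → K.arrow c b := by
    intro c hca
    have h₁ := hg _ _ (h.arrow hG hca)
    have h₂ := hg _ _ habG
    have hcb : c ≠ b := by
      rintro rfl
      exact hK.not_arrow_of_arrowhead (Or.inr hab) hca
    rcases hG.adj_iff.1 (hadj c hcb (Or.inl hca)) with h₃ | h₃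
    · rcases h.arrowhead _ _ h₃ with h₄ | h₄
      · exact h₄
      · exact absurd (ha c b h₄) (not_le.2 h₁)
    · exact absurd (hg _ _ h₃) (by omega)
  have hhead : ∀ c, c ≠ b → K.Arrowhead c a → K.Arrowhead c b := by
    rintro c hcb (hca | hca)
    · exact Or.inl (harr c hca)
    · rcases hG.adj_iff.1 (hadj c hcb (Or.inr hca)) with h₃ | h₃
      · exact h.arrowhead _ _ h₃
      · exact absurd (hg _ _ h₃) (not_lt.2 (hb c (K.arc_symm hca)))
  refine ⟨⟨hK, h.line_free, hab, harr, ?_⟩, habG⟩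
  intro d y hdb hdy hy
  by_cases hadj : K.Adj d b
  · rcases hadj with h₁ | h₁ | h₁ | h₁
    · exact absurd h₁ (h.line_free _ _)
    · exact Or.inl h₁
    · rcases hy.1 with rfl | h₂
      · exact hhead d hdb hdy
      · exact absurd ((Relation.TransGen.single h₂).tail h₁) (hK.1 y d hdy)
    · exact Or.inr h₁
  · obtain ⟨z, hz, hdz, hbz⟩ := h.reduce {v | v = a ∨ K.arrow v b} d b y a hdb hadj hdy hy.1 hy.2
      (Or.inr (K.arc_symm hab))
    rcases hz with rfl | hz
    · exact hhead d hdb hdz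
    · exact absurd hz (hK.not_arrow_of_arrowhead hbz)

/-- The choice of the arc also makes sure that the new graph is ancestral. -/
lemma replaceArc (h : K.ResolvedBy G) (hG : G.IsDAG) {g : V → ℕ}
    (hg : ∀ x y, G.arrow x y → g y < g x) {a b : V} (hab : K.arc a b)
    (ha : ∀ x y, K.arc x y → g x ≤ g a) (hb : ∀ y, K.arc a y → g b ≤ g y) :
    (K.replaceArc a b).ResolvedBy G := by
  obtain ⟨hr, habG⟩ := h.replaceableArc hG hg hab ha hb
  have hah : ∀ {x y}, (K.replaceArc a b).Arrowhead x y → K.Arrowhead x y := by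
    intro x y hxy
    refine (replaceArc_arrowhead_of_ne ?_).1 hxy
    rintro ⟨rfl, rfl⟩
    exact hr.not_arrowhead hxy
  have hah' : ∀ x y, G.arrow x y → (K.replaceArc a b).Arrowhead x y := by
    intro x y hxy
    refine (replaceArc_arrowhead_of_ne ?_).2 (h.arrowhead x y hxy)
    rintro ⟨rfl, rfl⟩
    exact hG.isAncestral.not_arrow_of_arrowhead (Or.inl hxy) habG
  have hanc : ∀ {x y}, K.Ancestor x y → g y < g x := by
    intro x y hxy
    induction hxy with
    | single h' => exact hg _ _ (h.arrow hG h')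
    | tail _ h' ih => exact (hg _ _ (h.arrow hG h')).trans ih
  have hlt := hg _ _ habG
  refine ⟨⟨?_, fun x hx => absurd hx.choose_spec (h.line_free _ _)⟩, h.line_free, ?_, ?_, hah', ?_⟩
  · intro i j hji hij
    rcases hr.ancestor_of_replaceArc hij with h' | ⟨h₁, h₂⟩
    · exact h.ancestral.1 i j (hah hji) h'
    · rcases h₁ with rfl | h₁
      · rcases h₂ with rfl | h₂
        · exact hr.not_arrowhead hji
        · have h₃ := hanc h₂
          rcases hah hji with h₄ | h₄
          · exact absurd (hg _ _ (h.arrow hG h₄)) (by omega)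
          · exact absurd (hb j (K.arc_symm h₄)) (by omega)
      · refine h.ancestral.1 i j (hah hji) ?_
        rcases h₂ with rfl | h₂
        exacts [h₁, h₁.trans h₂]
  · intro S i j x y hij hn hix hx hxy hjy
    rw [replaceArc_adj] at hn
    obtain ⟨z, hz, hiz, hjz⟩ := h.reduce S i j x y hij hn (hah hix) hx
      (Relation.ReflTransGen.mono (fun _ _ h' => ⟨h'.1.1, h'.2⟩) _ _ hxy) (hah hjy)
    exact ⟨z, hz, hah' _ _ (h.unshielded i z j hij hn hiz hjz),
      hah' _ _ (h.unshielded j z i hij.symm (fun h' => hn h'.symm) hjz hiz)⟩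
  · intro x y
    rw [replaceArc_adj, h.adj_iff]
  · intro x y z hxz hn hxy hzy
    rw [replaceArc_adj] at hn
    exact h.unshielded x y z hxz hn (hah hxy) (hah hzy)

lemma eq_of_arc_free (h : K.ResolvedBy G) (hG : G.IsDAG) (ha : ∀ x y, ¬ K.arc x y) : K = G := by
  have h₁ : K.line = G.line := by
    ext x y
    exact ⟨fun h' => absurd h' (h.line_free x y), fun h' => absurd h' (hG.1 x y)⟩
  have h₂ : K.arc = G.arc := by
    ext x y
    exact ⟨fun h' => absurd h' (ha x y), fun h' => absurd h' (hG.2.1 x y)⟩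
  have h₃ : K.arrow = G.arrow := by
    ext x y
    exact ⟨h.arrow hG, fun h' => (h.arrowhead x y h').resolve_right (ha x y)⟩
  cases K
  cases G
  simp only at h₁ h₂ h₃
  subst h₁ h₂ h₃
  rfl

/-- Orienting all arcs by an order, without destroying unshielded colliders, does not change which
nodes are joined by connecting walks. -/
theorem reach_iff [Finite V] (hG : G.IsDAG) {g : V → ℕ} (hg : ∀ x y, G.arrow x y → g y < g x)
    {C : Set V} {i j : V} (n : ℕ) : ∀ {K : MixedGraph V}, {p : V × V | K.arc p.1 p.2}.ncard = n →
      K.ResolvedBy G → ((∃ m, K.Reach C i m j) ↔ ∃ m, G.Reach C i m j) := by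
  induction n using Nat.strong_induction_on with
  | _ n ih =>
    intro K hn h
    by_cases hne : ∃ x y, K.arc x y
    · obtain ⟨a, ⟨b₀, hab₀⟩, ha⟩ := Set.exists_max_image {x | ∃ y, K.arc x y} g
        (Set.toFinite _) hne
      obtain ⟨b, hab, hb⟩ := Set.exists_min_image {y | K.arc a y} g (Set.toFinite _) ⟨b₀, hab₀⟩
      have ha' : ∀ x y, K.arc x y → g x ≤ g a := fun x y hxy => ha x ⟨y, hxy⟩
      have hb' : ∀ y, K.arc a y → g b ≤ g y := hb
      rw [(h.replaceableArc hG hg hab ha' hb').1.reach_iff]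
      refine ih _ ?_ rfl (h.replaceArc hG hg hab ha' hb')
      rw [← hn]
      refine Set.ncard_lt_ncard ⟨fun p hp => hp.1, fun hs => ?_⟩ (Set.toFinite _)
      have := hs (show (a, b) ∈ {p : V × V | K.arc p.1 p.2} from hab)
      exact this.2.1 ⟨rfl, rfl⟩
    · rw [h.eq_of_arc_free hG fun x y hxy => hne ⟨x, y, hxy⟩]

end ResolvedBy

end MixedGraph

/-! ### Maximum cardinality search -/

section MaximumCardinalitySearch

variable {W : Type*} {G : SimpleGraph W}

/-- A node `c` that has an earlier neighbour `a` which `b` has not is not visited before `b` unless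
`b` has an earlier neighbour which `c` has not. -/
lemma IsMCSOrder.exists_adj_not_adj [Finite W] {σ : W ≃ Fin (Nat.card W)} (hσ : IsMCSOrder G σ)
    {a b c : W} (hab : σ a < σ b) (hbc : σ b < σ c) (hca : G.Adj c a) (hba : ¬ G.Adj b a) :
    ∃ d, σ d < σ b ∧ G.Adj b d ∧ ¬ G.Adj c d := by
  by_contra! hcon
  refine absurd (hσ b c hbc.le) (not_le.2 (Set.ncard_lt_ncard ⟨?_, fun hs => ?_⟩ (Set.toFinite _)))
  · exact fun w hw => ⟨hw.1, hcon w hw.1 hw.2⟩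
  · exact hba (hs (show a ∈ {w | σ w < σ b ∧ G.Adj c w} from ⟨hab, hca⟩)).2

/-- `f 0, …, f k` is an induced path. -/
structure IsInducedPath (G : SimpleGraph W) (k : ℕ) (f : ℕ → W) : Prop where
  inj : ∀ i ≤ k, ∀ j ≤ k, f i = f j → i = j
  adj_iff : ∀ i ≤ k, ∀ j ≤ k, G.Adj (f i) (f j) ↔ i + 1 = j ∨ j + 1 = i

lemma IsInducedPath.reverse {k : ℕ} {f : ℕ → W} (h : IsInducedPath G k f) :
    IsInducedPath G k fun i => f (k - i) where
  inj i hi j hj e := by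
    have := h.inj (k - i) (by omega) (k - j) (by omega) e
    omega
  adj_iff i hi j hj := by
    rw [h.adj_iff _ (by omega) _ (by omega)]
    omega

/-- The first `j + 1` nodes of `f`, followed by `d`. -/
def extendPath (f : ℕ → W) (j : ℕ) (d : W) (i : ℕ) : W := if i ≤ j then f i else d

lemma extendPath_of_le {f : ℕ → W} {j : ℕ} {d : W} {i : ℕ} (h : i ≤ j) :
    extendPath f j d i = f i := if_pos h

lemma extendPath_last {f : ℕ → W} {j : ℕ} {d : W} : extendPath f j d (j + 1) = d :=
  if_neg (by omega)

lemma IsInducedPath.extend_inj {k j : ℕ} {f : ℕ → W} {d : W} (h : IsInducedPath G k f)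
    (hj : j ≤ k) (hd : ∀ i ≤ j, f i ≠ d) :
    ∀ i ≤ j + 1, ∀ i' ≤ j + 1, extendPath f j d i = extendPath f j d i' → i = i' := by
  intro i hi i' hi' e
  rcases hi.lt_or_eq with hi | rfl <;> rcases hi'.lt_or_eq with hi' | rfl
  · rw [extendPath_of_le (by omega), extendPath_of_le (by omega)] at e
    exact h.inj _ (by omega) _ (by omega) e
  · rw [extendPath_of_le (by omega), extendPath_last] at e
    exact absurd e (hd _ (by omega))
  · rw [extendPath_last, extendPath_of_le (by omega)] at e
    exact absurd e.symm (hd _ (by omega))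
  · rfl

lemma IsInducedPath.extend_adj {k j : ℕ} {f : ℕ → W} {d : W} (h : IsInducedPath G k f)
    (hj : j ≤ k) (hj2 : 1 ≤ j) (hjd : G.Adj (f j) d)
    (hd : ∀ i, 1 ≤ i → i < j → ¬ G.Adj (f i) d) :
    ∀ i ≤ j + 1, ∀ i' ≤ j + 1, G.Adj (extendPath f j d i) (extendPath f j d i') ↔
      (i + 1 = i' ∨ i' + 1 = i) ∨
        (G.Adj (f 0) d ∧ ((i = 0 ∧ i' = j + 1) ∨ (i = j + 1 ∧ i' = 0))) := by
  have key : ∀ i ≤ j, G.Adj (f i) d ↔ i = j ∨ (G.Adj (f 0) d ∧ i = 0) := by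
    intro i hi
    constructor
    · intro ha
      rcases Nat.eq_zero_or_pos i with rfl | hi0
      · exact Or.inr ⟨ha, rfl⟩
      · rcases hi.lt_or_eq with hi | rfl
        exacts [absurd ha (hd i hi0 hi), Or.inl rfl]
    · rintro (rfl | ⟨ha, rfl⟩)
      exacts [hjd, ha]
  intro i hi i' hi'
  rcases hi.lt_or_eq with hi | rfl <;> rcases hi'.lt_or_eq with hi' | rfl
  · rw [extendPath_of_le (by omega), extendPath_of_le (by omega), h.adj_iff _ (by omega) _
      (by omega)]
    have h₁ : ¬ i' = j + 1 := by omega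
    have h₂ : ¬ i = j + 1 := by omega
    tauto
  · rw [extendPath_of_le (by omega), extendPath_last, key i (by omega)]
    have h₁ : ¬ (j + 1 + 1 = i) := by omega
    have h₂ : ¬ (i = j + 1) := by omega
    have h₃ : i + 1 = j + 1 ↔ i = j := by omega
    tauto
  · rw [extendPath_of_le (i := i') (by omega), extendPath_last, G.adj_comm, key i' (by omega)]
    have h₁ : ¬ (j + 1 + 1 = i') := by omega
    have h₂ : ¬ (i' = j + 1) := by omega
    have h₃ : i' + 1 = j + 1 ↔ i' = j := by omega
    tauto
  · rw [extendPath_last]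
    have h₁ : ¬ (j + 1 + 1 = j + 1) := by omega
    have h₂ : ¬ (j + 1 = 0) := by omega
    simp

lemma cycleGraph_adj_iff_val {n : ℕ} (u v : Fin (n + 2)) :
    (SimpleGraph.cycleGraph (n + 2)).Adj u v ↔
      ((u : ℕ) + 1 = v ∨ (v : ℕ) + 1 = u) ∨
        (((u : ℕ) = 0 ∧ (v : ℕ) = n + 1) ∨ ((u : ℕ) = n + 1 ∧ (v : ℕ) = 0)) := by
  rw [SimpleGraph.cycleGraph_adj', Fin.sub_def, Fin.sub_def]
  have hu := u.2
  have hv := v.2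
  simp only
  rcases Nat.lt_or_ge (u : ℕ) v with h | h
  · rw [Nat.mod_eq_of_lt (show n + 2 - v + u < n + 2 by omega),
      show n + 2 - (u : ℕ) + v = (v - u) + (n + 2) by omega, Nat.add_mod_right,
      Nat.mod_eq_of_lt (show (v : ℕ) - u < n + 2 by omega)]
    omega
  · rcases h.eq_or_lt with h | h
    · rw [h, show n + 2 - (u : ℕ) + u = n + 2 by omega, Nat.mod_self]
      omega
    · rw [Nat.mod_eq_of_lt (show n + 2 - u + v < n + 2 by omega),
        show n + 2 - (v : ℕ) + u = (u - v) + (n + 2) by omega, Nat.add_mod_right,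
        Nat.mod_eq_of_lt (show (u : ℕ) - v < n + 2 by omega)]
      omega

/-- In a chordal graph, the inner nodes of an induced path cannot all be visited after both of its
end nodes: otherwise a neighbour `d` of the later end node closes a chordless cycle or yields such a
path with earlier end nodes. -/
lemma IsMCSOrder.false_of_isInducedPath [Finite W] (hG : IsChordalGraph G)
    {σ : W ≃ Fin (Nat.card W)} (hσ : IsMCSOrder G σ) (N : ℕ) :
    ∀ (k : ℕ) (f : ℕ → W), 2 ≤ k → IsInducedPath G k f → σ (f 0) < σ (f k) → (σ (f k) : ℕ) = N →
      (∀ i, 1 ≤ i → i < k → σ (f k) < σ (f i)) → False := by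
  induction N using Nat.strong_induction_on with
  | _ N ih =>
    intro k f hk hf h0k hN hin
    have hk0 : ¬ G.Adj (f k) (f 0) := by
      rw [hf.adj_iff _ le_rfl _ (Nat.zero_le k)]
      omega
    obtain ⟨d, hdk, hkd, h1d⟩ := hσ.exists_adj_not_adj h0k (hin 1 le_rfl (by omega))
      ((hf.adj_iff 1 (by omega) 0 (by omega)).2 (by omega)) hk0
    classical
    have hex : ∃ j, 1 ≤ j ∧ G.Adj (f j) d := ⟨k, by omega, hkd⟩
    obtain ⟨hj1, hjd⟩ := Nat.find_spec hex
    have hjk : Nat.find hex ≤ k := Nat.find_min' hex ⟨by omega, hkd⟩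
    have hjmin : ∀ i, 1 ≤ i → i < Nat.find hex → ¬ G.Adj (f i) d :=
      fun i hi hi' ha => Nat.find_min hex hi' ⟨hi, ha⟩
    generalize Nat.find hex = j at hj1 hjd hjk hjmin
    have hj2 : 2 ≤ j := by
      rcases hj1.eq_or_lt with rfl | h
      exacts [absurd hjd h1d, h]
    have hlt : ∀ i, 1 ≤ i → i ≤ j → σ d < σ (f i) := by
      intro i hi hi'
      rcases (hi'.trans hjk).lt_or_eq with h | rfl
      exacts [hdk.trans (hin i hi h), hdk]
    have hd0 : f 0 ≠ d := by
      rintro rfl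
      exact hk0 hkd
    have hd : ∀ i ≤ j, f i ≠ d := by
      rintro i hi rfl
      rcases Nat.eq_zero_or_pos i with rfl | h
      exacts [hd0 rfl, lt_irrefl _ (hlt i h hi)]
    have hinj := hf.extend_inj hjk hd
    have hadj := hf.extend_adj hjk hj1 hjd hjmin
    by_cases h0 : G.Adj (f 0) d
    · refine (hG (j + 2) (by omega)).false ⟨⟨fun i => extendPath f j d i, fun i i' e => ?_⟩, ?_⟩
      · exact Fin.ext (hinj i (by omega) i' (by omega) e)
      · intro i i'
        rw [cycleGraph_adj_iff_val]
        refine (hadj i (by omega) i' (by omega)).trans ?_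
        simp [h0]
    · have hpath : IsInducedPath G (j + 1) (extendPath f j d) :=
        ⟨hinj, fun i hi i' hi' => by rw [hadj i hi i' hi']; simp [h0]⟩
      have e0 : extendPath f j d 0 = f 0 := extendPath_of_le (Nat.zero_le j)
      have hin' : ∀ i, 1 ≤ i → i < j + 1 →
          σ d < σ (extendPath f j d i) ∧ σ (f 0) < σ (extendPath f j d i) := by
        intro i hi hi'
        rw [extendPath_of_le (by omega)]
        refine ⟨hlt i hi (by omega), ?_⟩
        rcases (show i ≤ k by omega).lt_or_eq with h | rfl
        exacts [h0k.trans (hin i hi h), h0k]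
      have hne : σ (f 0) ≠ σ d := fun e => hd0 (σ.injective e)
      rcases lt_or_gt_of_ne hne with h | h
      · refine ih _ ?_ (j + 1) _ (by omega) hpath ?_ rfl ?_
        · rw [extendPath_last, ← hN]
          exact hdk
        · rwa [extendPath_last, e0]
        · rw [extendPath_last]
          exact fun i hi hi' => (hin' i hi hi').1
      · refine ih _ ?_ (j + 1) _ (by omega) hpath.reverse ?_ rfl ?_
        · rw [Nat.sub_self, e0, ← hN]
          exact h0k
        · rwa [Nat.sub_self, Nat.sub_zero, extendPath_last, e0]
        · rw [Nat.sub_self, e0]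
          exact fun i hi hi' => (hin' (j + 1 - i) (by omega) (by omega)).2

/-- A maximum cardinality search order of a chordal graph is a perfect elimination order. -/
theorem IsMCSOrder.adj_of_adj_of_lt [Finite W] (hG : IsChordalGraph G)
    {σ : W ≃ Fin (Nat.card W)} (hσ : IsMCSOrder G σ) {x y z : W} (hxy : G.Adj x y)
    (hzy : G.Adj z y) (hx : σ x < σ y) (hz : σ z < σ y) (hxz : x ≠ z) : G.Adj x z := by
  have key : ∀ {x z : W}, G.Adj x y → G.Adj z y → σ x < σ y → σ z < σ y → σ x < σ z →
      G.Adj x z := by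
    intro x z hxy hzy hx hz hlt
    by_contra hn
    have hxz : x ≠ z := by
      rintro rfl
      exact lt_irrefl _ hlt
    have hn' : ¬ G.Adj z x := fun h => hn h.symm
    refine hσ.false_of_isInducedPath hG (σ z) 2
      (fun i => if i = 0 then x else if i = 1 then y else z) le_rfl ⟨?_, ?_⟩ (by simpa) (by simp) ?_
    · have h₁ := hxy.ne
      have h₂ := hzy.ne
      intro i hi j hj
      interval_cases i <;> interval_cases j <;> simp [h₁, h₂, hxz, h₁.symm, h₂.symm, hxz.symm]
    · intro i hi j hj
      interval_cases i <;> interval_cases j <;>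
        simp [hxy, hzy, hxy.symm, hzy.symm, hn, hn']
    · intro i hi hi'
      obtain rfl : i = 1 := by omega
      simpa
  rcases lt_or_gt_of_ne fun e => hxz (σ.injective e) with h | h
  · exact key hxy hzy hx hz h
  · exact (key hzy hxy hz hx h).symm

/-- The first `k` steps of a maximum cardinality search: the visited nodes are numbered `0, …,
k - 1`, all others have the number `k`. -/
structure IsPartialMCS (G : SimpleGraph W) (k : ℕ) (ν : W → ℕ) : Prop where
  le : ∀ w, ν w ≤ k
  card : {w | ν w < k}.ncard = k
  inj : ∀ v w, ν v < k → ν v = ν w → v = w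
  max : ∀ v u, ν v < k → ν v ≤ ν u →
    {w | ν w < ν v ∧ G.Adj u w}.ncard ≤ {w | ν w < ν v ∧ G.Adj v w}.ncard

lemma IsPartialMCS.exists_succ [Finite W] {k : ℕ} {ν : W → ℕ} (h : IsPartialMCS G k ν)
    (hk : k < Nat.card W) : ∃ ν', IsPartialMCS G (k + 1) ν' := by
  have hne : {w | ν w = k}.Nonempty := by
    by_contra hcon
    have : {w | ν w < k} = Set.univ := Set.eq_univ_of_forall fun w =>
      lt_of_le_of_ne (h.le w) fun e => hcon ⟨w, e⟩
    have hc := h.card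
    rw [this, Set.ncard_univ] at hc
    omega
  obtain ⟨u, hu, hmax⟩ := Set.exists_max_image {w | ν w = k}
    (fun x => {w | ν w < k ∧ G.Adj x w}.ncard) (Set.toFinite _) hne
  replace hu : ν u = k := hu
  classical
  let ν' : W → ℕ := fun w => if w = u then k else if ν w = k then k + 1 else ν w
  have h1 : ∀ w, ν' w < k ↔ ν w < k := by
    intro w
    simp only [ν']
    split_ifs with h₁ h₂
    · rw [h₁]; omega
    · omega
    · rfl
  have h2 : ∀ w, ν w < k → ν' w = ν w := by
    intro w hw
    simp only [ν']
    rw [if_neg (by rintro rfl; omega), if_neg (by omega)]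
  have h3 : ν' u = k := if_pos rfl
  have h4 : ∀ w, w ≠ u → ν w = k → ν' w = k + 1 := by
    intro w hw hw'
    simp only [ν']
    rw [if_neg hw, if_pos hw']
  have h5 : ∀ w, ν' w < k + 1 ↔ ν w < k ∨ w = u := by
    intro w
    by_cases hw : w = u
    · simp [hw, h3]
    · rcases (h.le w).lt_or_eq with hlt | heq
      · simp [h2 w hlt, hlt]; omega
      · simp [h4 w hw heq, hw, heq]
  have h6 : ∀ w, ∀ m ≤ k, ν' w < m ↔ ν w < m := by
    intro w m hm
    rcases Nat.lt_or_ge (ν w) k with hw | hw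
    · rw [h2 w hw]
    · have := (h1 w).not.2 (by omega)
      omega
  refine ⟨ν', ⟨?_, ?_, ?_, ?_⟩⟩
  · intro w
    rcases (h.le w).lt_or_eq with hlt | heq
    · rw [h2 w hlt]; omega
    · by_cases hw : w = u
      · rw [hw, h3]; omega
      · rw [h4 w hw heq]
  · have : {w | ν' w < k + 1} = insert u {w | ν w < k} := by
      ext w
      exact (h5 w).trans or_comm
    have hu' : u ∉ {w | ν w < k} := fun hmem => absurd hu (ne_of_lt hmem)
    rw [this, Set.ncard_insert_of_notMem hu' (Set.toFinite _), h.card]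
  · intro v w hv hvw
    have hw := (h5 w).1 (hvw ▸ hv)
    rcases (h5 v).1 hv with hv' | rfl <;> rcases hw with hw' | rfl
    · rw [h2 v hv', h2 w hw'] at hvw
      exact h.inj v w hv' hvw
    · rw [h2 v hv', h3] at hvw
      omega
    · rw [h2 w hw', h3] at hvw
      omega
    · rfl
  · intro v x hv hvx
    have hle : ν' v ≤ k := by omega
    have hset : ∀ y, {w | ν' w < ν' v ∧ G.Adj y w} = {w | ν w < ν' v ∧ G.Adj y w} := by
      intro y
      ext w
      exact and_congr_left fun _ => h6 w _ hle
    rw [hset, hset]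
    rcases (h5 v).1 hv with hv' | rfl
    · rw [h2 v hv']
      refine h.max v x hv' ?_
      by_contra hcon
      have := h2 x (by omega)
      rw [this, h2 v hv'] at hvx
      omega
    · rw [h3]
      refine hmax x ?_
      have := (h1 x).not.1 (by omega)
      exact le_antisymm (h.le x) (by omega)

lemma exists_isMCSOrder [Finite W] (G : SimpleGraph W) : ∃ σ, IsMCSOrder G σ := by
  have key : ∀ k ≤ Nat.card W, ∃ ν, IsPartialMCS G k ν := by
    intro k
    induction k with
    | zero => exact fun _ => ⟨fun _ => 0, ⟨by simp, by simp, by simp, by simp⟩⟩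
    | succ k ih =>
      intro hk
      obtain ⟨ν, hν⟩ := ih (by omega)
      exact hν.exists_succ hk
  obtain ⟨ν, hν⟩ := key _ le_rfl
  have hlt : ∀ w, ν w < Nat.card W := by
    have : {w | ν w < Nat.card W} = Set.univ := by
      refine Set.eq_of_subset_of_ncard_le (Set.subset_univ _) ?_ (Set.toFinite _)
      rw [hν.card, Set.ncard_univ]
    intro w
    exact (Set.ext_iff.1 this w).2 trivial
  let e : W → Fin (Nat.card W) := fun w => ⟨ν w, hlt w⟩
  have he : Function.Injective e := fun v w hvw => hν.inj v w (hlt v) (congrArg Fin.val hvw)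
  have hbij : Function.Bijective e :=
    (Nat.bijective_iff_injective_and_card e).2 ⟨he, by simp⟩
  refine ⟨Equiv.ofBijective e hbij, fun v u hvu => ?_⟩
  exact hν.max v u (hlt v) hvu

end MaximumCardinalitySearch

namespace MixedGraph

variable {V : Type*}

/-! ### Orienting the lines -/

/-- An orientation of the lines of `H` along an order `r` such that adjacent lines that are oriented
to the same node are part of a triangle. -/
structure OrientsLines (H H' : MixedGraph V) (r : V → ℕ) : Prop where
  line_free : ∀ a b, ¬ H'.line a b
  arrow_iff : ∀ a b, H'.arrow a b ↔ H.arrow a b ∨ (H.line a b ∧ r a < r b)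
  arc_iff : ∀ a b, H'.arc a b ↔ H.arc a b
  ne : ∀ a b, H.line a b → r a ≠ r b
  perfect : ∀ a b c, H.line a b → H.line c b → r a < r b → r c < r b → a ≠ c → H.line a c

/-- `v` is an endpoint of a line. -/
def OnLine (H : MixedGraph V) (v : V) : Prop := ∃ w, H.line v w

namespace OrientsLines

variable {H H' : MixedGraph V} {r : V → ℕ}

lemma adj_iff (h : H.OrientsLines H' r) {a b : V} : H'.Adj a b ↔ H.Adj a b := by
  unfold Adj
  rw [h.arrow_iff, h.arrow_iff, h.arc_iff]
  have h₁ := h.line_free a b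
  constructor
  · rintro (h' | (h' | h') | (h' | h') | h')
    exacts [absurd h' h₁, Or.inr (Or.inl h'), Or.inl h'.1, Or.inr (Or.inr (Or.inl h')),
      Or.inl (H.line_symm h'.1), Or.inr (Or.inr (Or.inr h'))]
  · rintro (h' | h' | h' | h')
    · rcases lt_or_gt_of_ne (h.ne a b h') with h₂ | h₂
      · exact Or.inr (Or.inl (Or.inr ⟨h', h₂⟩))
      · exact Or.inr (Or.inr (Or.inl (Or.inr ⟨H.line_symm h', h₂⟩)))
    · exact Or.inr (Or.inl (Or.inl h'))
    · exact Or.inr (Or.inr (Or.inl (Or.inl h')))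
    · exact Or.inr (Or.inr (Or.inr h'))

lemma arrowhead (h : H.OrientsLines H' r) {a b : V} (hab : H.Arrowhead a b) : H'.Arrowhead a b :=
  hab.imp (fun h' => (h.arrow_iff a b).2 (Or.inl h')) (h.arc_iff a b).2

lemma arrowhead_iff (h : H.OrientsLines H' r) {a b : V} (hb : ¬ H.OnLine b) :
    H'.Arrowhead a b ↔ H.Arrowhead a b := by
  refine ⟨?_, h.arrowhead⟩
  rintro (h' | h')
  · rcases (h.arrow_iff a b).1 h' with h' | h'
    exacts [Or.inl h', absurd ⟨a, H.line_symm h'.1⟩ hb]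
  · exact Or.inr ((h.arc_iff a b).1 h')

lemma line_of_arrowhead (h : H.OrientsLines H' r) (hH : H.IsAncestral) {a b : V}
    (hb : H.OnLine b) (hab : H'.Arrowhead a b) : H.line a b ∧ r a < r b := by
  obtain ⟨c, hc⟩ := hb
  rcases hab with h' | h'
  · rcases (h.arrow_iff a b).1 h' with h' | h'
    exacts [absurd hc (hH.not_line_of_arrowhead (Or.inl h')), h']
  · exact absurd hc (hH.not_line_of_arrowhead (Or.inr ((h.arc_iff a b).1 h')))

lemma ancestor (h : H.OrientsLines H' r) {a b : V} (hab : H.Ancestor a b) : H'.Ancestor a b :=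
  Relation.TransGen.mono (p := H'.arrow) (fun a b h' => (h.arrow_iff a b).2 (Or.inl h')) _ _ hab

lemma ancestor_cases (h : H.OrientsLines H' r) (hH : H.IsAncestral) {a b : V}
    (hab : H'.Ancestor a b) :
    (¬ H.OnLine a → ¬ H.OnLine b ∧ H.Ancestor a b) ∧ (H.OnLine b → H.OnLine a ∧ r a < r b) := by
  have step : ∀ {a b}, H'.arrow a b →
      (¬ H.OnLine a → ¬ H.OnLine b ∧ H.arrow a b) ∧ (H.OnLine b → H.OnLine a ∧ r a < r b) := by
    intro a b hab
    constructor
    · intro ha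
      rcases (h.arrow_iff a b).1 hab with h' | h'
      · exact ⟨fun ⟨c, hc⟩ => hH.not_line_of_arrowhead (Or.inl h') hc, h'⟩
      · exact absurd ⟨b, h'.1⟩ ha
    · intro hb
      have h' := h.line_of_arrowhead hH hb (Or.inl hab)
      exact ⟨⟨b, h'.1⟩, h'.2⟩
  induction hab with
  | single h' => exact ⟨fun ha => ⟨((step h').1 ha).1, .single ((step h').1 ha).2⟩, (step h').2⟩
  | tail _ h' ih =>
    refine ⟨fun ha => ?_, fun hb => ?_⟩
    · obtain ⟨h₁, h₂⟩ := ih.1 ha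
      obtain ⟨h₃, h₄⟩ := (step h').1 h₁
      exact ⟨h₃, h₂.tail h₄⟩
    · obtain ⟨h₁, h₂⟩ := (step h').2 hb
      obtain ⟨h₃, h₄⟩ := ih.2 h₁
      exact ⟨h₃, h₄.trans h₂⟩

lemma isAncestral (h : H.OrientsLines H' r) (hH : H.IsAncestral) : H'.IsAncestral := by
  refine ⟨fun i j hji hij => ?_, fun i hi => absurd hi.choose_spec (h.line_free _ _)⟩
  have h' := h.ancestor_cases hH hij
  by_cases hi : H.OnLine i
  · obtain ⟨h₁, h₂⟩ := h.line_of_arrowhead hH hi hji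
    have h₃ := (h'.2 ⟨i, h₁⟩).2
    omega
  · exact hH.1 i j ((h.arrowhead_iff hi).1 hji) (h'.1 hi).2

lemma anteSet (h : H.OrientsLines H' r) {C : Set V} {y : V} (hy : H.AnteSet C y) :
    H'.AnteSet C y := by
  rcases hy with hy | ⟨d, hd, hy⟩
  exacts [Or.inl hy, Or.inr ⟨d, hd, h.ancestor hy⟩]

lemma anteSet_iff (h : H.OrientsLines H' r) (hH : H.IsAncestral) {C : Set V} {y : V}
    (hn : ¬ H.OnLine y) : H'.AnteSet C y ↔ H.AnteSet C y := by
  refine ⟨?_, h.anteSet⟩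
  rintro (hy | ⟨d, hd, hy⟩)
  exacts [Or.inl hy, Or.inr ⟨d, hd, ((h.ancestor_cases hH hy).1 hn).2⟩]

lemma open_iff (h : H.OrientsLines H' r) (hH : H.IsAncestral) {C : Set V} {m : Bool} {y z : V}
    (hn : ¬ H.OnLine y) : H'.Open C m y z ↔ H.Open C m y z := by
  unfold Open
  rw [h.anteSet_iff hH hn, h.arrowhead_iff hn]

lemma collidersReduce (h : H.OrientsLines H' r) (hH : H.IsAncestral) (hr : H.CollidersReduce) :
    H'.CollidersReduce := by
  intro S i j x y hij hn hix hx hxy hjy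
  rw [h.adj_iff] at hn
  have hnl : ∀ {u v}, H.arc u v → ¬ H.OnLine v :=
    fun hu ⟨_, hw⟩ => hH.not_line_of_arrowhead (Or.inr hu) hw
  rcases Relation.ReflTransGen.cases_head hxy with rfl | ⟨u, hu, -⟩
  · exact ⟨x, hx, hix, hjy⟩
  · have hyl : ¬ H.OnLine y := by
      rcases Relation.ReflTransGen.cases_tail hxy with rfl | ⟨v, -, hv⟩
      · exact hnl (H.arc_symm ((h.arc_iff _ _).1 hu.1))
      · exact hnl ((h.arc_iff _ _).1 hv.1)
    rw [h.arrowhead_iff (hnl (H.arc_symm ((h.arc_iff _ _).1 hu.1)))] at hix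
    rw [h.arrowhead_iff hyl] at hjy
    obtain ⟨z, hz, h₁, h₂⟩ := hr S i j x y hij hn hix hx (Relation.ReflTransGen.mono
      (fun u v h' => ⟨(h.arc_iff u v).1 h'.1, h'.2⟩) _ _ hxy) hjy
    exact ⟨z, hz, h.arrowhead h₁, h.arrowhead h₂⟩

variable {C : Set V} {i : V}

/-- In the oriented graph, if a node `y ∉ C` on a line is reached, then so are the nodes that are
joined to `y` by lines: if it came from `x` and `y` would become a collider, there is a line from `x` to the
next node. -/
lemma reach_of_line (h : H.OrientsLines H' r) (hH : H.IsAncestral) (N : ℕ) : ∀ {m : Bool} {y z : V},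
    r y = N → H'.Reach C i m y → y ∉ C → H.line y z → ∃ m, H'.Reach C i m z := by
  induction N using Nat.strong_induction_on with
  | _ N ih =>
    intro m y z hN hr hy hyz
    have hyz' : H'.Adj y z := h.adj_iff.2 (Or.inl hyz)
    by_cases hzy : H'.Arrowhead z y
    · cases hr with
      | start => exact Reach.start.step hyz' (open_false hy)
      | @head mx x _ hx hxy ho =>
        obtain ⟨hl, hlt⟩ := h.line_of_arrowhead hH ⟨z, hyz⟩ hxy
        have hxC : x ∉ C :=
          ho.notMem fun h' => (h.isAncestral hH).not_arrow_of_arrowhead h'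
            ((h.arrow_iff x y).2 (Or.inr ⟨hl, hlt⟩))
        by_cases hxz : x = z
        · exact hxz ▸ ⟨_, hx⟩
        · obtain ⟨hl', hlt'⟩ := h.line_of_arrowhead hH ⟨z, hyz⟩ hzy
          exact ih _ (by omega) rfl hx hxC (h.perfect x y z hl hl' hlt hlt' hxz)
      | tail hx hxy hn ho =>
        exact (Reach.tail hx hxy hn ho).step hyz' (open_false hy)
    · exact hr.step hyz' (open_of_not_arrowhead hzy hy)

/-- As no arrowhead of `H` points to a node on a line, a walk in `H` leaves such nodes only if they
are outside `C`; the walk in `H'` can then be continued by `reach_of_line`. -/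
lemma reach_orient (h : H.OrientsLines H' r) (hH : H.IsAncestral) {m : Bool} {j : V}
    (hr : H.Reach C i m j) : ∃ m, H'.Reach C i m j := by
  have key : ∀ {m y}, H.Reach C i m y →
      (H.OnLine y → ∃ m, H'.Reach C i m y) ∧ (¬ H.OnLine y → H'.Reach C i m y) := by
    have step : ∀ {m y z}, ((H.OnLine y → ∃ m, H'.Reach C i m y) ∧
        (¬ H.OnLine y → H'.Reach C i m y)) → H.Adj y z → H.Open C m y z →
        (H.OnLine z → ∃ m, H'.Reach C i m z) ∧ (¬ H.OnLine z →
          (H.Arrowhead y z → H'.Reach C i true z) ∧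
            (¬ H.Arrowhead y z → H'.Reach C i false z)) := by
      intro m y z hP hyz ho
      have hyz' := h.adj_iff.2 hyz
      by_cases hy : H.OnLine y
      · obtain ⟨m', hm'⟩ := hP.1 hy
        have hny : ∀ x, ¬ H.Arrowhead x y := fun x hx => hH.2 y hy ⟨x, hx⟩
        have hyC := ho.notMem (hny z)
        refine ⟨fun hz => h.reach_of_line hH _ rfl hm' hyC (hH.line_of_adj hy hz hyz),
          fun hz => ?_⟩
        have hyz_arrow : H.Arrowhead y z := by
          rcases hyz with h' | h' | h' | h'
          exacts [absurd ⟨y, H.line_symm h'⟩ hz, Or.inl h', absurd (Or.inl h') (hny z), Or.inr h']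
        have hzy : ¬ H'.Arrowhead z y :=
          fun h' => hz ⟨y, (h.line_of_arrowhead hH hy h').1⟩
        exact ⟨fun _ => hm'.head (h.arrowhead hyz_arrow) (open_of_not_arrowhead hzy hyC),
          fun h' => absurd hyz_arrow h'⟩
      · have hs := (hP.2 hy).step_mark hyz' ((h.open_iff hH hy).2 ho)
        refine ⟨fun _ => (hP.2 hy).step hyz' ((h.open_iff hH hy).2 ho), fun hz => ?_⟩
        rwa [h.arrowhead_iff hz] at hs
    intro m y hr
    induction hr with
    | start => exact ⟨fun _ => ⟨_, Reach.start⟩, fun _ => Reach.start⟩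
    | head _ hyz ho ih =>
      exact (step ih hyz.adj ho).imp id fun h' hz => (h' hz).1 hyz
    | tail _ hyz hn ho ih =>
      exact (step ih hyz ho).imp id fun h' hz => (h' hz).2 hn
  by_cases hj : H.OnLine j
  · exact (key hr).1 hj
  · exact ⟨_, (key hr).2 hj⟩

lemma reach_of_orient (h : H.OrientsLines H' r) (hH : H.IsAncestral) {m : Bool} {j : V}
    (hr : H'.Reach C i m j) : ∃ m, H.Reach C i m j := by
  -- A walk that arrives at `y` along an oriented line from `x` may return to `x` in `H`, as `x`
  -- is not in `C`.
  have key : ∀ {m y}, H'.Reach C i m y →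
      (¬ H.OnLine y → H.Reach C i m y) ∧ (H.OnLine y → H.Reach C i false y ∧
        (m = true → ∃ x, H.line x y ∧ r x < r y ∧ x ∉ C ∧ H.Reach C i false x)) := by
    have step : ∀ {m y z}, ((¬ H.OnLine y → H.Reach C i m y) ∧
        (H.OnLine y → H.Reach C i false y ∧
          (m = true → ∃ x, H.line x y ∧ r x < r y ∧ x ∉ C ∧ H.Reach C i false x))) →
        H.Adj y z → H'.Open C m y z →
        (¬ H.OnLine z → (H.Arrowhead y z → H.Reach C i true z) ∧
          (¬ H.Arrowhead y z → H.Reach C i false z)) ∧ (H.OnLine z → H.Reach C i false z ∧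
            (H'.Arrowhead y z →
              ∃ x, H.line x z ∧ r x < r z ∧ x ∉ C ∧ H.Reach C i false x)) := by
      intro m y z hP hyz ho
      by_cases hy : H.OnLine y
      · obtain ⟨hr, hm⟩ := hP.2 hy
        refine ⟨fun hz => ?_, fun hz => ?_⟩
        · have hyC := ho.notMem fun h' => hz ⟨y, (h.line_of_arrowhead hH hy h').1⟩
          exact hr.step_mark hyz (open_false hyC)
        · have hl := hH.line_of_adj hy hz hyz
          have hnz : ∀ x, ¬ H.Arrowhead x z := fun x hx => hH.2 z hz ⟨x, hx⟩
          by_cases hzy : H'.Arrowhead z y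
          · have hlt := (h.line_of_arrowhead hH hy hzy).2
            refine ⟨?_, fun h' => absurd (h.line_of_arrowhead hH hz h').2 (by omega)⟩
            cases m with
            | false => exact (hr.step_mark hyz (open_false ho.of_false)).2 (hnz y)
            | true =>
              obtain ⟨x, hxy, hlt', hxC, hx⟩ := hm rfl
              by_cases hxz : x = z
              · exact hxz ▸ hx
              · exact (hx.step_mark (Or.inl (h.perfect x y z hxy (H.line_symm hl) hlt' hlt hxz))
                  (open_false hxC)).2 (hnz x)
          · have hyC := ho.notMem hzy
            exact ⟨(hr.step_mark hyz (open_false hyC)).2 (hnz y),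
              fun h' => ⟨y, hl, (h.line_of_arrowhead hH hz h').2, hyC, hr⟩⟩
      · have hs := (hP.1 hy).step_mark hyz ((h.open_iff hH hy).1 ho)
        refine ⟨fun _ => hs, fun hz => ⟨hs.2 fun h' => hH.2 z hz ⟨y, h'⟩, fun h' => ?_⟩⟩
        exact absurd ⟨z, (h.line_of_arrowhead hH hz h').1⟩ hy
    intro m y hr
    induction hr with
    | start => exact ⟨fun _ => Reach.start, fun _ => ⟨Reach.start, by simp⟩⟩
    | head _ hyz ho ih =>
      have hs := step ih (h.adj_iff.1 hyz.adj) ho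
      exact ⟨fun hz => (hs.1 hz).1 ((h.arrowhead_iff hz).1 hyz),
        fun hz => ⟨(hs.2 hz).1, fun _ => (hs.2 hz).2 hyz⟩⟩
    | tail _ hyz hn ho ih =>
      have hs := step ih (h.adj_iff.1 hyz) ho
      exact ⟨fun hz => (hs.1 hz).2 fun h' => hn ((h.arrowhead_iff hz).2 h'),
        fun hz => ⟨(hs.2 hz).1, by simp⟩⟩
  by_cases hj : H.OnLine j
  · exact ⟨_, ((key hr).2 hj).1⟩
  · exact ⟨_, (key hr).1 hj⟩

end OrientsLines

/-- A maximum cardinality search order yields an orientation of the lines without unshielded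
colliders. -/
lemma orientsLines_orientLines [Finite V] {H : MixedGraph V}
    (hch : IsChordalGraph H.lineSubgraph) {σ : H.LineNode ≃ Fin (Nat.card H.LineNode)}
    (hσ : IsMCSOrder H.lineSubgraph σ) : ∃ r, H.OrientsLines (H.orientLines σ) r := by
  classical
  let r : V → ℕ := fun v => if h : ∃ w, H.line v w then (σ ⟨v, h⟩ : ℕ) else 0
  have hr : ∀ v (h : ∃ w, H.line v w), r v = σ ⟨v, h⟩ := fun v h => dif_pos h
  refine ⟨r, fun _ _ h => h, ?_, fun _ _ => Iff.rfl, ?_, ?_⟩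
  · intro a b
    refine or_congr_right ?_
    constructor
    · rintro ⟨h, hlt⟩
      rw [hr a ⟨b, h⟩, hr b ⟨a, H.line_symm h⟩]
      exact ⟨h, hlt⟩
    · rintro ⟨h, hlt⟩
      rw [hr a ⟨b, h⟩, hr b ⟨a, H.line_symm h⟩] at hlt
      exact ⟨h, hlt⟩
  · intro a b h e
    rw [hr a ⟨b, h⟩, hr b ⟨a, H.line_symm h⟩] at e
    have := congrArg Subtype.val (σ.injective (Fin.ext e))
    simp only at this
    exact H.line_irrefl b (this ▸ h)
  · intro a b c hab hcb ha hc hac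
    rw [hr a ⟨b, hab⟩, hr b ⟨a, H.line_symm hab⟩] at ha
    rw [hr c ⟨b, hcb⟩, hr b ⟨a, H.line_symm hab⟩] at hc
    exact hσ.adj_of_adj_of_lt hch (x := ⟨a, b, hab⟩) (y := ⟨b, a, H.line_symm hab⟩)
      (z := ⟨c, b, hcb⟩) hab hcb ha hc fun e => hac (congrArg Subtype.val e)

end MixedGraph

namespace MixedGraph

variable {V : Type*}

/-! ### The algorithm -/

/-- An arc that is forced in both directions would be the inner edge of a minimal collider path or
cycle with four nodes. -/
lemma OrientsLines.orientable {H H' : MixedGraph V} {r : V → ℕ} (h : H.OrientsLines H' r)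
    (hH : H.IsMAG) (hC : H.DAGCondition) : H'.Orientable := by
  have hr := hH.collidersReduce hC
  refine ⟨h.isAncestral hH.1, h.line_free, h.collidersReduce hH.1 hr, ?_⟩
  rintro a b ⟨hab, j, hja, hnja, hjb⟩ ⟨-, m, hmb, hnmb, hma⟩
  rw [h.adj_iff] at hnja hnmb
  rw [h.arc_iff] at hab
  have hb : ¬ H.OnLine b := fun ⟨_, hw⟩ => hH.1.not_line_of_arrowhead (Or.inr hab) hw
  have ha : ¬ H.OnLine a := fun ⟨_, hw⟩ => hH.1.not_line_of_arrowhead (Or.inr (H.arc_symm hab)) hw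
  rw [h.arrowhead_iff hb] at hjb
  rw [h.arrowhead_iff ha] at hma
  have hjm : j ≠ m := by
    rintro rfl
    exact hnja hma.adj
  by_cases hadj : H.Adj j m
  · refine hC.2 ⟨j, m, [j, b, a, m], rfl, Or.inr (isMinimalColliderCycle_quadruple ?_ hjb
      (Or.inr hab) (Or.inr (H.arc_symm hab)) hma hadj hnja fun h' => hnmb h'.symm)⟩
    have hba : b ≠ a := Arrowhead.ne (Or.inr (H.arc_symm hab))
    simp [hjb.ne, hja, hjm, hba, hmb.symm, hma.ne.symm]
  · rcases hr.of_two hjm hadj hjb (H.arc_symm hab) hma with ⟨-, h'⟩ | ⟨h', -⟩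
    exacts [hnmb h'.adj, hnja h'.adj]

/-- `K` arises from `L` by replacing some of the forced arcs. -/
structure PartlyForced (L K : MixedGraph V) : Prop where
  line_free : ∀ x y, ¬ K.line x y
  of_arrow : ∀ x y, L.arrow x y → K.arrow x y
  arrow : ∀ x y, K.arrow x y → L.ArrowOrForced x y
  arc_iff : ∀ x y, K.arc x y ↔ L.arc x y ∧ ¬ K.arrow x y ∧ ¬ K.arrow y x

namespace PartlyForced

variable {L K : MixedGraph V}

lemma refl (hL : L.Orientable) : L.PartlyForced L := by
  refine ⟨hL.line_free, fun _ _ h => h, fun _ _ h => Or.inl h, fun x y => ⟨fun h => ⟨h, ?_, ?_⟩,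
    And.left⟩⟩
  · exact hL.ancestral.not_arrow_of_arrowhead (Or.inr (L.arc_symm h))
  · exact hL.ancestral.not_arrow_of_arrowhead (Or.inr h)

lemma arrowhead (h : L.PartlyForced K) {x y : V} (hxy : K.Arrowhead x y) : L.Arrowhead x y := by
  rcases hxy with h' | h'
  · exact (h.arrow x y h').arrowhead
  · exact Or.inr ((h.arc_iff x y).1 h').1

lemma adj_iff (h : L.PartlyForced K) (hL : L.Orientable) {x y : V} : K.Adj x y ↔ L.Adj x y := by
  constructor
  · rintro (h' | h' | h' | h')
    · exact absurd h' (h.line_free x y)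
    · exact (h.arrow x y h').arrowhead.adj
    · exact (h.arrow y x h').arrowhead.adj.symm
    · exact Or.inr (Or.inr (Or.inr ((h.arc_iff x y).1 h').1))
  · rintro (h' | h' | h' | h')
    · exact absurd h' (hL.line_free x y)
    · exact Or.inr (Or.inl (h.of_arrow x y h'))
    · exact Or.inr (Or.inr (Or.inl (h.of_arrow y x h')))
    · by_cases h₁ : K.arrow x y
      · exact Or.inr (Or.inl h₁)
      by_cases h₂ : K.arrow y x
      · exact Or.inr (Or.inr (Or.inl h₂))
      · exact Or.inr (Or.inr (Or.inr ((h.arc_iff x y).2 ⟨h', h₁, h₂⟩)))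

lemma replaceArc (h : L.PartlyForced K) {i k : V} (hik : K.arc i k → L.Forced i k) :
    L.PartlyForced (K.replaceArc i k) := by
  refine ⟨h.line_free, fun x y h' => Or.inl (h.of_arrow x y h'), ?_, fun x y => ?_⟩
  · rintro x y (h' | ⟨h', rfl, rfl⟩)
    exacts [h.arrow x y h', Or.inr (hik h')]
  · have h₁ := h.arc_iff x y
    have h₂ : K.arc x y ↔ K.arc y x := ⟨K.arc_symm, K.arc_symm⟩
    simp only [MixedGraph.replaceArc]
    tauto

lemma step (h : L.PartlyForced K) (hL : L.Orientable) {K' : MixedGraph V}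
    (hs : ColliderStep K K') : L.PartlyForced K' := by
  obtain ⟨i, k, j, hij, hn, hik, hjk, rfl⟩ := hs
  rw [h.adj_iff hL] at hn
  have hjk' := h.arrowhead hjk
  have hik' := ((h.arc_iff i k).1 hik).1
  have h₁ : L.PartlyForced (K.replaceArc i k) := h.replaceArc fun _ =>
    forced_of_not_adj hij.symm (fun h' => hn h'.symm) hjk' hik'
  exact h₁.replaceArc fun h' =>
    forced_of_not_adj hij hn (Or.inr hik') ((h₁.arc_iff j k).1 h').1

lemma of_reflTransGen (hL : L.Orientable) (h : Relation.ReflTransGen ColliderStep L K) :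
    L.PartlyForced K := by
  induction h with
  | refl => exact refl hL
  | tail _ hs ih => exact ih.step hL hs

/-- When no step is possible any more, all forced arcs have been replaced. -/
lemma arrow_of_forced (h : L.PartlyForced K) (hL : L.Orientable)
    (hfin : ¬ ∃ K', ColliderStep K K') {x y : V} (hxy : L.Forced x y) : K.arrow x y := by
  obtain ⟨hxy', j, hjx, hn, hjy⟩ := id hxy
  have not_back : ∀ {u v}, L.Forced u v → ¬ K.arrow v u := by
    intro u v huv h'
    rcases h.arrow v u h' with h₁ | h₁
    · exact hL.ancestral.not_arrow_of_arrowhead (Or.inr huv.1) h₁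
    · exact hL.forced_asymm _ _ huv h₁
  by_contra hcon
  have harc : K.arc x y := (h.arc_iff x y).2 ⟨hxy', hcon, not_back hxy⟩
  refine hfin ⟨_, x, y, j, hjx.symm, fun h' => hn ((h.adj_iff hL).1 h').symm, harc, ?_, rfl⟩
  rcases hjy with h' | h'
  · exact Or.inl (h.of_arrow j y h')
  · by_cases h₁ : K.arrow j y
    · exact Or.inl h₁
    · exact Or.inr ((h.arc_iff j y).2 ⟨h', h₁, not_back (forced_of_not_adj hjx.symm
        (fun h' => hn h'.symm) (Or.inr hxy') h')⟩)

end PartlyForced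

lemma ColliderStep.ncard_lt [Finite V] {K K' : MixedGraph V} (h : ColliderStep K K') :
    {p : V × V | K'.arc p.1 p.2}.ncard < {p : V × V | K.arc p.1 p.2}.ncard := by
  obtain ⟨i, k, j, -, -, hik, -, rfl⟩ := h
  refine Set.ncard_lt_ncard ⟨fun p hp => hp.1.1, fun hs => ?_⟩ (Set.toFinite _)
  have := hs (show (i, k) ∈ {p : V × V | K.arc p.1 p.2} from hik)
  exact this.1.2.1 ⟨rfl, rfl⟩

lemma not_exists_seq_colliderStep [Finite V] (s : ℕ → MixedGraph V) :
    ¬ ∀ n, ColliderStep (s n) (s (n + 1)) := by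
  intro h
  have key : ∀ n, {p : V × V | (s n).arc p.1 p.2}.ncard + n ≤
      {p : V × V | (s 0).arc p.1 p.2}.ncard := by
    intro n
    induction n with
    | zero => exact le_rfl
    | succ n ih =>
      have := (h n).ncard_lt
      omega
  have := key ({p : V × V | (s 0).arc p.1 p.2}.ncard + 1)
  omega

lemma exists_isColliderResult [Finite V] (n : ℕ) : ∀ K : MixedGraph V,
    {p : V × V | K.arc p.1 p.2}.ncard = n → ∃ K', IsColliderResult K K' := by
  induction n using Nat.strong_induction_on with
  | _ n ih =>
    intro K hn
    by_cases h : ∃ K', ColliderStep K K'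
    · obtain ⟨K', hK'⟩ := h
      obtain ⟨K'', h₁, h₂⟩ := ih _ (hn ▸ hK'.ncard_lt) K' rfl
      exact ⟨K'', Relation.ReflTransGen.head hK' h₁, h₂⟩
    · exact ⟨K, Relation.ReflTransGen.refl, h⟩

/-- Existence of topological numberings of acyclic relations. -/
lemma exists_injective_lt_of_acyclic [Finite V] {r : V → V → Prop}
    (h : ∀ x, ¬ Relation.TransGen r x x) :
    ∃ f : V → ℕ, Function.Injective f ∧ ∀ a b, r a b → f b < f a := by
  have : IsPartialOrder V (Relation.ReflTransGen fun a b => r b a) :=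
    { refl := fun _ => Relation.ReflTransGen.refl
      trans := fun _ _ _ => Relation.ReflTransGen.trans
      antisymm := by
        intro a b hab hba
        rcases Relation.reflTransGen_iff_eq_or_transGen.1 hab with h₁ | h₁
        · exact h₁.symm
        · exact absurd (Relation.transGen_swap.1 (h₁.trans_left hba)) (h a) }
  obtain ⟨s, hs, hrs⟩ := extend_partialOrder (Relation.ReflTransGen fun a b => r b a)
  have hlt : ∀ a b, s b a → b ≠ a → {x | s x b}.ncard < {x | s x a}.ncard := by
    intro a b hba hne
    refine Set.ncard_lt_ncard ⟨fun x hx => hs.trans x b a hx hba, fun hsub => ?_⟩ (Set.toFinite _)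
    exact hne (hs.antisymm b a hba (hsub (show a ∈ {x | s x a} from hs.refl a)))
  refine ⟨fun a => {x | s x a}.ncard, fun a b e => ?_, fun a b hab => hlt a b
    (hrs _ _ (Relation.ReflTransGen.single hab)) ?_⟩
  · by_contra hne
    rcases hs.total a b with h' | h'
    · exact absurd e (hlt b a h' hne).ne
    · exact absurd e.symm (hlt a b h' (Ne.symm hne)).ne
  · rintro rfl
    exact h _ (Relation.TransGen.single hab)

lemma exists_isArcOrder [Finite V] {K : MixedGraph V} {f : V → ℕ} (hf : K.IsArrowOrder f) :
    ∃ g, K.IsArcOrder f g := by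
  classical
  obtain ⟨M, hM⟩ := (Set.finite_range f).bddAbove
  replace hM : ∀ v, f v ≤ M := fun v => hM ⟨v, rfl⟩
  obtain ⟨n, ⟨e⟩⟩ := Finite.exists_equiv_fin V
  refine ⟨fun v => if v ∈ K.arrowNodes then f v else M + 1 + e v, fun v hv => if_pos hv, ?_⟩
  intro v _ w _ hvw
  by_cases hv : v ∈ K.arrowNodes <;> by_cases hw : w ∈ K.arrowNodes <;>
    simp only [hv, hw, if_true, if_false] at hvw
  · exact hf.1 hv hw hvw
  · have := hM v
    omega
  · have := hM w
    omega
  · exact e.injective (Fin.ext (by omega))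

section Output

variable {L K : MixedGraph V} {f g : V → ℕ}

lemma IsArcOrder.lt_of_arrow (hf : K.IsArrowOrder f) (hg : K.IsArcOrder f g) {a b : V}
    (hab : (K.orientArcs g).arrow a b) : g b < g a := by
  rcases hab with h | ⟨-, h⟩
  · rw [hg.1 (show a ∈ K.arrowNodes from ⟨b, Or.inl h⟩),
      hg.1 (show b ∈ K.arrowNodes from ⟨a, Or.inr h⟩)]
    exact hf.2 a b h
  · exact h

lemma isDAG_orientArcs (hl : ∀ x y, ¬ K.line x y) (hf : K.IsArrowOrder f)
    (hg : K.IsArcOrder f g) : (K.orientArcs g).IsDAG := by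
  refine ⟨hl, fun _ _ h => h, ?_⟩
  have : ∀ a b, (K.orientArcs g).Ancestor a b → g b < g a := by
    intro a b h
    induction h with
    | single h => exact IsArcOrder.lt_of_arrow hf hg h
    | tail _ h ih => exact (IsArcOrder.lt_of_arrow hf hg h).trans ih
  exact fun a h => lt_irrefl _ (this a a h)

lemma adj_orientArcs (hg : K.IsArcOrder f g) {x y : V} :
    (K.orientArcs g).Adj x y ↔ K.Adj x y := by
  constructor
  · rintro (h | (h | ⟨h, -⟩) | (h | ⟨h, -⟩) | h)
    exacts [Or.inl h, Or.inr (Or.inl h), Or.inr (Or.inr (Or.inr h)), Or.inr (Or.inr (Or.inl h)),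
      Or.inr (Or.inr (Or.inr (K.arc_symm h))), h.elim]
  · rintro (h | h | h | h)
    · exact Or.inl h
    · exact Or.inr (Or.inl (Or.inl h))
    · exact Or.inr (Or.inr (Or.inl (Or.inl h)))
    · have hne : g x ≠ g y := by
        intro e
        have := hg.2 (Or.inr ⟨y, h⟩) (Or.inr ⟨x, K.arc_symm h⟩) e
        exact K.arc_irrefl x (this ▸ h)
      rcases lt_or_gt_of_ne hne with h' | h'
      · exact Or.inr (Or.inr (Or.inl (Or.inr ⟨K.arc_symm h, h'⟩)))
      · exact Or.inr (Or.inl (Or.inr ⟨h, h'⟩))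

lemma Orientable.resolvedBy (hL : L.Orientable) (hK : IsColliderResult L K)
    (hg : K.IsArcOrder f g) : L.ResolvedBy (K.orientArcs g) := by
  have hP := PartlyForced.of_reflTransGen hL hK.1
  refine ⟨hL.ancestral, hL.line_free, hL.reduce, ?_, ?_, ?_⟩
  · intro x y
    rw [adj_orientArcs hg, hP.adj_iff hL]
  · rintro x y (h | ⟨h, -⟩)
    exacts [hP.arrowhead (Or.inl h), hP.arrowhead (Or.inr h)]
  · intro x y z hxz hn hxy hzy
    rcases hxy with h | h
    · exact Or.inl (hP.of_arrow x y h)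
    · exact Or.inl (hP.arrow_of_forced hL hK.2
        (forced_of_not_adj hxz.symm (fun h' => hn h'.symm) hzy h))

lemma Orientable.exists_isArrowOrder [Finite V] (hL : L.Orientable) (hK : IsColliderResult L K) :
    ∃ f, K.IsArrowOrder f := by
  have hP := PartlyForced.of_reflTransGen hL hK.1
  obtain ⟨f, hf, hf'⟩ := exists_injective_lt_of_acyclic (r := K.arrow) fun x hx =>
    hL.not_transGen_arrowOrForced x (Relation.TransGen.mono hP.arrow _ _ hx)
  exact ⟨f, hf.injOn, hf'⟩

end Output

lemma OrientsLines.markovEquiv [Finite V] {H L K : MixedGraph V} {r f g : V → ℕ}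
    (h : H.OrientsLines L r) (hH : H.IsAncestral) (hL : L.Orientable)
    (hK : IsColliderResult L K) (hf : K.IsArrowOrder f) (hg : K.IsArcOrder f g) :
    (K.orientArcs g).IsDAG ∧ H.MarkovEquiv (K.orientArcs g) := by
  have hP := PartlyForced.of_reflTransGen hL hK.1
  have hG := isDAG_orientArcs hP.line_free hf hg
  refine ⟨hG, markovEquiv_of_reach hH hG.isAncestral fun C i j _ => ?_⟩
  rw [← ResolvedBy.reach_iff hG (fun x y => IsArcOrder.lt_of_arrow hf hg) _ rfl
    (hL.resolvedBy hK hg)]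
  exact ⟨fun ⟨_, hr⟩ => h.reach_orient hH hr, fun ⟨_, hr⟩ => h.reach_of_orient hH hr⟩

end MixedGraph

theorem mainTheorem1 {V : Type*} [Finite V] (H : MixedGraph V) (hH : H.IsMAG) :
    ((∃ G : MixedGraph V, G.IsDAG ∧ H.MarkovEquiv G) ↔ H.DAGCondition) ∧
    -- under the condition, the algorithm can be carried through whatever choices are made,
    -- and always outputs a Markov equivalent DAG
    (H.DAGCondition →
      (∃ σ, IsMCSOrder H.lineSubgraph σ) ∧
      ∀ σ, IsMCSOrder H.lineSubgraph σ →
        (¬ ∃ s : ℕ → MixedGraph V, s 0 = H.orientLines σ ∧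
          ∀ n, MixedGraph.ColliderStep (s n) (s (n + 1))) ∧
        (∃ K, MixedGraph.IsColliderResult (H.orientLines σ) K) ∧
        ∀ K, MixedGraph.IsColliderResult (H.orientLines σ) K →
          (∃ f, K.IsArrowOrder f) ∧
          ∀ f, K.IsArrowOrder f →
            (∃ g, K.IsArcOrder f g) ∧
            ∀ g, K.IsArcOrder f g →
              (K.orientArcs g).IsDAG ∧ H.MarkovEquiv (K.orientArcs g)) := by
  have hex : ∃ σ, IsMCSOrder H.lineSubgraph σ := exists_isMCSOrder _
  have hres : ∀ K : MixedGraph V, ∃ K', MixedGraph.IsColliderResult K K' :=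
    fun K => MixedGraph.exists_isColliderResult _ K rfl
  refine ⟨⟨fun ⟨G, hG, hHG⟩ => hHG.dagCondition hH hG, fun hC => ?_⟩, fun hC => ⟨hex, ?_⟩⟩
  · obtain ⟨σ, hσ⟩ := hex
    obtain ⟨r, hr⟩ := MixedGraph.orientsLines_orientLines hC.1 hσ
    have hL := hr.orientable hH hC
    obtain ⟨K, hK⟩ := hres (H.orientLines σ)
    obtain ⟨f, hf⟩ := hL.exists_isArrowOrder hK
    obtain ⟨g, hg⟩ := MixedGraph.exists_isArcOrder hf
    exact ⟨_, hr.markovEquiv hH.1 hL hK hf hg⟩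
  · intro σ hσ
    obtain ⟨r, hr⟩ := MixedGraph.orientsLines_orientLines hC.1 hσ
    have hL := hr.orientable hH hC
    refine ⟨fun ⟨s, _, hs⟩ => MixedGraph.not_exists_seq_colliderStep s hs, hres _, fun K hK =>
      ⟨hL.exists_isArrowOrder hK, fun f hf => ⟨MixedGraph.exists_isArcOrder hf, fun g hg =>
        hr.markovEquiv hH.1 hL hK hf hg⟩⟩⟩
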